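/- **Proposition 2.1.** Let $\mathscr P(\mathbb R^n)$ be the set of measurable non-negative functions $w$ on $\mathbb R^n$ for which there are a polynomial $v$ on $\mathbb R^n$ and a constant $C$ with $w(x+y)\le C\,v(x)\,w(y)$ for all $x,y\in\mathbb R^n$. Let $m,\omega\in\mathscr P(\mathbb R^n)$ and $0<p,q\le\infty$, and write $\|g\|_{L_{p,\omega}}=\|g\,\omega\|_{L_p(\mathbb R^n)}$; for a tempered distribution this is the norm of the function that represents it, and $\infty$ if there is no such function. Fix a window $\phi\in\mathscr S(\mathbb R^n)\setminus\{0\}$. For $f\in\mathscr S'(\mathbb R^n)$ let $V_\phi f(x,\xi)=\langle f,\,M_\xi T_x\phi\rangle=\int f(y)\,\overline{\phi(y-x)}\,e^{-2\pi i y\cdot\xi}\,dy$ (the integral understood as the action of the distribution $f$), and $$\|f\|_{\mathcal M^{m,\omega}_{p,q}}=\Big(\int_{\mathbb R^n}\|V_\phi f(\cdot,\xi)\|_{L_{p,\omega}}^{q}\,m(\xi)^q\,d\xi\Big)^{1/q},\qquad \mathcal M^{m,\omega}_{p,q}=\{f\in\mathscr S'(\mathbb R^n):\|f\|_{\mathcal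 M^{m,\omega}_{p,q}}<\infty\},$$ with the essential supremum over $\xi$ if $q=\infty$. Let $\rho:\mathbb R^n\to[0,1]$ be a smooth function with $\rho(\xi)=1$ for $|\xi|_\infty\le 1/2$ and $\rho(\xi)=0$ for $|\xi|_\infty\ge 1$, where $|\xi|_\infty=\max_i|\xi_i|$. For $k\in\mathbb Z^n$ put $\sigma_k(\xi)=\rho(\xi-k)\big(\sum_{l\in\mathbb Z^n}\rho(\xi-l)\big)^{-1}$ and $\Box_k=\mathscr F^{-1}\sigma_k\mathscr F$ on $\mathscr S'(\mathbb R^n)$, where $\mathscr F f(\xi)=\int f(x)e^{-2\pi i x\cdot\xi}dx$, and let $$\|f\|_{M^{m,\omega}_{p,q}}=\Big(\sum_{k\in\mathbb Z^n}\|\Box_k f\|_{L_{p,\omega}}^{q}\,m(k)^q\Big)^{1/q},$$ with the supremum over $k$ if $q=\infty$ (and the convention $\infty\cdot 0=0$ in all these expressions). Then there is a constant $C$, which depends only on $n,p,q,m,\omega,\phi,\rho$, such that for every $f\in\mathscr S'(\mathbb R^n)$ $$\|f\|_{M^{m,\omega}_{p,q}}\le C\,\|f\|_{\mathcal M^{m,\omega}_{p,q}}\quad\text{and}\quad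 \|f\|_{\mathcal M^{m,\omega}_{p,q}}\le C\,\|f\|_{M^{m,\omega}_{p,q}}.$$ Moreover, if neither $m$ nor $\omega$ vanishes identically, then $\mathcal M^{m,\omega}_{p,q}$ is a linear subspace of $\mathscr S'(\mathbb R^n)$ and $\|\cdot\|_{M^{m,\omega}_{p,q}}$ is a quasi-norm on it: it is finite, absolutely homogeneous, zero only at $f=0$, and satisfies $\|f+g\|\le K(\|f\|+\|g\|)$ with a constant $K$ independent of $f$ and $g$. -/

import Mathlib

open MeasureTheory
open scoped SchwartzMap ENNReal NNReal

noncomputable section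

namespace ModulationSpaces

/-! ### Weights -/

/-- Weights of polynomial growth on `ℝⁿ`: (Lebesgue measurable) non-negative functions `w` such that
`w (x + y) ≤ C * v x * w y` for all `x, y`, with a constant `C` and a polynomial `v`. -/
structure IsPolyModerate {n : ℕ} (w : EuclideanSpace ℝ (Fin n) → ℝ) : Prop where
  aemeasurable : AEMeasurable w volume
  nonneg : ∀ x, 0 ≤ w x
  moderate : ∃ (v : MvPolynomial (Fin n) ℝ) (C : ℝ), ∀ x y : EuclideanSpace ℝ (Fin n),
    w (x + y) ≤ C * MvPolynomial.eval (fun i => x i) v * w y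

/-- The weighted `L_p` (quasi-)norm of a function, `(∫ |g(x) w(x)|^p dx)^(1/p)`, and the essential
supremum of `|g w|` if `p = ∞`. -/
def weightedLpNorm {n : ℕ} (p : ℝ≥0∞) (w : EuclideanSpace ℝ (Fin n) → ℝ)
    (g : EuclideanSpace ℝ (Fin n) → ℂ) : ℝ≥0∞ :=
  eLpNorm (fun x => g x * (w x : ℂ)) p volume

/-! ### The short-time Fourier transform and the modulation space -/

/-- The character `y ↦ exp (2πi ξ·y)`. -/
def character {n : ℕ} (ξ y : EuclideanSpace ℝ (Fin n)) : ℂ :=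
  Complex.exp ((2 * Real.pi * inner ℝ ξ y : ℝ) * Complex.I)

theorem hasTemperateGrowth_character {n : ℕ} (ξ : EuclideanSpace ℝ (Fin n)) :
    (character ξ).HasTemperateGrowth := by
  have h1 : (fun t : ℝ => Complex.exp (Complex.I * t)).HasTemperateGrowth := by
    refine ⟨(contDiff_const.mul Complex.ofRealCLM.contDiff).cexp, fun k => ⟨0, 1, fun t => ?_⟩⟩
    rw [norm_iteratedFDeriv_eq_norm_iteratedDeriv]
    have h2 : iteratedDeriv k (fun t : ℝ => Complex.exp (Complex.I * t))
        = fun t : ℝ => Complex.I ^ k * Complex.exp (Complex.I * t) := by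
      induction k with
      | zero => simp
      | succ k ih =>
        rw [iteratedDeriv_succ, ih]
        funext s
        have h3 : HasDerivAt (fun t : ℝ => Complex.I * (t : ℂ)) Complex.I s := by
          simpa using (Complex.ofRealCLM.hasDerivAt (x := s)).const_mul Complex.I
        rw [(h3.cexp.const_mul (Complex.I ^ k)).deriv]
        ring
    rw [h2]
    simp [mul_comm Complex.I, Complex.norm_exp_ofReal_mul_I]
  have h4 : (fun y : EuclideanSpace ℝ (Fin n) => 2 * Real.pi * inner ℝ ξ y).HasTemperateGrowth := by
    fun_prop
  have h5 := h1.comp h4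
  have h6 : character ξ
      = (fun t : ℝ => Complex.exp (Complex.I * t)) ∘ (fun y => 2 * Real.pi * inner ℝ ξ y) := by
    funext y
    simp [character, mul_comm]
  rw [h6]
  exact h5

/-- The time-frequency shift `M_ξ T_x φ`, that is `y ↦ exp (2πi ξ·y) φ(y - x)`. -/
def timeFreqShift {n : ℕ} (x ξ : EuclideanSpace ℝ (Fin n)) (φ : 𝓢(EuclideanSpace ℝ (Fin n), ℂ)) :
    𝓢(EuclideanSpace ℝ (Fin n), ℂ) :=
  SchwartzMap.smulLeftCLM ℂ (character ξ) (SchwartzMap.compSubConstCLM ℂ x φ)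

theorem timeFreqShift_apply {n : ℕ} (x ξ : EuclideanSpace ℝ (Fin n))
    (φ : 𝓢(EuclideanSpace ℝ (Fin n), ℂ)) (y : EuclideanSpace ℝ (Fin n)) :
    timeFreqShift x ξ φ y = character ξ y * φ (y - x) := by
  simp [timeFreqShift, hasTemperateGrowth_character ξ]

/-- The complex conjugate of a Schwartz function. -/
def conjSchwartz {n : ℕ} (φ : 𝓢(EuclideanSpace ℝ (Fin n), ℂ)) : 𝓢(EuclideanSpace ℝ (Fin n), ℂ) :=
  SchwartzMap.postcompCLM (𝕜 := ℝ) (Complex.conjCLE : ℂ →L[ℝ] ℂ) φ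

theorem conjSchwartz_apply {n : ℕ} (φ : 𝓢(EuclideanSpace ℝ (Fin n), ℂ))
    (y : EuclideanSpace ℝ (Fin n)) :
    conjSchwartz φ y = (starRingEnd ℂ) (φ y) := by
  simp [conjSchwartz]

/-- The short-time Fourier transform `V_φ f(x, ξ) = ⟨f, M_ξ T_x φ⟩` of a tempered distribution `f`;
the bracket is conjugate linear in its second argument, so `f` is evaluated at
`y ↦ conj (φ(y - x)) exp (-2πi ξ·y)`. -/
def stft {n : ℕ} (φ : 𝓢(EuclideanSpace ℝ (Fin n), ℂ)) (f : 𝓢'(EuclideanSpace ℝ (Fin n), ℂ))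
    (x ξ : EuclideanSpace ℝ (Fin n)) : ℂ :=
  f (conjSchwartz (timeFreqShift x ξ φ))

/-- The (quasi-)norm of the weighted modulation space with window `φ`: the `L_q` norm in `ξ`,
with weight `m`, of the `L_p` norm in `x`, with weight `ω`, of `V_φ f(x, ξ)`. The value is `∞` for
those tempered distributions that do not belong to the space. -/
def modulationNorm {n : ℕ} (p q : ℝ≥0∞) (m ω : EuclideanSpace ℝ (Fin n) → ℝ)
    (φ : 𝓢(EuclideanSpace ℝ (Fin n), ℂ)) (f : 𝓢'(EuclideanSpace ℝ (Fin n), ℂ)) : ℝ≥0∞ :=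
  eLpNorm (fun ξ : EuclideanSpace ℝ (Fin n) =>
    weightedLpNorm p ω (fun x => stft φ f x ξ) * ENNReal.ofReal (m ξ)) q volume

/-- The weighted modulation space. -/
def modulationSpace {n : ℕ} (p q : ℝ≥0∞) (m ω : EuclideanSpace ℝ (Fin n) → ℝ)
    (φ : 𝓢(EuclideanSpace ℝ (Fin n), ℂ)) : Set (𝓢'(EuclideanSpace ℝ (Fin n), ℂ)) :=
  {f | modulationNorm p q m ω φ f < ∞}

/-! ### Frequency-uniform decomposition -/

/-- The integer point `k`, as a point of `ℝⁿ`. -/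
def latticePoint {n : ℕ} (k : Fin n → ℤ) : EuclideanSpace ℝ (Fin n) :=
  WithLp.toLp 2 (fun i => (k i : ℝ))

/-- Smooth functions `ρ : ℝⁿ → [0, 1]` with `ρ(ξ) = 1` for `|ξ|_∞ ≤ 1/2` and `ρ(ξ) = 0` for
`|ξ|_∞ ≥ 1`. -/
structure IsCubeBump {n : ℕ} (ρ : EuclideanSpace ℝ (Fin n) → ℝ) : Prop where
  contDiff : ContDiff ℝ ((⊤ : ℕ∞) : WithTop ℕ∞) ρ
  mem_Icc : ∀ ξ, ρ ξ ∈ Set.Icc (0 : ℝ) 1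
  eq_one : ∀ ξ, (∀ i, |ξ i| ≤ 1 / 2) → ρ ξ = 1
  eq_zero : ∀ ξ, (∃ i, 1 ≤ |ξ i|) → ρ ξ = 0

/-- The partition of unity `σ_k(ξ) = ρ(ξ - k) / ∑_l ρ(ξ - l)`. -/
def freqCutoff {n : ℕ} (ρ : EuclideanSpace ℝ (Fin n) → ℝ) (k : Fin n → ℤ)
    (ξ : EuclideanSpace ℝ (Fin n)) : ℝ :=
  ρ (ξ - latticePoint k) / ∑' l : Fin n → ℤ, ρ (ξ - latticePoint l)

theorem hasTemperateGrowth_freqCutoff {n : ℕ} {ρ : EuclideanSpace ℝ (Fin n) → ℝ}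
    (hρ : IsCubeBump ρ) (k : Fin n → ℤ) :
    (fun ξ => (freqCutoff ρ k ξ : ℂ)).HasTemperateGrowth := by
  have hz : ∀ (l : Fin n → ℤ) (ξ : EuclideanSpace ℝ (Fin n)),
      (∃ i, 1 ≤ |ξ i - l i|) → ρ (ξ - latticePoint l) = 0 := by
    intro l ξ h
    exact hρ.eq_zero _ (by simpa [latticePoint] using h)
  have hcd : ∀ l : Fin n → ℤ,
      ContDiff ℝ ((⊤ : ℕ∞) : WithTop ℕ∞) (fun ξ => ρ (ξ - latticePoint l)) :=
    fun l => hρ.contDiff.comp (contDiff_id.sub contDiff_const)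
  -- near a given point only the lattice points of a fixed finite box contribute
  have hfin : ∀ (ξ₀ ξ : EuclideanSpace ℝ (Fin n)), ‖ξ - ξ₀‖ < 1 →
      ∀ l ∉ Fintype.piFinset (fun i => Finset.Icc (⌊ξ₀ i⌋ - 2) (⌊ξ₀ i⌋ + 3)),
        ρ (ξ - latticePoint l) = 0 := by
    intro ξ₀ ξ hξ l hl
    rw [Fintype.mem_piFinset] at hl
    push Not at hl
    obtain ⟨i, hi⟩ := hl
    refine hz l ξ ⟨i, ?_⟩
    by_contra! hlt
    apply hi
    have h1 : |ξ i - ξ₀ i| < 1 := by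
      have := PiLp.norm_apply_le (ξ - ξ₀) i
      rw [Real.norm_eq_abs] at this
      exact lt_of_le_of_lt this hξ
    rw [abs_lt] at hlt h1
    have h2 := Int.floor_le (ξ₀ i)
    have h3 := Int.lt_floor_add_one (ξ₀ i)
    rw [Finset.mem_Icc]
    constructor
    · have h4 : ((⌊ξ₀ i⌋ - 2 : ℤ) : ℝ) < (l i : ℝ) := by push_cast; linarith
      exact le_of_lt (by exact_mod_cast h4)
    · have h4 : (l i : ℝ) < ((⌊ξ₀ i⌋ + 3 : ℤ) : ℝ) := by push_cast; linarith
      exact le_of_lt (by exact_mod_cast h4)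
  have hsum : ∀ (ξ₀ ξ : EuclideanSpace ℝ (Fin n)), ‖ξ - ξ₀‖ < 1 →
      ∑' l : Fin n → ℤ, ρ (ξ - latticePoint l) =
        ∑ l ∈ Fintype.piFinset (fun i => Finset.Icc (⌊ξ₀ i⌋ - 2) (⌊ξ₀ i⌋ + 3)),
          ρ (ξ - latticePoint l) :=
    fun ξ₀ ξ hξ => tsum_eq_sum (hfin ξ₀ ξ hξ)
  have hS : ContDiff ℝ ((⊤ : ℕ∞) : WithTop ℕ∞)
      (fun ξ => ∑' l : Fin n → ℤ, ρ (ξ - latticePoint l)) := by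
    rw [contDiff_iff_contDiffAt]
    intro ξ₀
    refine ContDiffAt.congr_of_eventuallyEq
      (f := fun ξ => ∑ l ∈ Fintype.piFinset
        (fun i => Finset.Icc (⌊ξ₀ i⌋ - 2) (⌊ξ₀ i⌋ + 3)), ρ (ξ - latticePoint l))
      (ContDiff.sum fun l _ => hcd l).contDiffAt ?_
    filter_upwards [Metric.ball_mem_nhds ξ₀ one_pos] with ξ hξ
    exact hsum ξ₀ ξ (by simpa [dist_eq_norm] using hξ)
  have hpos : ∀ ξ : EuclideanSpace ℝ (Fin n), ∑' l : Fin n → ℤ, ρ (ξ - latticePoint l) ≠ 0 := by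
    intro ξ
    rw [hsum ξ ξ (by simp)]
    apply ne_of_gt
    refine Finset.sum_pos' (fun l _ => (hρ.mem_Icc _).1) ⟨fun i => round (ξ i), ?_, ?_⟩
    · by_contra hl
      have h0 := hfin ξ ξ (by simp) _ hl
      rw [hρ.eq_one _ (fun i => by simpa [latticePoint] using abs_sub_round (ξ i))] at h0
      exact one_ne_zero h0
    · rw [hρ.eq_one _ (fun i => by simpa [latticePoint] using abs_sub_round (ξ i))]
      exact one_pos
  have hσ : ContDiff ℝ ((⊤ : ℕ∞) : WithTop ℕ∞) (freqCutoff ρ k) := (hcd k).div hS hpos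
  have hσ' : ContDiff ℝ ((⊤ : ℕ∞) : WithTop ℕ∞) (fun ξ => (freqCutoff ρ k ξ : ℂ)) :=
    Complex.ofRealCLM.contDiff.comp hσ
  refine HasCompactSupport.hasTemperateGrowth ?_ hσ'
  refine HasCompactSupport.intro (isCompact_closedBall (latticePoint k) (Real.sqrt n)) ?_
  intro ξ hξ
  have : ρ (ξ - latticePoint k) = 0 := by
    apply hz
    by_contra! hlt
    apply hξ
    rw [Metric.mem_closedBall, dist_eq_norm, EuclideanSpace.norm_eq]
    apply Real.sqrt_le_sqrt
    calc ∑ i, ‖(ξ - latticePoint k) i‖ ^ 2 ≤ ∑ _i : Fin n, (1 : ℝ) := by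
          refine Finset.sum_le_sum fun i _ => ?_
          have h1 : ‖(ξ - latticePoint k) i‖ < 1 := by
            simpa [latticePoint] using hlt i
          exact pow_le_one₀ (norm_nonneg _) h1.le
      _ = n := by simp
  simp [freqCutoff, this]

/-- The frequency-uniform decomposition operator `□_k = 𝓕⁻¹ σ_k 𝓕` on tempered distributions. -/
def boxOp {n : ℕ} (ρ : EuclideanSpace ℝ (Fin n) → ℝ) (k : Fin n → ℤ)
    (f : 𝓢'(EuclideanSpace ℝ (Fin n), ℂ)) : 𝓢'(EuclideanSpace ℝ (Fin n), ℂ) :=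
  TemperedDistribution.fourierMultiplierCLM ℂ (fun ξ => (freqCutoff ρ k ξ : ℂ)) f

/-- The tempered distribution `T` is given by integration against the function `g`. -/
def IsRepresentedBy {n : ℕ} (T : 𝓢'(EuclideanSpace ℝ (Fin n), ℂ))
    (g : EuclideanSpace ℝ (Fin n) → ℂ) : Prop :=
  ∀ ψ : 𝓢(EuclideanSpace ℝ (Fin n), ℂ),
    Integrable (fun x => ψ x * g x) volume ∧ T ψ = ∫ x, ψ x * g x

/-- The weighted `L_p` (quasi-)norm of a tempered distribution: that of the (almost everywhere
unique) function which represents it, and `∞` if it is not represented by a function. -/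
def distLpNorm {n : ℕ} (p : ℝ≥0∞) (w : EuclideanSpace ℝ (Fin n) → ℝ)
    (T : 𝓢'(EuclideanSpace ℝ (Fin n), ℂ)) : ℝ≥0∞ :=
  ⨅ (g : EuclideanSpace ℝ (Fin n) → ℂ) (_ : IsRepresentedBy T g), weightedLpNorm p w g

/-- The discrete (quasi-)norm `(∑_k ‖□_k f‖_{L_{p,ω}}^q m(k)^q)^(1/q)`, with the supremum over `k`
if `q = ∞`. -/
def discreteModulationNorm {n : ℕ} (p q : ℝ≥0∞) (m ω : EuclideanSpace ℝ (Fin n) → ℝ)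
    (ρ : EuclideanSpace ℝ (Fin n) → ℝ) (f : 𝓢'(EuclideanSpace ℝ (Fin n), ℂ)) : ℝ≥0∞ :=
  if q = ∞ then
    ⨆ k : Fin n → ℤ, distLpNorm p ω (boxOp ρ k f) * ENNReal.ofReal (m (latticePoint k))
  else
    (∑' k : Fin n → ℤ,
      (distLpNorm p ω (boxOp ρ k f) * ENNReal.ofReal (m (latticePoint k))) ^ q.toReal)
        ^ (1 / q.toReal)

/-! ### Quasi-norms -/

/-- `N` is a quasi-norm on the linear space `V` of tempered distributions. -/
structure IsQuasiNormOn {n : ℕ} (V : Set (𝓢'(EuclideanSpace ℝ (Fin n), ℂ)))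
    (N : 𝓢'(EuclideanSpace ℝ (Fin n), ℂ) → ℝ≥0∞) : Prop where
  zero_mem : 0 ∈ V
  add_mem : ∀ f ∈ V, ∀ g ∈ V, f + g ∈ V
  smul_mem : ∀ (c : ℂ), ∀ f ∈ V, c • f ∈ V
  lt_top : ∀ f ∈ V, N f < ∞
  eq_zero_iff : ∀ f ∈ V, N f = 0 ↔ f = 0
  smul : ∀ (c : ℂ), ∀ f ∈ V, N (c • f) = ‖c‖ₑ * N f
  add_le : ∃ K : ℝ≥0, ∀ f ∈ V, ∀ g ∈ V, N (f + g) ≤ K * (N f + N g)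

/-- `N` and `N'` are equivalent, as extended-valued functionals on all tempered distributions;
in particular they are finite on the same distributions. -/
def AreEquivalent {n : ℕ} (N N' : 𝓢'(EuclideanSpace ℝ (Fin n), ℂ) → ℝ≥0∞) : Prop :=
  ∃ C : ℝ≥0, ∀ f, N f ≤ C * N' f ∧ N' f ≤ C * N f

end ModulationSpaces

end

/-! Both quasi-norms are instances of one functional, `stftNorm`: a mixed norm of a short-time
Fourier transform. The continuous norm uses the window `φ` and Lebesgue measure in frequency. The
discrete one uses the window `𝓕⁻ σ₀` and counting measure on the integer lattice, because `□_k f` is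
the function `x ↦ V f(x, k)` up to a unimodular factor (`isRepresentedBy_boxOp`). The claim thus
becomes that changing window and frequency measure costs only a constant.

A pair `(a, b)` is reproducing along a measure `ν` when `∫ conj(â(ξ - η)) b̂(ξ - η) dν(η) = 1` for
all `ξ`. Every Schwartz function is then a superposition of time-frequency shifts of `b`. A tempered
distribution may be moved under this integral (`map_eq_integral`), which expresses `V_γ f` as an
integral of `V_b f` (`IsReproducing.stft_eq_integral`). Its kernel consists of inner products of
time-frequency shifts and decays faster than any power, so `|V_γ f|` is dominated by averages of
`|V_b f|`. A multiple of `φ` completes `φ` to a reproducing pair for Lebesgue measure; a function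
with Fourier transform `1` on the support of `σ₀` completes `𝓕⁻ σ₀` for the lattice.

For `p, q ≥ 1`, Minkowski's inequality in time and Schur's test in frequency would finish. For
smaller exponents the same domination is needed for `r`-th powers, with `r = min(1, p, q)`. It
follows since `|V_b f|` is dominated by its own averages and grows polynomially
(`rpow_le_lintegral_rpow`); afterwards the exponents are `p / r, q / r ≥ 1`. Moderate weights are
replaced by comparable Borel ones and absorbed in the decay of the kernel.

Definiteness also comes from the reproducing formula: if `V_b f` vanishes almost everywhere, then `f
= 0`. -/

noncomputable section

namespace SchwartzMap

/-! ### Integrals of Schwartz-valued functions under continuous linear maps -/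

section WeakIntegral

universe u

variable {E F : Type u} {W : Type*} [NormedAddCommGroup E] [NormedSpace ℝ E]
  [NormedAddCommGroup F] [NormedSpace ℝ F]

/-- The map `ψ ↦ ‖x‖ ^ k • ψ x` from Schwartz functions to bounded continuous functions. -/
def weightedBCF (k : ℕ) : 𝓢(E, F) →ₗ[ℝ] BoundedContinuousFunction E F where
  toFun ψ := BoundedContinuousFunction.ofNormedAddCommGroup
    (fun x => ‖x‖ ^ k • ψ x) ((continuous_norm.pow k).smul ψ.continuous)
    (SchwartzMap.seminorm ℝ k 0 ψ)
    (fun x => by simpa [norm_smul] using ψ.norm_pow_mul_le_seminorm ℝ k x)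
  map_add' ψ χ := by ext1 x; exact smul_add _ _ _
  map_smul' c ψ := by ext1 x; exact smul_comm _ _ _

theorem weightedBCF_apply (k : ℕ) (ψ : 𝓢(E, F)) (x : E) :
    weightedBCF k ψ x = ‖x‖ ^ k • ψ x := rfl

theorem norm_weightedBCF (k : ℕ) (ψ : 𝓢(E, F)) :
    ‖weightedBCF k ψ‖ = SchwartzMap.seminorm ℝ k 0 ψ := by
  apply le_antisymm
  · refine (BoundedContinuousFunction.norm_le (apply_nonneg _ _)).2 fun x => ?_
    simpa [weightedBCF_apply, norm_smul] using ψ.norm_pow_mul_le_seminorm ℝ k x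
  · refine ψ.seminorm_le_bound ℝ k 0 (norm_nonneg _) fun x => ?_
    have := (weightedBCF k ψ).norm_coe_le_norm x
    simpa [weightedBCF_apply, norm_smul] using this

theorem seminorm_fderivCLM (k l : ℕ) (ψ : 𝓢(E, F)) :
    SchwartzMap.seminorm ℝ k l (fderivCLM ℝ E F ψ) = SchwartzMap.seminorm ℝ k (l + 1) ψ := by
  rw [seminorm_apply, seminorm_apply]
  have : ((fderivCLM ℝ E F ψ : 𝓢(E, E →L[ℝ] F)) : E → E →L[ℝ] F) = fderiv ℝ ψ := by
    ext1 x; exact fderivCLM_apply ℝ ψ x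
  rw [this]
  simp only [norm_iteratedFDeriv_fderiv]

variable [TopologicalSpace W]

theorem tendsto_seminorm_sub {h : W → 𝓢(E, F)} (hc : Continuous h) (k l : ℕ) (w₀ : W) :
    Filter.Tendsto (fun w => SchwartzMap.seminorm ℝ k l (h w - h w₀)) (nhds w₀) (nhds 0) := by
  have := ((schwartz_withSeminorms ℝ E F).tendsto_nhds h (h w₀)).1 hc.continuousAt (k, l)
  rw [Metric.tendsto_nhds]
  intro ε hε
  filter_upwards [this ε hε] with w hw
  simpa [abs_of_nonneg] using hw

theorem continuous_of_norm_le_seminorm {B : Type*} [NormedAddCommGroup B] [NormedSpace ℝ B]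
    {J : 𝓢(E, F) →ₗ[ℝ] B} {k l : ℕ} (hJ : ∀ ψ, ‖J ψ‖ = SchwartzMap.seminorm ℝ k l ψ)
    {h : W → 𝓢(E, F)} (hc : Continuous h) : Continuous fun w => J (h w) := by
  rw [continuous_iff_continuousAt]
  intro w₀
  rw [ContinuousAt, tendsto_iff_norm_sub_tendsto_zero]
  refine squeeze_zero (fun _ => norm_nonneg _) (fun w => ?_) (tendsto_seminorm_sub hc k l w₀)
  rw [← map_sub, hJ]

theorem continuous_eval_comp {h : W → 𝓢(E, F)} (hc : Continuous h) (x : E) :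
    Continuous fun w => h w x := by
  have h2 := continuous_of_norm_le_seminorm (norm_weightedBCF (E := E) (F := F) 0) hc
  have h3 : Continuous fun w => (BoundedContinuousFunction.evalCLM ℝ x) (weightedBCF 0 (h w)) :=
    (ContinuousLinearMap.continuous _).comp h2
  simpa [weightedBCF_apply] using h3

variable [MeasurableSpace W] [OpensMeasurableSpace W] [SecondCountableTopology W]
  {μ : Measure W}

theorem integrable_of_norm_eq_seminorm {B : Type*} [NormedAddCommGroup B] [NormedSpace ℝ B]
    {J : 𝓢(E, F) →ₗ[ℝ] B} {k l : ℕ} (hJ : ∀ ψ, ‖J ψ‖ = SchwartzMap.seminorm ℝ k l ψ)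
    {h : W → 𝓢(E, F)} (hc : Continuous h)
    (hi : ∀ k l : ℕ, Integrable (fun w => SchwartzMap.seminorm ℝ k l (h w)) μ) :
    Integrable (fun w => J (h w)) μ :=
  (hi k l).mono' (continuous_of_norm_le_seminorm hJ hc).aestronglyMeasurable
    (Filter.Eventually.of_forall fun _ => (hJ _).le)

theorem integrable_eval_comp {h : W → 𝓢(E, F)} (hc : Continuous h)
    (hi : ∀ k l : ℕ, Integrable (fun w => SchwartzMap.seminorm ℝ k l (h w)) μ) (x : E) :
    Integrable (fun w => h w x) μ :=
  (hi 0 0).mono' (continuous_eval_comp hc x).aestronglyMeasurable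
    (Filter.Eventually.of_forall fun w => (h w).norm_le_seminorm ℝ x)

/-- Differentiation under the integral sign: the `(0, 1)` seminorm of `h w` bounds its derivative at
all points at once, so it is an integrable majorant. -/
theorem fderivCLM_eq_integral {h : W → 𝓢(E, F)} (hc : Continuous h)
    (hi : ∀ k l : ℕ, Integrable (fun w => SchwartzMap.seminorm ℝ k l (h w)) μ)
    {s : 𝓢(E, F)} (hs : ∀ x, s x = ∫ w, h w x ∂μ) (x : E) :
    fderivCLM ℝ E F s x = ∫ w, fderivCLM ℝ E F (h w) x ∂μ := by
  have hc' : Continuous fun w => fderivCLM ℝ E F (h w) := (fderivCLM ℝ E F).continuous.comp hc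
  have h2 : HasFDerivAt (fun y => ∫ w, h w y ∂μ) (∫ w, fderivCLM ℝ E F (h w) x ∂μ) x := by
    refine hasFDerivAt_integral_of_dominated_of_fderiv_le (s := Set.univ)
      (F := fun y w => h w y) (F' := fun y w => fderivCLM ℝ E F (h w) y)
      (bound := fun w => SchwartzMap.seminorm ℝ 0 1 (h w)) Filter.univ_mem
      (Filter.Eventually.of_forall fun y => (continuous_eval_comp hc y).aestronglyMeasurable)
      (integrable_eval_comp hc hi x) (continuous_eval_comp hc' x).aestronglyMeasurable ?_
      (hi 0 1) ?_
    · refine Filter.Eventually.of_forall fun w y _ => ?_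
      rw [← seminorm_fderivCLM]
      exact norm_le_seminorm ℝ _ y
    · refine Filter.Eventually.of_forall fun w y _ => ?_
      rw [fderivCLM_apply]
      exact (h w).hasFDerivAt y
  rw [fderivCLM_apply, ← h2.fderiv, ← funext hs]

/-- Every Schwartz seminorm is the norm of a linear map into a Banach space which commutes with
absolutely convergent integrals. -/
theorem exists_model_seminorm (E : Type u) [NormedAddCommGroup E] [NormedSpace ℝ E] (k l : ℕ)
    (μ : Measure W) :
    ∀ (F : Type u) [NormedAddCommGroup F] [NormedSpace ℝ F] [CompleteSpace F],
      ∃ (B : Type u) (_ : NormedAddCommGroup B) (_ : NormedSpace ℝ B) (_ : CompleteSpace B)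
        (J : 𝓢(E, F) →ₗ[ℝ] B), (∀ ψ, ‖J ψ‖ = SchwartzMap.seminorm ℝ k l ψ) ∧
        ∀ (h : W → 𝓢(E, F)), Continuous h →
          (∀ k l : ℕ, Integrable (fun w => SchwartzMap.seminorm ℝ k l (h w)) μ) →
          ∀ s : 𝓢(E, F), (∀ x, s x = ∫ w, h w x ∂μ) → J s = ∫ w, J (h w) ∂μ := by
  -- Each derivative is traded for values in `E →L[ℝ] F`. This is why `F` stays quantified in the
  -- induction and shares a universe with `E`.
  induction l with
  | zero =>
    intro F _ _ _
    refine ⟨BoundedContinuousFunction E F, inferInstance, inferInstance, inferInstance,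
      weightedBCF k, norm_weightedBCF k, fun h hc hi s hs => ?_⟩
    ext1 x
    have e3 := ((BoundedContinuousFunction.evalCLM ℝ x).integral_comp_comm
      (integrable_of_norm_eq_seminorm (norm_weightedBCF k) hc hi)).symm
    simp only [BoundedContinuousFunction.evalCLM_apply] at e3
    rw [e3]
    simp only [weightedBCF_apply]
    rw [integral_smul, hs]
  | succ l ih =>
    intro F _ _ _
    obtain ⟨B, i1, i2, i3, J, hJ, hint⟩ := ih (E →L[ℝ] F)
    refine ⟨B, i1, i2, i3, J.comp (fderivCLM ℝ E F).toLinearMap, fun ψ => ?_,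
      fun h hc hi s hs => ?_⟩
    · rw [← seminorm_fderivCLM, ← hJ]; rfl
    · refine hint (fun w => fderivCLM ℝ E F (h w)) ((fderivCLM ℝ E F).continuous.comp hc)
        (fun k l => ?_) _ (fderivCLM_eq_integral hc hi hs)
      simpa only [seminorm_fderivCLM] using hi k (l + 1)

theorem exists_seminorm_bound {G : Type*} [NormedAddCommGroup G] [NormedSpace ℝ G]
    (f : 𝓢(E, F) →L[ℝ] G) :
    ∃ (s : Finset (ℕ × ℕ)) (C : ℝ), 0 ≤ C ∧
      ∀ ψ, ‖f ψ‖ ≤ C * ∑ i ∈ s, SchwartzMap.seminorm ℝ i.1 i.2 ψ := by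
  have hq : Continuous ((normSeminorm ℝ G).comp f.toLinearMap) :=
    continuous_norm.comp f.continuous
  obtain ⟨s, C, -, h⟩ := Seminorm.bound_of_continuous (schwartz_withSeminorms ℝ E F) _ hq
  refine ⟨s, C, C.2, fun ψ => (h ψ).trans ?_⟩
  change (C : ℝ) * _ ≤ _
  refine mul_le_mul_of_nonneg_left ?_ C.2
  refine Seminorm.finset_sup_apply_le (Finset.sum_nonneg fun i _ => apply_nonneg _ _) fun i hi => ?_
  exact Finset.single_le_sum (f := fun i : ℕ × ℕ => SchwartzMap.seminorm ℝ i.1 i.2 ψ)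
    (fun i _ => apply_nonneg _ _) hi

/-- Continuous linear maps on Schwartz space commute with absolutely convergent integrals. -/
theorem map_eq_integral [CompleteSpace F] {G : Type*} [NormedAddCommGroup G] [NormedSpace ℝ G]
    [CompleteSpace G] {h : W → 𝓢(E, F)} (hc : Continuous h)
    (hi : ∀ k l : ℕ, Integrable (fun w => SchwartzMap.seminorm ℝ k l (h w)) μ)
    {s : 𝓢(E, F)} (hs : ∀ x, s x = ∫ w, h w x ∂μ) (f : 𝓢(E, F) →L[ℝ] G) :
    Integrable (fun w => f (h w)) μ ∧ f s = ∫ w, f (h w) ∂μ := by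
  obtain ⟨t, C, hC, hf⟩ := exists_seminorm_bound f
  have hfi : Integrable (fun w => f (h w)) μ :=
    ((integrable_finsetSum t fun i _ => hi i.1 i.2).const_mul C).mono'
      (f.continuous.comp hc).aestronglyMeasurable (Filter.Eventually.of_forall fun w => hf (h w))
  refine ⟨hfi, ?_⟩
  choose Bt i1 i2 i3 J hJ hint using fun i : t => exists_model_seminorm E i.1.1 i.1.2 μ F

  -- The integral is formed in this Banach space rather than in Schwartz space. On the closure of
  -- the range of `T` the seminorm bound still controls the `G`-component by the others. The other
  -- components of `∫ T (h w)` and `T s` agree, hence so do the `G`-components.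
  let T : 𝓢(E, F) →ₗ[ℝ] G × ((i : t) → Bt i) := f.toLinearMap.prod (LinearMap.pi J)
  have hTc : Continuous fun w => T (h w) :=
    (f.continuous.comp hc).prodMk (continuous_pi fun i => continuous_of_norm_le_seminorm (hJ i) hc)
  have hJi : ∀ i, Integrable (fun w => J i (h w)) μ := fun i =>
    integrable_of_norm_eq_seminorm (hJ i) hc hi
  have hT2 : Integrable (fun w => (T (h w)).2) μ := Integrable.of_eval hJi
  have hTi : Integrable (fun w => T (h w)) μ := hfi.prodMk hT2
  let K : Submodule ℝ (G × ((i : t) → Bt i)) := (LinearMap.range T).topologicalClosure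
  have hK : IsClosed (K : Set (G × ((i : t) → Bt i))) := Submodule.isClosed_topologicalClosure _
  have : CompleteSpace K := hK.completeSpace_coe
  have hmem : ∀ ψ, T ψ ∈ K := fun ψ => subset_closure ⟨ψ, rfl⟩
  -- The integral is taken inside the complete space `K` and then carried over by the inclusion.
  have hI : ∫ w, T (h w) ∂μ ∈ K := by
    have h1 : Continuous fun w => (⟨T (h w), hmem _⟩ : K) := hTc.subtype_mk _
    have h2 : Integrable (fun w => (⟨T (h w), hmem _⟩ : K)) μ :=
      hTi.norm.mono' h1.aestronglyMeasurable (Filter.Eventually.of_forall fun w => le_rfl)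
    have h3 := K.subtypeL.integral_comp_comm h2
    have h4 : ∫ w, T (h w) ∂μ = K.subtypeL (∫ w, (⟨T (h w), hmem _⟩ : K) ∂μ) := h3
    rw [h4]
    exact Subtype.coe_prop _
  have hcl : ∀ b ∈ K, ‖b.1‖ ≤ C * ∑ i, ‖b.2 i‖ := by
    intro b hb
    have hclosed : IsClosed {b : G × ((i : t) → Bt i) | ‖b.1‖ ≤ C * ∑ i, ‖b.2 i‖} :=
      isClosed_le (by fun_prop) (by fun_prop)
    refine hclosed.closure_subset_iff.2 ?_ hb
    rintro _ ⟨ψ, rfl⟩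
    refine (hf ψ).trans (mul_le_mul_of_nonneg_left ?_ hC)
    rw [← Finset.sum_coe_sort t]
    exact Finset.sum_le_sum fun i _ => (hJ i ψ).ge
  have h5 := hcl _ (K.sub_mem hI (hmem s))
  have h6 : ∀ i, (∫ w, T (h w) ∂μ - T s).2 i = 0 := by
    intro i
    have e1 : (∫ w, T (h w) ∂μ).2 = ∫ w, (T (h w)).2 ∂μ :=
      ((ContinuousLinearMap.snd ℝ G _).integral_comp_comm hTi).symm
    have e2 : (∫ w, (T (h w)).2 ∂μ) i = ∫ w, J i (h w) ∂μ :=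
      ((ContinuousLinearMap.proj (R := ℝ) (φ := Bt) i).integral_comp_comm hT2).symm
    rw [Prod.snd_sub, Pi.sub_apply, e1, e2, sub_eq_zero]
    exact (hint i h hc hi s hs).symm
  simp only [h6, norm_zero, Finset.sum_const_zero, mul_zero] at h5
  have h7 : (∫ w, T (h w) ∂μ - T s).1 = 0 := norm_le_zero_iff.1 h5
  have e1 : (∫ w, T (h w) ∂μ).1 = ∫ w, f (h w) ∂μ :=
    ((ContinuousLinearMap.fst ℝ G _).integral_comp_comm hTi).symm
  rw [Prod.fst_sub, e1, sub_eq_zero] at h7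
  exact h7.symm

end WeakIntegral

end SchwartzMap

end

noncomputable section

namespace SchwartzMap

open FourierTransform

/-! ### Translations of Schwartz functions: polynomial bounds and joint continuity -/

section Translation

theorem one_add_norm_le_mul_sub {E : Type*} [SeminormedAddCommGroup E] (x y : E) :
    1 + ‖x‖ ≤ (1 + ‖x - y‖) * (1 + ‖y‖) := by
  have h1 : ‖x‖ ≤ ‖x - y‖ + ‖y‖ := by simpa using norm_add_le (x - y) y
  nlinarith [norm_nonneg (x - y), norm_nonneg y]

variable {E F : Type*} [NormedAddCommGroup E] [NormedSpace ℝ E]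
  [NormedAddCommGroup F] [NormedSpace ℝ F]

/-- The seminorm that controls `(1 + ‖x‖) ^ k * ‖D^l ψ x‖`. -/
def boxSeminorm (E F : Type*) [NormedAddCommGroup E] [NormedSpace ℝ E]
    [NormedAddCommGroup F] [NormedSpace ℝ F] (k l : ℕ) : Seminorm ℝ 𝓢(E, F) :=
  (2 ^ k : ℝ≥0) • (Finset.Iic (k, l)).sup (schwartzSeminormFamily ℝ E F)

theorem continuous_boxSeminorm (k l : ℕ) : Continuous (boxSeminorm E F k l) := by
  have h1 : ∀ s : Finset (ℕ × ℕ), Continuous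
      (s.sup (schwartzSeminormFamily ℝ E F) : Seminorm ℝ 𝓢(E, F)) := by
    intro s
    induction s using Finset.induction_on with
    | empty => exact continuous_const (y := (0 : ℝ))
    | insert a s _ ih =>
      rw [Finset.sup_insert]
      exact ((schwartz_withSeminorms ℝ E F).continuous_seminorm a).max ih
  exact (h1 _).const_smul (2 ^ k : ℝ≥0)

theorem one_add_pow_mul_le_boxSeminorm (k l : ℕ) (ψ : 𝓢(E, F)) (x : E) :
    (1 + ‖x‖) ^ k * ‖iteratedFDeriv ℝ l ψ x‖ ≤ boxSeminorm E F k l ψ := by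
  have := one_add_le_sup_seminorm_apply (𝕜 := ℝ) (m := (k, l)) le_rfl le_rfl ψ x
  exact this.trans (le_of_eq (by simp [boxSeminorm, NNReal.smul_def]; rfl))

theorem seminorm_translate_le (k l : ℕ) (y : E) (ψ : 𝓢(E, F)) :
    SchwartzMap.seminorm ℝ k l (compSubConstCLM ℝ y ψ)
      ≤ (1 + ‖y‖) ^ k * boxSeminorm E F k l ψ := by
  refine seminorm_le_bound ℝ k l _ (by positivity) fun x => ?_
  have h1 : ((compSubConstCLM ℝ y ψ : 𝓢(E, F)) : E → F) = fun x => ψ (x - y) := by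
    ext1 x; simp
  rw [h1, iteratedFDeriv_comp_sub]
  calc ‖x‖ ^ k * ‖iteratedFDeriv ℝ l ψ (x - y)‖
      ≤ ((1 + ‖x - y‖) * (1 + ‖y‖)) ^ k * ‖iteratedFDeriv ℝ l ψ (x - y)‖ := by
        gcongr
        linarith [one_add_norm_le_mul_sub x y]
    _ = (1 + ‖y‖) ^ k * ((1 + ‖x - y‖) ^ k * ‖iteratedFDeriv ℝ l ψ (x - y)‖) := by
        rw [mul_pow]; ring
    _ ≤ _ := by
        gcongr
        exact one_add_pow_mul_le_boxSeminorm k l ψ (x - y)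

/-- Translation is polynomially bounded with respect to every continuous seminorm. -/
theorem exists_seminorm_translate_le (q : Seminorm ℝ 𝓢(E, F)) (hq : Continuous q) :
    ∃ (A : ℕ) (q' : Seminorm ℝ 𝓢(E, F)), Continuous q' ∧
      ∀ y ψ, q (compSubConstCLM ℝ y ψ) ≤ (1 + ‖y‖) ^ A * q' ψ := by
  obtain ⟨s, C, -, h⟩ := Seminorm.bound_of_continuous (schwartz_withSeminorms ℝ E F) q hq
  refine ⟨s.sup Prod.fst, C • ∑ i ∈ s, boxSeminorm E F i.1 i.2, ?_, fun y ψ => ?_⟩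
  · refine Continuous.const_smul (M := ℝ≥0) ?_ C
    have : ∀ t : Finset (ℕ × ℕ), Continuous
        (∑ i ∈ t, boxSeminorm E F i.1 i.2 : Seminorm ℝ 𝓢(E, F)) := by
      intro t
      induction t using Finset.induction_on with
      | empty => exact continuous_const (y := (0 : ℝ))
      | insert a s ha ih =>
        rw [Finset.sum_insert ha]
        exact (continuous_boxSeminorm _ _).add ih
    exact this s
  · have hsum : ∀ t : Finset (ℕ × ℕ), (∑ i ∈ t, boxSeminorm E F i.1 i.2) ψ
        = ∑ i ∈ t, boxSeminorm E F i.1 i.2 ψ := by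
      intro t
      induction t using Finset.induction_on with
      | empty => simp
      | insert a s ha ih =>
        rw [Finset.sum_insert ha, Finset.sum_insert ha, ← ih]; rfl
    refine (h _).trans ?_
    change (C : ℝ) * _ ≤ _ * ((C : ℝ) * _)
    rw [mul_left_comm, hsum]
    refine mul_le_mul_of_nonneg_left ?_ C.2
    refine Seminorm.finset_sup_apply_le (by positivity) fun i hi => ?_
    refine (seminorm_translate_le i.1 i.2 y ψ).trans ?_
    gcongr
    · linarith [norm_nonneg y]
    · exact Finset.le_sup (f := Prod.fst) hi
    · exact Finset.single_le_sum (f := fun i : ℕ × ℕ => boxSeminorm E F i.1 i.2 ψ)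
        (fun i _ => apply_nonneg _ _) hi

/-- The mean value inequality for the `l`-th derivative on the ball of radius `‖y - y₀‖` about `x -
y₀`; this costs one more derivative, and the weight at `x` is shifted into the ball. -/
theorem seminorm_translate_sub_le (k l : ℕ) (y y₀ : E) (ψ : 𝓢(E, F)) :
    SchwartzMap.seminorm ℝ k l (compSubConstCLM ℝ y ψ - compSubConstCLM ℝ y₀ ψ)
      ≤ (1 + (‖y - y₀‖ + ‖y₀‖)) ^ k * boxSeminorm E F k (l + 1) ψ * ‖y - y₀‖ := by
  refine seminorm_le_bound ℝ k l _ (by positivity) fun x => ?_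
  have h1 : ((compSubConstCLM ℝ y ψ - compSubConstCLM ℝ y₀ ψ : 𝓢(E, F)) : E → F)
      = (fun x => ψ (x - y)) - fun x => ψ (x - y₀) := by
    ext1 x; simp
  have hd : ∀ a : E, ContDiffAt ℝ l (fun x => ψ (x - a)) x := fun a =>
    ((ψ.smooth l).comp (contDiff_id.sub contDiff_const)).contDiffAt
  rw [h1, iteratedFDeriv_sub_apply (hd y) (hd y₀), iteratedFDeriv_comp_sub, iteratedFDeriv_comp_sub]
  have h2 : ∀ u ∈ Metric.closedBall (x - y₀) ‖y - y₀‖,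
      ‖x‖ ^ k * ‖fderiv ℝ (iteratedFDeriv ℝ l ψ) u‖
        ≤ (1 + (‖y - y₀‖ + ‖y₀‖)) ^ k * boxSeminorm E F k (l + 1) ψ := by
    intro u hu
    rw [norm_fderiv_iteratedFDeriv]
    rw [mem_closedBall_iff_norm] at hu
    have h3 : ‖x - u‖ ≤ ‖y - y₀‖ + ‖y₀‖ := by
      calc ‖x - u‖ = ‖-(u - (x - y₀)) + y₀‖ := by congr 1; abel
        _ ≤ ‖-(u - (x - y₀))‖ + ‖y₀‖ := norm_add_le _ _
        _ ≤ _ := by rw [norm_neg]; gcongr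
    calc ‖x‖ ^ k * ‖iteratedFDeriv ℝ (l + 1) ψ u‖
        ≤ ((1 + (‖y - y₀‖ + ‖y₀‖)) * (1 + ‖u‖)) ^ k * ‖iteratedFDeriv ℝ (l + 1) ψ u‖ := by
          gcongr
          have := one_add_norm_le_mul_sub x u
          nlinarith [norm_nonneg u]
      _ = (1 + (‖y - y₀‖ + ‖y₀‖)) ^ k * ((1 + ‖u‖) ^ k * ‖iteratedFDeriv ℝ (l + 1) ψ u‖) := by
          rw [mul_pow]; ring
      _ ≤ _ := by
          gcongr
          exact one_add_pow_mul_le_boxSeminorm k (l + 1) ψ u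
  have hdiff : ∀ u : E, DifferentiableAt ℝ (iteratedFDeriv ℝ l ψ) u := fun u =>
    (ψ.smooth ⊤).differentiable_iteratedFDeriv (by exact_mod_cast WithTop.coe_lt_top l) u
  -- The weight `‖x‖ ^ k` is divided out to give a derivative bound on the ball, so its vanishing is
  -- treated apart.
  by_cases hx : ‖x‖ ^ k = 0
  · rw [hx, zero_mul]; positivity
  have hxpos : 0 < ‖x‖ ^ k := lt_of_le_of_ne (by positivity) (Ne.symm hx)
  have h4 := (convex_closedBall (x - y₀) ‖y - y₀‖).norm_image_sub_le_of_norm_fderiv_le (𝕜 := ℝ)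
    (f := iteratedFDeriv ℝ l ψ)
    (C := (1 + (‖y - y₀‖ + ‖y₀‖)) ^ k * boxSeminorm E F k (l + 1) ψ / ‖x‖ ^ k)
    (fun u _ => hdiff u) (fun u hu => by
      rw [le_div_iff₀ hxpos, mul_comm]
      exact h2 u hu)
    (x := x - y₀) (y := x - y) (by simp) (by
      rw [mem_closedBall_iff_norm, ← norm_neg]
      apply le_of_eq; congr 1; abel)
  have h5 : x - y - (x - y₀) = -(y - y₀) := by abel
  rw [h5, norm_neg, div_mul_eq_mul_div, le_div_iff₀ hxpos, mul_comm] at h4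
  exact h4

/-- Translation is jointly continuous. -/
theorem continuous_translate :
    Continuous fun w : E × 𝓢(E, F) => compSubConstCLM ℝ w.1 w.2 := by
  rw [continuous_iff_continuousAt]
  rintro ⟨y₀, ψ₀⟩
  refine ((schwartz_withSeminorms ℝ E F).tendsto_nhds _ _).2 fun i ε hε => ?_
  have h1 : Filter.Tendsto (fun w : E × 𝓢(E, F) =>
      (1 + ‖w.1‖) ^ i.1 * boxSeminorm E F i.1 i.2 (w.2 - ψ₀)
      + (1 + (‖w.1 - y₀‖ + ‖y₀‖)) ^ i.1 * boxSeminorm E F i.1 (i.2 + 1) ψ₀ * ‖w.1 - y₀‖)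
      (nhds (y₀, ψ₀)) (nhds 0) := by
    have hc : Continuous (fun w : E × 𝓢(E, F) =>
      (1 + ‖w.1‖) ^ i.1 * boxSeminorm E F i.1 i.2 (w.2 - ψ₀)
      + (1 + (‖w.1 - y₀‖ + ‖y₀‖)) ^ i.1 * boxSeminorm E F i.1 (i.2 + 1) ψ₀ * ‖w.1 - y₀‖) := by
      have := (continuous_boxSeminorm (E := E) (F := F) i.1 i.2).comp
        ((continuous_snd (X := E)).sub (continuous_const (y := ψ₀)))
      refine ((by fun_prop : Continuous fun w : E × 𝓢(E, F) => (1 + ‖w.1‖) ^ i.1).mul this).add ?_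
      fun_prop
    convert! hc.tendsto (y₀, ψ₀) using 2
    simp
  filter_upwards [h1.eventually (gt_mem_nhds hε)] with w hw
  refine lt_of_le_of_lt ?_ hw
  -- The change of function is handled by the bound locally uniform in the shift, the change of
  -- shift by the Lipschitz bound at the fixed `ψ₀`.
  have h2 : compSubConstCLM ℝ w.1 w.2 - compSubConstCLM ℝ y₀ ψ₀
      = compSubConstCLM ℝ w.1 (w.2 - ψ₀)
        + (compSubConstCLM ℝ w.1 ψ₀ - compSubConstCLM ℝ y₀ ψ₀) := by
    rw [map_sub]; abel
  rw [h2]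
  exact (map_add_le_add _ _ _).trans (add_le_add (seminorm_translate_le _ _ _ _)
    (seminorm_translate_sub_le _ _ _ _ _))

end Translation

end SchwartzMap

end

noncomputable section

namespace ModulationSpaces

open FourierTransform SchwartzMap

variable {n : ℕ}

local notation "𝔼" => EuclideanSpace ℝ (Fin n)

/-! ### Characters -/

theorem character_comm (ξ y : 𝔼) : character ξ y = character y ξ := by
  simp [character, real_inner_comm]

theorem character_add_right (ξ x y : 𝔼) :
    character ξ (x + y) = character ξ x * character ξ y := by
  rw [character, character, character, ← Complex.exp_add]
  congr 1
  rw [inner_add_right]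
  push_cast
  ring

theorem character_add_left (ξ η y : 𝔼) :
    character (ξ + η) y = character ξ y * character η y := by
  rw [character_comm, character_add_right, character_comm y, character_comm y]

theorem conj_character (ξ y : 𝔼) : (starRingEnd ℂ) (character ξ y) = character (-ξ) y := by
  rw [character, character, ← Complex.exp_conj, map_mul, Complex.conj_ofReal, Complex.conj_I,
    inner_neg_left]
  congr 1
  push_cast
  ring

theorem character_neg_right (ξ y : 𝔼) : character ξ (-y) = character (-ξ) y := by
  simp [character]

@[simp]
theorem norm_character (ξ y : 𝔼) : ‖character ξ y‖ = 1 := by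
  rw [character]
  exact Complex.norm_exp_ofReal_mul_I _

@[simp]
theorem character_zero_left (y : 𝔼) : character 0 y = 1 := by
  simp [character]

theorem continuous_character : Continuous fun w : 𝔼 × 𝔼 => character w.1 w.2 := by
  unfold character
  fun_prop

theorem continuous_character_comp {X : Type*} [TopologicalSpace X] {a b : X → 𝔼}
    (ha : Continuous a) (hb : Continuous b) : Continuous fun t => character (a t) (b t) :=
  continuous_character.comp (ha.prodMk hb)

theorem fourier_eq_integral (g : 𝓢(𝔼, ℂ)) (u : 𝔼) :
    𝓕 g u = ∫ t, character (-u) t * g t := by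
  rw [fourier_coe, Real.fourier_eq']
  refine integral_congr_ae (Filter.Eventually.of_forall fun t => ?_)
  simp only [character, smul_eq_mul, inner_neg_left, real_inner_comm]
  congr 3
  push_cast
  ring

theorem fourierInv_eq_integral (g : 𝓢(𝔼, ℂ)) (u : 𝔼) :
    𝓕⁻ g u = ∫ t, character u t * g t := by
  rw [fourierInv_apply_eq]
  simp [fourier_eq_integral]

/-! ### Time-frequency shifts -/

theorem norm_timeFreqShift_apply (x ξ : 𝔼) (φ : 𝓢(𝔼, ℂ)) (t : 𝔼) :
    ‖timeFreqShift x ξ φ t‖ = ‖φ (t - x)‖ := by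
  rw [timeFreqShift_apply, norm_mul, norm_character, one_mul]

theorem fourier_timeFreqShift_eq_translate (x ξ : 𝔼) (φ : 𝓢(𝔼, ℂ)) :
    𝓕 (timeFreqShift x ξ φ) = compSubConstCLM ℝ ξ (𝓕 (compSubConstCLM ℝ x φ)) := by
  ext u
  rw [compSubConstCLM_apply, fourier_eq_integral, fourier_eq_integral]
  refine integral_congr_ae (Filter.Eventually.of_forall fun t => ?_)
  simp only [timeFreqShift_apply, compSubConstCLM_apply]
  rw [← mul_assoc, ← character_add_left]
  congr 2
  abel

theorem fourier_timeFreqShift_apply (x ξ : 𝔼) (φ : 𝓢(𝔼, ℂ)) (u : 𝔼) :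
    𝓕 (timeFreqShift x ξ φ) u = character (-(u - ξ)) x * 𝓕 φ (u - ξ) := by
  rw [fourier_timeFreqShift_eq_translate, compSubConstCLM_apply, fourier_eq_integral,
    fourier_eq_integral, ← integral_const_mul,
    ← integral_sub_right_eq_self (fun t => character (-(u - ξ)) x *
      (character (-(u - ξ)) t * φ t)) x]
  refine integral_congr_ae (Filter.Eventually.of_forall fun t => ?_)
  simp only [compSubConstCLM_apply]
  rw [← mul_assoc, ← character_add_right]
  congr 2
  abel

theorem norm_fourier_timeFreqShift_apply (x ξ : 𝔼) (φ : 𝓢(𝔼, ℂ)) (u : 𝔼) :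
    ‖𝓕 (timeFreqShift x ξ φ) u‖ = ‖𝓕 φ (u - ξ)‖ := by
  rw [fourier_timeFreqShift_apply, norm_mul, norm_character, one_mul]

/-- Modulation is translation on the Fourier side. Continuity and seminorm bounds for time-frequency
shifts thereby reduce to those for translations. -/
theorem timeFreqShift_eq (x ξ : 𝔼) (φ : 𝓢(𝔼, ℂ)) :
    timeFreqShift x ξ φ = 𝓕⁻ (compSubConstCLM ℝ ξ (𝓕 (compSubConstCLM ℝ x φ))) := by
  rw [← fourier_timeFreqShift_eq_translate, fourierInv_fourier_eq]

theorem timeFreqShift_zero_zero (φ : 𝓢(𝔼, ℂ)) : timeFreqShift 0 0 φ = φ := by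
  ext t
  simp [timeFreqShift_apply]

/-- Complex conjugation of Schwartz functions as a real-linear continuous map. -/
def conjCLM (n : ℕ) :
    𝓢(EuclideanSpace ℝ (Fin n), ℂ) →L[ℝ] 𝓢(EuclideanSpace ℝ (Fin n), ℂ) :=
  SchwartzMap.postcompCLM (𝕜 := ℝ) (Complex.conjCLE : ℂ →L[ℝ] ℂ)

theorem continuous_timeFreqShift (φ : 𝓢(𝔼, ℂ)) :
    Continuous fun w : 𝔼 × 𝔼 => timeFreqShift w.1 w.2 φ := by
  simp_rw [timeFreqShift_eq]
  have h1 : Continuous fun w : 𝔼 × 𝔼 => 𝓕 (compSubConstCLM ℝ w.1 φ) :=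
    (fourierCLM ℝ 𝓢(𝔼, ℂ)).continuous.comp
      (continuous_translate.comp (continuous_fst.prodMk continuous_const))
  exact (fourierInvCLM ℝ 𝓢(𝔼, ℂ)).continuous.comp
    (continuous_translate.comp (continuous_snd.prodMk h1))

theorem continuous_conjSchwartz_timeFreqShift (φ : 𝓢(𝔼, ℂ)) :
    Continuous fun w : 𝔼 × 𝔼 => conjSchwartz (timeFreqShift w.1 w.2 φ) :=
  (conjCLM n).continuous.comp (continuous_timeFreqShift φ)

/-- Time-frequency shifts are polynomially bounded with respect to every continuous seminorm. -/
theorem exists_seminorm_conjSchwartz_timeFreqShift_le (q : Seminorm ℝ 𝓢(𝔼, ℂ)) (hq : Continuous q)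
    (φ : 𝓢(𝔼, ℂ)) : ∃ (A : ℕ) (C : ℝ), 0 ≤ C ∧ ∀ x ξ : 𝔼,
      q (conjSchwartz (timeFreqShift x ξ φ)) ≤ C * ((1 + ‖x‖) * (1 + ‖ξ‖)) ^ A := by
  -- The translation bound is used twice: for the frequency shift, on the Fourier side, and then for
  -- the time shift, with the seminorm `q₁` so produced.
  obtain ⟨A₁, q₁, hq₁, h₁⟩ := exists_seminorm_translate_le
    ((q.comp (conjCLM n).toLinearMap).comp (fourierInvCLM ℝ 𝓢(𝔼, ℂ)).toLinearMap)
    (hq.comp ((conjCLM n).continuous.comp (fourierInvCLM ℝ 𝓢(𝔼, ℂ)).continuous))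
  obtain ⟨A₂, q₂, -, h₂⟩ := exists_seminorm_translate_le
    (q₁.comp (fourierCLM ℝ 𝓢(𝔼, ℂ)).toLinearMap)
    (hq₁.comp (fourierCLM ℝ 𝓢(𝔼, ℂ)).continuous)
  refine ⟨max A₁ A₂, q₂ φ, apply_nonneg _ _, fun x ξ => ?_⟩
  have e1 := h₁ ξ (𝓕 (compSubConstCLM ℝ x φ))
  have e2 := h₂ x φ
  have e3 : ((q.comp (conjCLM n).toLinearMap).comp (fourierInvCLM ℝ 𝓢(𝔼, ℂ)).toLinearMap)
      (compSubConstCLM ℝ ξ (𝓕 (compSubConstCLM ℝ x φ)))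
      = q (conjSchwartz (timeFreqShift x ξ φ)) := by
    rw [timeFreqShift_eq]; rfl
  rw [e3] at e1
  calc q (conjSchwartz (timeFreqShift x ξ φ))
      ≤ (1 + ‖ξ‖) ^ A₁ * q₁ (𝓕 (compSubConstCLM ℝ x φ)) := e1
    _ ≤ (1 + ‖ξ‖) ^ A₁ * ((1 + ‖x‖) ^ A₂ * q₂ φ) := by
        gcongr
        exact e2
    _ ≤ (1 + ‖ξ‖) ^ max A₁ A₂ * ((1 + ‖x‖) ^ max A₁ A₂ * q₂ φ) := by
        gcongr
        · linarith [norm_nonneg ξ]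
        · exact le_max_left _ _
        · linarith [norm_nonneg x]
        · exact le_max_right _ _
    _ = _ := by rw [mul_pow]; ring

theorem continuous_stft (φ : 𝓢(𝔼, ℂ)) (f : 𝓢'(𝔼, ℂ)) :
    Continuous fun w : 𝔼 × 𝔼 => stft φ f w.1 w.2 :=
  (ContinuousLinearMap.continuous f).comp (continuous_conjSchwartz_timeFreqShift φ)

/-- A tempered distribution as a real-linear continuous map. -/
def realLinear (f : 𝓢'(𝔼, ℂ)) : 𝓢(𝔼, ℂ) →L[ℝ] ℂ where
  toFun := f
  map_add' := map_add f
  map_smul' c ψ := by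
    rw [show c • ψ = (c : ℂ) • ψ from by ext; simp, map_smul]
    simp
  cont := ContinuousLinearMap.continuous f

theorem exists_norm_stft_le (φ : 𝓢(𝔼, ℂ)) (f : 𝓢'(𝔼, ℂ)) :
    ∃ (A : ℕ) (C : ℝ), 0 ≤ C ∧ ∀ x ξ : 𝔼,
      ‖stft φ f x ξ‖ ≤ C * ((1 + ‖x‖) * (1 + ‖ξ‖)) ^ A :=
  exists_seminorm_conjSchwartz_timeFreqShift_le
    ((normSeminorm ℝ ℂ).comp (realLinear f).toLinearMap)
    (continuous_norm.comp (realLinear f).continuous) φ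

/-! ### Decay of inner products of time-frequency shifts -/

theorem exists_one_add_pow_mul_norm_le (γ : 𝓢(𝔼, ℂ)) (N : ℕ) :
    ∃ C : ℝ, 0 ≤ C ∧ ∀ t, (1 + ‖t‖) ^ N * ‖γ t‖ ≤ C :=
  ⟨boxSeminorm 𝔼 ℂ N 0 γ, apply_nonneg _ _, fun t => by
    simpa using one_add_pow_mul_le_boxSeminorm N 0 γ t⟩

theorem integrable_one_add_pow_mul_norm (γ : 𝓢(𝔼, ℂ)) (N : ℕ) :
    Integrable fun t => (1 + ‖t‖) ^ N * ‖γ t‖ := by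
  have h1 : (fun t => (1 + ‖t‖) ^ N * ‖γ t‖)
      = fun t => ∑ i ∈ Finset.range (N + 1), (N.choose i : ℝ) * (‖t‖ ^ i * ‖γ t‖) := by
    ext1 t
    rw [add_comm, add_pow, Finset.sum_mul]
    refine Finset.sum_congr rfl fun i _ => ?_
    simp; ring
  rw [h1]
  exact integrable_finsetSum _ fun i _ => (γ.integrable_pow_mul volume i).const_mul _

/-- Only the moduli of `U` and `V` enter, so one estimate serves time-frequency shifts and their
Fourier transforms alike. -/
theorem exists_norm_integral_translates_le (γ a : 𝓢(𝔼, ℂ)) (N : ℕ) :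
    ∃ C : ℝ, 0 ≤ C ∧ ∀ (x y : 𝔼) (U V : 𝔼 → ℂ), (∀ t, ‖U t‖ = ‖γ (t - x)‖) →
      (∀ t, ‖V t‖ = ‖a (t - y)‖) →
      (1 + ‖x - y‖) ^ N * ‖∫ t, (starRingEnd ℂ) (V t) * U t‖ ≤ C := by
  obtain ⟨C, hC, ha⟩ := exists_one_add_pow_mul_norm_le a N
  refine ⟨C * ∫ t, (1 + ‖t‖) ^ N * ‖γ t‖, by positivity, fun x y U V hU hV => ?_⟩
  rw [← integral_sub_right_eq_self (fun t => (1 + ‖t‖) ^ N * ‖γ t‖) x, ← integral_const_mul]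
  have h0 : (1 + ‖x - y‖) ^ N * ‖∫ t, (starRingEnd ℂ) (V t) * U t‖
      = ‖∫ t, (((1 + ‖x - y‖) ^ N : ℝ) : ℂ) * ((starRingEnd ℂ) (V t) * U t)‖ := by
    rw [integral_const_mul, norm_mul, Complex.norm_real, Real.norm_of_nonneg (by positivity)]
  rw [h0]
  refine norm_integral_le_of_norm_le
    (((integrable_one_add_pow_mul_norm γ N).comp_sub_right x).const_mul C)
    (Filter.Eventually.of_forall fun t => ?_)
  rw [norm_mul, norm_mul, Complex.norm_real, RCLike.norm_conj, hU, hV,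
    Real.norm_of_nonneg (by positivity)]
  have h1 : 1 + ‖x - y‖ ≤ (1 + ‖t - y‖) * (1 + ‖t - x‖) := by
    have := one_add_norm_le_mul_sub (x - y) (x - t)
    rwa [show x - y - (x - t) = t - y by abel, norm_sub_rev x t] at this
  calc (1 + ‖x - y‖) ^ N * (‖a (t - y)‖ * ‖γ (t - x)‖)
      ≤ ((1 + ‖t - y‖) * (1 + ‖t - x‖)) ^ N * (‖a (t - y)‖ * ‖γ (t - x)‖) := by gcongr
    _ = ((1 + ‖t - y‖) ^ N * ‖a (t - y)‖) * ((1 + ‖t - x‖) ^ N * ‖γ (t - x)‖) := by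
        rw [mul_pow]; ring
    _ ≤ _ := by
        gcongr
        exact ha _

/-- The `L₂` inner product of `u` and `v`, conjugate linear in the second argument. -/
def schwartzInner (u v : 𝓢(𝔼, ℂ)) : ℂ := ∫ t, (starRingEnd ℂ) (v t) * u t

theorem schwartzInner_fourier (u v : 𝓢(𝔼, ℂ)) :
    schwartzInner (𝓕 u) (𝓕 v) = schwartzInner u v := by
  have := integral_inner_fourier_fourier v u
  simpa [schwartzInner, RCLike.inner_apply, mul_comm] using this

/-- Decay in `x - y` is seen on the time side, decay in `ξ - η` after Plancherel. Each is taken to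
order `2 * N`, since a product of `N`-th powers is at most the sum of their squares. -/
theorem exists_norm_schwartzInner_timeFreqShift_le (γ a : 𝓢(𝔼, ℂ)) (N : ℕ) :
    ∃ C : ℝ, 0 ≤ C ∧ ∀ x ξ y η : 𝔼,
      ((1 + ‖x - y‖) * (1 + ‖ξ - η‖)) ^ N
        * ‖schwartzInner (timeFreqShift x ξ γ) (timeFreqShift y η a)‖ ≤ C := by
  obtain ⟨C₁, hC₁, h₁⟩ := exists_norm_integral_translates_le γ a (2 * N)
  obtain ⟨C₂, hC₂, h₂⟩ := exists_norm_integral_translates_le (𝓕 γ) (𝓕 a) (2 * N)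
  refine ⟨C₁ + C₂, by positivity, fun x ξ y η => ?_⟩
  have e1 := h₁ x y _ _ (norm_timeFreqShift_apply x ξ γ) (norm_timeFreqShift_apply y η a)
  have e2 := h₂ ξ η _ _ (norm_fourier_timeFreqShift_apply x ξ γ)
    (norm_fourier_timeFreqShift_apply y η a)
  have e3 := schwartzInner_fourier (timeFreqShift x ξ γ) (timeFreqShift y η a)
  unfold schwartzInner at e3 ⊢
  rw [e3] at e2
  set D := ‖∫ t, (starRingEnd ℂ) (timeFreqShift y η a t) * timeFreqShift x ξ γ t‖
  have h3 : 0 ≤ D := norm_nonneg _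
  rw [pow_mul'] at e1 e2
  rw [mul_pow]
  nlinarith [mul_nonneg h3 (sq_nonneg ((1 + ‖x - y‖) ^ N - (1 + ‖ξ - η‖) ^ N))]

end ModulationSpaces

end

noncomputable section

namespace ModulationSpaces

open FourierTransform SchwartzMap

variable {n : ℕ}

local notation "𝔼" => EuclideanSpace ℝ (Fin n)

/-! ### Reproducing formulas for the short-time Fourier transform -/

/-- Measures whose translates integrate a fixed negative power of `1 + ‖ξ‖` uniformly. -/
def UniformlyFinite (ν : Measure 𝔼) : Prop :=
  ∃ (N : ℕ) (C : ℝ≥0), ∀ ξ : 𝔼, ∫⁻ η, ((1 + ‖ξ - η‖ₑ) ^ N)⁻¹ ∂ν ≤ C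

theorem enorm_inv_one_add_pow (x : 𝔼) (N : ℕ) :
    ‖((1 + ‖x‖) ^ N)⁻¹‖ₑ = ((1 + ‖x‖ₑ) ^ N)⁻¹ := by
  have h1 : ‖(1 + ‖x‖ : ℝ)‖ₑ = 1 + ‖x‖ₑ := by
    rw [Real.enorm_of_nonneg (by positivity), ENNReal.ofReal_add zero_le_one (norm_nonneg _),
      ENNReal.ofReal_one, ofReal_norm]
  rw [enorm_inv (by positivity), enorm_pow, h1]

theorem UniformlyFinite.exists_integrable {ν : Measure 𝔼} (hν : UniformlyFinite ν) :
    ∃ N₀ : ℕ, ∀ N ≥ N₀, Integrable (fun η : 𝔼 => ((1 + ‖η‖) ^ N)⁻¹) ν := by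
  obtain ⟨N₀, C, h⟩ := hν
  have hm : ∀ N : ℕ, Continuous fun η : 𝔼 => ((1 + ‖η‖) ^ N)⁻¹ := fun N =>
    Continuous.inv₀ (by fun_prop) fun η => by positivity
  have h0 : Integrable (fun η : 𝔼 => ((1 + ‖η‖) ^ N₀)⁻¹) ν := by
    refine ⟨(hm N₀).aestronglyMeasurable, ?_⟩
    rw [HasFiniteIntegral]
    simp_rw [enorm_inv_one_add_pow]
    have := h 0
    simp_rw [zero_sub, enorm_neg] at this
    exact this.trans_lt ENNReal.coe_lt_top
  refine ⟨N₀, fun N hN => h0.mono' (hm N).aestronglyMeasurable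
    (Filter.Eventually.of_forall fun η => ?_)⟩
  rw [Real.norm_of_nonneg (by positivity)]
  gcongr
  linarith [norm_nonneg η]

theorem UniformlyFinite.exists_integrable_prod {μ ν : Measure 𝔼} [SFinite μ] [SFinite ν]
    (hμ : UniformlyFinite μ) (hν : UniformlyFinite ν) :
    ∃ N₀ : ℕ, Integrable (fun w : 𝔼 × 𝔼 => (((1 + ‖w.1‖) * (1 + ‖w.2‖)) ^ N₀)⁻¹) (μ.prod ν) := by
  obtain ⟨N₁, h₁⟩ := hμ.exists_integrable
  obtain ⟨N₂, h₂⟩ := hν.exists_integrable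
  refine ⟨max N₁ N₂, ?_⟩
  have := (h₁ _ (le_max_left N₁ N₂)).mul_prod (h₂ _ (le_max_right N₁ N₂))
  refine this.congr (Filter.Eventually.of_forall fun w => ?_)
  simp only [mul_pow, mul_inv]

theorem uniformlyFinite_volume : UniformlyFinite (volume : Measure 𝔼) := by
  refine ⟨n + 1, (∫⁻ η : 𝔼, ((1 + ‖η‖ₑ) ^ (n + 1))⁻¹).toNNReal, fun ξ => ?_⟩
  have h1 : ∫⁻ η : 𝔼, ((1 + ‖η‖ₑ) ^ (n + 1))⁻¹ < ∞ := by
    have h2 := finite_integral_one_add_norm (E := 𝔼) (μ := volume) (r := n + 1) (by simp)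
    refine lt_of_le_of_lt (lintegral_mono fun η => ?_) h2
    rw [← enorm_inv_one_add_pow, Real.enorm_of_nonneg (by positivity),
      Real.rpow_neg (by positivity)]
    exact_mod_cast le_rfl
  rw [lintegral_sub_left_eq_self (fun η : 𝔼 => ((1 + ‖η‖ₑ) ^ (n + 1))⁻¹) ξ,
    ENNReal.coe_toNNReal h1.ne]

theorem schwartzInner_eq_stft (g a : 𝓢(𝔼, ℂ)) (y η : 𝔼) :
    schwartzInner g (timeFreqShift y η a)
      = stft a (toTemperedDistributionCLM 𝔼 ℂ volume g) y η := by
  refine Eq.trans ?_ (toTemperedDistributionCLM_apply_apply volume g _).symm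
  simp [schwartzInner, conjSchwartz_apply]

theorem continuous_schwartzInner (g a : 𝓢(𝔼, ℂ)) :
    Continuous fun w : 𝔼 × 𝔼 => schwartzInner g (timeFreqShift w.1 w.2 a) := by
  simp_rw [schwartzInner_eq_stft]
  exact continuous_stft a _

theorem exists_norm_schwartzInner_le (g a : 𝓢(𝔼, ℂ)) (N : ℕ) :
    ∃ C : ℝ, 0 ≤ C ∧ ∀ w : 𝔼 × 𝔼, ‖schwartzInner g (timeFreqShift w.1 w.2 a)‖
      ≤ C * (((1 + ‖w.1‖) * (1 + ‖w.2‖)) ^ N)⁻¹ := by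
  obtain ⟨C, hC, h⟩ := exists_norm_schwartzInner_timeFreqShift_le g a N
  refine ⟨C, hC, fun w => ?_⟩
  have := h 0 0 w.1 w.2
  rw [timeFreqShift_zero_zero, zero_sub, zero_sub, norm_neg, norm_neg] at this
  rw [← div_eq_mul_inv, le_div_iff₀ (by positivity), mul_comm]
  exact this

/-- Plancherel writes the coefficient as a frequency integral; after Fubini the integral over `y` is
the Fourier transform of `b` at `ξ - η`. -/
theorem integral_schwartzInner_mul_timeFreqShift (g a b : 𝓢(𝔼, ℂ)) (η x : 𝔼) :
    ∫ y, schwartzInner g (timeFreqShift y η a) * timeFreqShift y η b x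
      = ∫ ξ, character x ξ * (𝓕 g ξ * ((starRingEnd ℂ) (𝓕 a (ξ - η)) * 𝓕 b (ξ - η))) := by
  have h1 : ∀ y, schwartzInner g (timeFreqShift y η a) * timeFreqShift y η b x
      = ∫ ξ, character (ξ - η) y * ((starRingEnd ℂ) (𝓕 a (ξ - η)) * 𝓕 g ξ)
          * (character η x * b (x - y)) := by
    intro y
    rw [← schwartzInner_fourier, schwartzInner, ← integral_mul_const]
    refine integral_congr_ae (Filter.Eventually.of_forall fun ξ => ?_)
    simp only [fourier_timeFreqShift_apply, map_mul, conj_character, neg_neg,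
      timeFreqShift_apply]
    ring
  have h2 : Integrable (Function.uncurry fun y ξ =>
      character (ξ - η) y * ((starRingEnd ℂ) (𝓕 a (ξ - η)) * 𝓕 g ξ)
          * (character η x * b (x - y))) ((volume : Measure 𝔼).prod volume) := by
    have h3 : Integrable (fun y => ‖b (x - y)‖) := (b.integrable.comp_sub_left x).norm
    obtain ⟨C, hC, ha⟩ := exists_one_add_pow_mul_norm_le (𝓕 a) 0
    have h4 : Integrable (fun ξ => C * ‖𝓕 g ξ‖) := (𝓕 g).integrable.norm.const_mul C
    refine (h3.mul_prod h4).mono' ?_ (Filter.Eventually.of_forall fun w => ?_)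
    · refine Continuous.aestronglyMeasurable ?_
      have e1 : Continuous fun w : 𝔼 × 𝔼 => character (w.2 - η) w.1 :=
        continuous_character_comp (by fun_prop) (by fun_prop)
      have e2 : Continuous fun w : 𝔼 × 𝔼 => (starRingEnd ℂ) (𝓕 a (w.2 - η)) :=
        Complex.continuous_conj.comp ((𝓕 a).continuous.comp (by fun_prop))
      have e3 : Continuous fun w : 𝔼 × 𝔼 => 𝓕 g w.2 := (𝓕 g).continuous.comp continuous_snd
      have e4 : Continuous fun w : 𝔼 × 𝔼 => b (x - w.1) := b.continuous.comp (by fun_prop)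
      exact (e1.mul (e2.mul e3)).mul (continuous_const.mul e4)
    · simp only [Function.uncurry, norm_mul, norm_character, one_mul, RCLike.norm_conj]
      rw [mul_comm]
      gcongr
      simpa using ha (w.2 - η)
  simp_rw [h1]
  rw [integral_integral_swap h2]
  refine integral_congr_ae (Filter.Eventually.of_forall fun ξ => ?_)
  have h5 : 𝓕 b (ξ - η) = ∫ y, character (-(ξ - η)) (x - y) * b (x - y) := by
    rw [fourier_eq_integral, ← integral_sub_left_eq_self _ volume x]
  simp only
  rw [h5, ← integral_const_mul, ← integral_const_mul, ← integral_const_mul]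
  refine integral_congr_ae (Filter.Eventually.of_forall fun y => ?_)
  have h6 : character x ξ * character (-(ξ - η)) (x - y)
      = character (ξ - η) y * character η x := by
    rw [sub_eq_add_neg x y, character_add_right, character_neg_right, neg_neg, ← mul_assoc,
      character_comm x ξ, ← character_add_left, mul_comm]
    congr 2
    abel
  simp only
  calc _ = (character (ξ - η) y * character η x)
        * ((starRingEnd ℂ) (𝓕 a (ξ - η)) * 𝓕 g ξ * b (x - y)) := by ring
    _ = _ := by rw [← h6]; ring

variable {ν : Measure (EuclideanSpace ℝ (Fin n))} [SFinite ν]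

/-- The pair of windows `(a, b)` reproduces every function from its short-time Fourier transform,
sampled in frequency along `ν`. -/
def IsReproducing (ν : Measure 𝔼) (a b : 𝓢(𝔼, ℂ)) : Prop :=
  ∀ ξ, ∫ η, (starRingEnd ℂ) (𝓕 a (ξ - η)) * 𝓕 b (ξ - η) ∂ν = 1

/-- With the time integral carried out at fixed `η`, the remaining integral over `η` is `1` by the
reproducing condition, and Fourier inversion is left. -/
theorem IsReproducing.eq_integral (hν : UniformlyFinite ν) {a b : 𝓢(𝔼, ℂ)}
    (hab : IsReproducing ν a b) (g : 𝓢(𝔼, ℂ)) (x : 𝔼) :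
    g x = ∫ w, schwartzInner g (timeFreqShift w.1 w.2 a) * timeFreqShift w.1 w.2 b x
      ∂((volume : Measure 𝔼).prod ν) := by
  have hi : Integrable (fun w : 𝔼 × 𝔼 =>
      schwartzInner g (timeFreqShift w.1 w.2 a) * timeFreqShift w.1 w.2 b x)
      ((volume : Measure 𝔼).prod ν) := by
    obtain ⟨N, hN⟩ := uniformlyFinite_volume.exists_integrable_prod hν
    obtain ⟨C, hC, h⟩ := exists_norm_schwartzInner_le g a N
    obtain ⟨C', hC', h'⟩ := exists_one_add_pow_mul_norm_le b 0
    refine ((hN.const_mul C).mul_const C').mono' ?_ (Filter.Eventually.of_forall fun w => ?_)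
    · exact ((continuous_schwartzInner g a).mul
        (continuous_eval_comp (continuous_timeFreqShift b) x)).aestronglyMeasurable
    · rw [norm_mul, norm_timeFreqShift_apply]
      gcongr
      · exact h w
      · simpa using h' (x - w.1)
  rw [integral_prod_symm _ hi]
  simp_rw [integral_schwartzInner_mul_timeFreqShift]
  -- The decay of `𝓕 b` in `ξ - η` becomes decay in `η` at the price of a factor `(1 + ‖ξ‖) ^ N`,
  -- which `𝓕 g` absorbs.
  have hi2 : Integrable (Function.uncurry fun η ξ =>
      character x ξ * (𝓕 g ξ * ((starRingEnd ℂ) (𝓕 a (ξ - η)) * 𝓕 b (ξ - η))))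
      (ν.prod (volume : Measure 𝔼)) := by
    obtain ⟨N, hN⟩ := hν.exists_integrable
    obtain ⟨C, hC, h⟩ := exists_one_add_pow_mul_norm_le (𝓕 a) 0
    obtain ⟨C', hC', h'⟩ := exists_one_add_pow_mul_norm_le (𝓕 b) N
    refine (((hN N le_rfl).const_mul (C * C')).mul_prod
      (integrable_one_add_pow_mul_norm (𝓕 g) N)).mono' ?_
      (Filter.Eventually.of_forall fun w => ?_)
    · refine Continuous.aestronglyMeasurable ?_
      have e1 : Continuous fun w : 𝔼 × 𝔼 => character x w.2 :=
        continuous_character_comp (by fun_prop) (by fun_prop)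
      have e2 : Continuous fun w : 𝔼 × 𝔼 => (starRingEnd ℂ) (𝓕 a (w.2 - w.1)) :=
        Complex.continuous_conj.comp ((𝓕 a).continuous.comp (by fun_prop))
      have e3 : Continuous fun w : 𝔼 × 𝔼 => 𝓕 g w.2 := (𝓕 g).continuous.comp continuous_snd
      have e4 : Continuous fun w : 𝔼 × 𝔼 => 𝓕 b (w.2 - w.1) :=
        (𝓕 b).continuous.comp (by fun_prop)
      exact e1.mul (e3.mul (e2.mul e4))
    · simp only [Function.uncurry, norm_mul, norm_character, one_mul, RCLike.norm_conj]
      have h1 := h (w.2 - w.1)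
      have h2 := h' (w.2 - w.1)
      rw [pow_zero, one_mul] at h1
      have h3 : 1 + ‖w.1‖ ≤ (1 + ‖w.2 - w.1‖) * (1 + ‖w.2‖) := by
        have := one_add_norm_le_mul_sub w.1 w.2
        rwa [norm_sub_rev] at this
      have h4 : (1 + ‖w.1‖) ^ N * ‖𝓕 b (w.2 - w.1)‖ ≤ C' * (1 + ‖w.2‖) ^ N := by
        calc (1 + ‖w.1‖) ^ N * ‖𝓕 b (w.2 - w.1)‖
            ≤ ((1 + ‖w.2 - w.1‖) * (1 + ‖w.2‖)) ^ N * ‖𝓕 b (w.2 - w.1)‖ := by gcongr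
          _ = ((1 + ‖w.2 - w.1‖) ^ N * ‖𝓕 b (w.2 - w.1)‖) * (1 + ‖w.2‖) ^ N := by
              rw [mul_pow]; ring
          _ ≤ _ := by gcongr
      have h5 : ‖𝓕 b (w.2 - w.1)‖ ≤ C' * (1 + ‖w.2‖) ^ N * ((1 + ‖w.1‖) ^ N)⁻¹ := by
        rw [← div_eq_mul_inv, le_div_iff₀ (by positivity), mul_comm]
        exact h4
      calc ‖𝓕 g w.2‖ * (‖𝓕 a (w.2 - w.1)‖ * ‖𝓕 b (w.2 - w.1)‖)
          ≤ ‖𝓕 g w.2‖ * (C * (C' * (1 + ‖w.2‖) ^ N * ((1 + ‖w.1‖) ^ N)⁻¹)) := by gcongr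
        _ = _ := by ring
  rw [integral_integral_swap hi2]
  simp_rw [integral_const_mul]
  rw [show g x = 𝓕⁻ (𝓕 g) x by rw [fourierInv_fourier_eq], fourierInv_eq_integral]
  refine integral_congr_ae (Filter.Eventually.of_forall fun ξ => ?_)
  simp only
  rw [hab ξ, mul_one]

theorem seminorm_complex_smul (k l : ℕ) (c : ℂ) (ψ : 𝓢(𝔼, ℂ)) :
    SchwartzMap.seminorm ℝ k l (c • ψ) = ‖c‖ * SchwartzMap.seminorm ℝ k l ψ :=
  map_smul_eq_mul (SchwartzMap.seminorm ℂ k l) c ψ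

/-- The reproducing formula for the shifted window `γ` is conjugated and `f` is applied under the
integral. -/
theorem IsReproducing.stft_eq_integral (hν : UniformlyFinite ν) {a b : 𝓢(𝔼, ℂ)}
    (hab : IsReproducing ν a b) (γ : 𝓢(𝔼, ℂ)) (f : 𝓢'(𝔼, ℂ)) (x ξ : 𝔼) :
    stft γ f x ξ = ∫ w, (starRingEnd ℂ) (schwartzInner (timeFreqShift x ξ γ)
      (timeFreqShift w.1 w.2 a)) * stft b f w.1 w.2 ∂((volume : Measure 𝔼).prod ν) := by
  set g := timeFreqShift x ξ γ
  set h : 𝔼 × 𝔼 → 𝓢(𝔼, ℂ) := fun w =>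
    (starRingEnd ℂ) (schwartzInner g (timeFreqShift w.1 w.2 a))
      • conjSchwartz (timeFreqShift w.1 w.2 b) with hh
  have hc : Continuous h := (Complex.continuous_conj.comp (continuous_schwartzInner g a)).smul
    (continuous_conjSchwartz_timeFreqShift b)
  have hi : ∀ k l : ℕ, Integrable (fun w => SchwartzMap.seminorm ℝ k l (h w))
      ((volume : Measure 𝔼).prod ν) := by
    intro k l
    have hq : Continuous (SchwartzMap.seminorm ℝ k l : Seminorm ℝ 𝓢(𝔼, ℂ)) :=
      (schwartz_withSeminorms ℝ 𝔼 ℂ).continuous_seminorm (k, l)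
    obtain ⟨N, hN⟩ := uniformlyFinite_volume.exists_integrable_prod hν
    obtain ⟨A, C, hC, h1⟩ := exists_seminorm_conjSchwartz_timeFreqShift_le
      (SchwartzMap.seminorm ℝ k l) hq b
    -- `A` orders of decay cancel the growth of the seminorms of the shifts; the other `N` give
    -- integrability.
    obtain ⟨C', hC', h2⟩ := exists_norm_schwartzInner_le g a (N + A)
    refine (hN.const_mul (C' * C)).mono' (hq.comp hc).aestronglyMeasurable
      (Filter.Eventually.of_forall fun w => ?_)
    rw [Real.norm_of_nonneg (apply_nonneg _ _), seminorm_complex_smul, RCLike.norm_conj]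
    calc _ ≤ (C' * (((1 + ‖w.1‖) * (1 + ‖w.2‖)) ^ (N + A))⁻¹)
          * (C * ((1 + ‖w.1‖) * (1 + ‖w.2‖)) ^ A) := by
          gcongr
          · exact h2 w
          · exact h1 w.1 w.2
      _ = _ := by
          have : (1 + ‖w.1‖) * (1 + ‖w.2‖) ≠ 0 := by positivity
          rw [pow_add]
          field_simp
  have hs : ∀ t, conjSchwartz g t = ∫ w, h w t ∂((volume : Measure 𝔼).prod ν) := by
    intro t
    rw [conjSchwartz_apply, hab.eq_integral hν g t, ← integral_conj]
    refine integral_congr_ae (Filter.Eventually.of_forall fun w => ?_)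
    simp [hh, conjSchwartz_apply]
  have := (map_eq_integral hc hi hs (realLinear f)).2
  have e1 : stft γ f x ξ = realLinear f (conjSchwartz g) := rfl
  rw [e1, this]
  refine integral_congr_ae (Filter.Eventually.of_forall fun w => ?_)
  exact map_smul f _ _

theorem IsReproducing.exists_enorm_stft_le (hν : UniformlyFinite ν) {a b : 𝓢(𝔼, ℂ)}
    (hab : IsReproducing ν a b) (γ : 𝓢(𝔼, ℂ)) (N : ℕ) :
    ∃ C : ℝ≥0, ∀ (f : 𝓢'(𝔼, ℂ)) (z : 𝔼 × 𝔼), ‖stft γ f z.1 z.2‖ₑ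
      ≤ C * ∫⁻ w, ‖stft b f w.1 w.2‖ₑ * (((1 + ‖z.1 - w.1‖ₑ) * (1 + ‖z.2 - w.2‖ₑ)) ^ N)⁻¹
        ∂((volume : Measure 𝔼).prod ν) := by
  obtain ⟨C, hC, h⟩ := exists_norm_schwartzInner_timeFreqShift_le γ a N
  refine ⟨C.toNNReal, fun f z => ?_⟩
  rw [hab.stft_eq_integral hν, ← lintegral_const_mul' _ _ ENNReal.coe_ne_top]
  refine (enorm_integral_le_lintegral_enorm _).trans (lintegral_mono fun w => ?_)
  rw [enorm_mul, mul_pow, ENNReal.mul_inv (by simp) (by simp), ← enorm_inv_one_add_pow,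
    ← enorm_inv_one_add_pow]
  have h1 : ‖(starRingEnd ℂ) (schwartzInner (timeFreqShift z.1 z.2 γ) (timeFreqShift w.1 w.2 a))‖ₑ
      ≤ C.toNNReal * ‖((1 + ‖z.1 - w.1‖) ^ N)⁻¹ * ((1 + ‖z.2 - w.2‖) ^ N)⁻¹‖ₑ := by
    rw [← ofReal_norm, Real.enorm_of_nonneg (by positivity), RCLike.norm_conj,
      show (C.toNNReal : ℝ≥0∞) = ENNReal.ofReal C from rfl, ← ENNReal.ofReal_mul hC]
    refine ENNReal.ofReal_le_ofReal ?_
    rw [← mul_inv, ← mul_pow, ← div_eq_mul_inv, le_div_iff₀ (by positivity), mul_comm]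
    exact h z.1 z.2 w.1 w.2
  calc _ ≤ (C.toNNReal * ‖((1 + ‖z.1 - w.1‖) ^ N)⁻¹ * ((1 + ‖z.2 - w.2‖) ^ N)⁻¹‖ₑ)
        * ‖stft b f w.1 w.2‖ₑ := by gcongr
    _ = _ := by rw [enorm_mul]; ring

end ModulationSpaces

end

noncomputable section

/-! ### Self-improving pointwise inequalities -/

section SelfImproving

variable {X : Type*} [AddCommGroup X]

/-- Submultiplicative weights on a group. -/
structure IsSubmultiplicative (κ : X → ℝ≥0∞) : Prop where
  zero : κ 0 = 1
  one_le : ∀ x, 1 ≤ κ x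
  ne_top : ∀ x, κ x ≠ ∞
  neg : ∀ x, κ (-x) = κ x
  add_le : ∀ x y, κ (x + y) ≤ κ x * κ y

theorem IsSubmultiplicative.inv_mul_inv_le {κ : X → ℝ≥0∞} (hκ : IsSubmultiplicative κ) (N : ℕ)
    (z u w : X) : (κ (z - u) ^ N)⁻¹ * (κ (u - w) ^ N)⁻¹ ≤ (κ (z - w) ^ N)⁻¹ := by
  have h0 : ∀ x, κ x ^ N ≠ 0 := fun x => pow_ne_zero _ (zero_lt_one.trans_le (hκ.one_le x)).ne'
  rw [← ENNReal.mul_inv (Or.inl (h0 _)) (Or.inr (h0 _)), ENNReal.inv_le_inv, ← mul_pow]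
  gcongr
  simpa using hκ.add_le (z - u) (u - w)

theorem lintegral_le_of_forall_le {α : Type*} [MeasurableSpace α] {μ : Measure α} {r : ℝ}
    (hr : r ≤ 1) (hr0 : 0 < r) (φ : α → ℝ≥0∞) (M : ℝ≥0∞) (hM : M ≠ ∞) (h : ∀ w, φ w ≤ M) :
    ∫⁻ w, φ w ∂μ ≤ M ^ (1 - r) * ∫⁻ w, φ w ^ r ∂μ := by
  have h1 : 0 ≤ 1 - r := by linarith
  rw [← lintegral_const_mul' _ _ (ENNReal.rpow_ne_top_of_nonneg h1 hM)]
  refine lintegral_mono fun w => ?_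
  calc φ w = φ w ^ ((1 - r) + r) := by simp
    _ = φ w ^ (1 - r) * φ w ^ r := ENNReal.rpow_add_of_nonneg _ _ h1 hr0.le
    _ ≤ _ := by gcongr; exact h w

variable [MeasurableSpace X] {μ : Measure X} {κ : X → ℝ≥0∞} {F G : X → ℝ≥0∞} {r : ℝ}

/-- Submultiplicativity bounds the supremum `M` by `K * ∫ F κ⁻ᴺ`, and there `F κ⁻ᴺ ≤ M ^ (1 - r) *
(F κ⁻ᴺ) ^ r`. As `M` is finite, `M ^ (1 - r)` can be divided out. -/
theorem iSup_rpow_le_of_ne_top (hκ : IsSubmultiplicative κ) (hr : r ≤ 1) (hr0 : 0 < r) {N : ℕ}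
    {K : ℝ≥0} (hF : ∀ z, F z ≤ K * ∫⁻ w, F w * (κ (z - w) ^ N)⁻¹ ∂μ) (z : X)
    (hM : ⨆ u, F u * (κ (z - u) ^ N)⁻¹ ≠ ∞) :
    (⨆ u, F u * (κ (z - u) ^ N)⁻¹) ^ r ≤ K * ∫⁻ w, (F w * (κ (z - w) ^ N)⁻¹) ^ r ∂μ := by
  set M := ⨆ u, F u * (κ (z - u) ^ N)⁻¹ with hMdef
  have hle : ∀ w, F w * (κ (z - w) ^ N)⁻¹ ≤ M := fun w =>
    le_iSup (fun u => F u * (κ (z - u) ^ N)⁻¹) w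
  have h1 : M ≤ K * (M ^ (1 - r) * ∫⁻ w, (F w * (κ (z - w) ^ N)⁻¹) ^ r ∂μ) := by
    refine iSup_le fun u => ?_
    have hfin : (κ (z - u) ^ N)⁻¹ ≠ ∞ := ENNReal.inv_ne_top.2
      (pow_ne_zero _ (zero_lt_one.trans_le (hκ.one_le _)).ne')
    calc F u * (κ (z - u) ^ N)⁻¹
        ≤ (K * ∫⁻ w, F w * (κ (u - w) ^ N)⁻¹ ∂μ) * (κ (z - u) ^ N)⁻¹ := by
          gcongr; exact hF u
      _ = K * ∫⁻ w, F w * (κ (u - w) ^ N)⁻¹ * (κ (z - u) ^ N)⁻¹ ∂μ := by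
          rw [lintegral_mul_const' _ _ hfin, mul_assoc]
      _ ≤ K * ∫⁻ w, F w * (κ (z - w) ^ N)⁻¹ ∂μ := by
          refine mul_le_mul_right (lintegral_mono fun w => ?_) _
          rw [mul_assoc, mul_comm _ (κ (z - u) ^ N)⁻¹]
          gcongr
          exact hκ.inv_mul_inv_le N z u w
      _ ≤ _ := by
          gcongr
          exact lintegral_le_of_forall_le hr hr0 _ M hM hle
  by_cases hM0 : M = 0
  · simp [hM0, hr0]
  have h2 : M ^ (1 - r) ≠ 0 := by simp [hM0, hM]
  have h3 : M ^ (1 - r) ≠ ∞ := ENNReal.rpow_ne_top_of_nonneg (by linarith) hM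
  rw [← ENNReal.mul_le_mul_iff_right h2 h3]
  calc M ^ (1 - r) * M ^ r = M := by
        rw [← ENNReal.rpow_add_of_nonneg _ _ (by linarith) hr0.le]; simp
    _ ≤ _ := h1
    _ = _ := by ring

/-- Polynomial growth makes the supremum finite for a large exponent `N'`. The bound obtained there
shows that the supremum for `N` is finite too whenever the right-hand side is, and the previous
lemma applies at `N`. The constant is therefore `K N`, free of the growth data of `F`; this yields
constants independent of `f` later. -/
theorem iSup_rpow_le (hκ : IsSubmultiplicative κ) (hr : r ≤ 1) (hr0 : 0 < r)
    {K : ℕ → ℝ≥0} (hF : ∀ N z, F z ≤ K N * ∫⁻ w, F w * (κ (z - w) ^ N)⁻¹ ∂μ)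
    (hgrowth : ∃ (A : ℝ≥0) (N : ℕ), ∀ z, F z ≤ A * κ z ^ N) (N : ℕ) (z : X) :
    (⨆ u, F u * (κ (z - u) ^ N)⁻¹) ^ r ≤ K N * ∫⁻ w, (F w * (κ (z - w) ^ N)⁻¹) ^ r ∂μ := by
  by_cases hK : K N = 0
  · have h0 : ∀ u, F u = 0 := fun u => by simpa [hK] using hF N u
    simp [h0, hr0]
  by_cases hI : ∫⁻ w, (F w * (κ (z - w) ^ N)⁻¹) ^ r ∂μ = ∞
  · rw [hI, ENNReal.mul_top (by simpa using hK)]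
    exact le_top
  refine iSup_rpow_le_of_ne_top hκ hr hr0 (hF N) z ?_
  obtain ⟨A, N₀, hA⟩ := hgrowth
  set N' := max N N₀ with hN'
  have hpow0 : ∀ (x : X) (m : ℕ), κ x ^ m ≠ 0 := fun x m =>
    pow_ne_zero _ (zero_lt_one.trans_le (hκ.one_le x)).ne'
  have hpowt : ∀ (x : X) (m : ℕ), κ x ^ m ≠ ∞ := fun x m => ENNReal.pow_ne_top (hκ.ne_top x)
  have hfin : ∀ u, ⨆ v, F v * (κ (u - v) ^ N')⁻¹ ≠ ∞ := by
    intro u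
    refine ne_top_of_le_ne_top (b := A * κ u ^ N₀)
      (ENNReal.mul_ne_top ENNReal.coe_ne_top (hpowt _ _)) (iSup_le fun v => ?_)
    have h1 : κ v ≤ κ u * κ (u - v) := by
      have := hκ.add_le u (-(u - v))
      rwa [hκ.neg, ← sub_eq_add_neg, sub_sub_cancel] at this
    calc F v * (κ (u - v) ^ N')⁻¹ ≤ A * (κ u * κ (u - v)) ^ N₀ * (κ (u - v) ^ N')⁻¹ := by
          gcongr
          exact (hA v).trans (by gcongr)
      _ ≤ A * (κ u ^ N₀ * κ (u - v) ^ N') * (κ (u - v) ^ N')⁻¹ := by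
          rw [mul_pow]
          gcongr
          · exact hκ.one_le _
          · exact le_max_right _ _
      _ = A * κ u ^ N₀ := by
          rw [← mul_assoc, mul_assoc, ENNReal.mul_inv_cancel (hpow0 _ _) (hpowt _ _), mul_one]
  set I := ∫⁻ w, (F w * (κ (z - w) ^ N)⁻¹) ^ r ∂μ
  have hbound : ∀ u, (F u * (κ (z - u) ^ N)⁻¹) ^ r ≤ K N' * I := by
    intro u
    have h1 := iSup_rpow_le_of_ne_top hκ hr hr0 (hF N') u (hfin u)
    have h2 : F u ≤ ⨆ v, F v * (κ (u - v) ^ N')⁻¹ := by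
      refine le_trans ?_ (le_iSup _ u)
      simp [hκ.zero]
    have h3 : ((κ (z - u) ^ N)⁻¹) ^ r ≠ ∞ :=
      ENNReal.rpow_ne_top_of_nonneg hr0.le (ENNReal.inv_ne_top.2 (hpow0 _ _))
    rw [ENNReal.mul_rpow_of_nonneg _ _ hr0.le]
    calc F u ^ r * ((κ (z - u) ^ N)⁻¹) ^ r
        ≤ (K N' * ∫⁻ w, (F w * (κ (u - w) ^ N')⁻¹) ^ r ∂μ) * ((κ (z - u) ^ N)⁻¹) ^ r := by
          gcongr
          exact (ENNReal.rpow_le_rpow h2 hr0.le).trans h1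
      _ = K N' * ∫⁻ w, (F w * (κ (u - w) ^ N')⁻¹) ^ r * ((κ (z - u) ^ N)⁻¹) ^ r ∂μ := by
          rw [lintegral_mul_const' _ _ h3, mul_assoc]
      _ ≤ K N' * I := by
          refine mul_le_mul_right (lintegral_mono fun w => ?_) _
          rw [← ENNReal.mul_rpow_of_nonneg _ _ hr0.le, mul_assoc]
          gcongr
          rw [mul_comm]
          refine le_trans ?_ (hκ.inv_mul_inv_le N z u w)
          gcongr
          · exact hκ.one_le _
          · exact le_max_left _ _
  refine ne_top_of_le_ne_top (b := (K N' * I) ^ r⁻¹) ?_ (iSup_le fun u => ?_)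
  · exact ENNReal.rpow_ne_top_of_nonneg (by positivity) (ENNReal.mul_ne_top ENNReal.coe_ne_top hI)
  · rw [ENNReal.le_rpow_inv_iff hr0]
    exact hbound u

/-- If `F` is dominated by its averages with respect to all negative powers of a submultiplicative
weight, and so is `G` by the averages of `F`, then `G ^ r` is dominated by the averages of `F ^ r`
for `r ≤ 1`. -/
theorem rpow_le_lintegral_rpow (hκ : IsSubmultiplicative κ) (hr : r ≤ 1) (hr0 : 0 < r)
    {K : ℕ → ℝ≥0} (hF : ∀ N z, F z ≤ K N * ∫⁻ w, F w * (κ (z - w) ^ N)⁻¹ ∂μ)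
    (hgrowth : ∃ (A : ℝ≥0) (N : ℕ), ∀ z, F z ≤ A * κ z ^ N) {N : ℕ} {L : ℝ≥0}
    (hG : ∀ z, G z ≤ L * ∫⁻ w, F w * (κ (z - w) ^ N)⁻¹ ∂μ) (z : X) :
    G z ^ r ≤ (L : ℝ≥0∞) ^ r * (K N : ℝ≥0∞) ^ (1 - r)
      * ∫⁻ w, (F w * (κ (z - w) ^ N)⁻¹) ^ r ∂μ := by
  have h0 := iSup_rpow_le hκ hr hr0 hF hgrowth N z
  set I := ∫⁻ w, (F w * (κ (z - w) ^ N)⁻¹) ^ r ∂μ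
  set M := ⨆ u, F u * (κ (z - u) ^ N)⁻¹
  have h1r : 0 ≤ 1 - r := by linarith
  -- In this case the integral `I` is infinite as well, so the bound is trivial unless `L = 0`, when
  -- `G z = 0`.
  by_cases hM : M = ∞
  · rw [hM, ENNReal.top_rpow_of_pos hr0, top_le_iff] at h0
    have hI : I = ∞ := by
      by_contra hI
      exact ENNReal.mul_ne_top ENNReal.coe_ne_top hI h0
    have hK : K N ≠ 0 := by
      intro hK
      simp [hK] at h0
    by_cases hL : L = 0
    · have : G z = 0 := by simpa [hL] using hG z
      simp [this, hr0]
    · rw [hI, ENNReal.mul_top]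
      · exact le_top
      · simp [hL, hK, hr0]
  have h2 : ∫⁻ w, F w * (κ (z - w) ^ N)⁻¹ ∂μ ≤ M ^ (1 - r) * I :=
    lintegral_le_of_forall_le hr hr0 _ M hM
      fun w => le_iSup (fun u => F u * (κ (z - u) ^ N)⁻¹) w
  calc G z ^ r ≤ (L * (M ^ (1 - r) * I)) ^ r := by
        gcongr
        exact (hG z).trans (by gcongr)
    _ = (L : ℝ≥0∞) ^ r * (M ^ r) ^ (1 - r) * I ^ r := by
        rw [ENNReal.mul_rpow_of_nonneg _ _ hr0.le, ENNReal.mul_rpow_of_nonneg _ _ hr0.le,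
          ← ENNReal.rpow_mul, ← ENNReal.rpow_mul, mul_comm (1 - r), mul_assoc]
    _ ≤ (L : ℝ≥0∞) ^ r * (K N * I) ^ (1 - r) * I ^ r := by gcongr
    _ = (L : ℝ≥0∞) ^ r * (K N : ℝ≥0∞) ^ (1 - r) * (I ^ (1 - r) * I ^ r) := by
        rw [ENNReal.mul_rpow_of_nonneg _ _ h1r]; ring
    _ = _ := by
        rw [← ENNReal.rpow_add_of_nonneg _ _ h1r hr0.le]; simp

end SelfImproving

/-! ### Minkowski's integral inequality and Schur's test -/

section Mixed

variable {α β : Type*} [MeasurableSpace α] [MeasurableSpace β]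

theorem eLpNorm_eq_lintegral_ennreal {μ : Measure α} {p : ℝ≥0∞} (hp : p ≠ 0) (hp' : p ≠ ∞)
    (f : α → ℝ≥0∞) : eLpNorm f p μ = (∫⁻ x, f x ^ p.toReal ∂μ) ^ (1 / p.toReal) := by
  rw [eLpNorm_eq_lintegral_rpow_enorm_toReal hp hp']
  simp

theorem measurable_eLpNorm_ennreal {μ : Measure α} [SFinite μ] (p : ℝ≥0∞) {f : α × β → ℝ≥0∞}
    (hf : Measurable f) : Measurable fun y => eLpNorm (fun x => f (x, y)) p μ := by
  by_cases hp : p = 0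
  · simp [hp]
  -- The essential supremum exceeds `c` exactly when the section of `{f > c}` has positive measure,
  -- and measures of sections are measurable.
  by_cases hp' : p = ∞
  · subst hp'
    refine measurable_of_Ioi fun c => ?_
    have : (fun y => eLpNorm (fun x => f (x, y)) ∞ μ) ⁻¹' Set.Ioi c
        = (fun y => μ ((fun x => (x, y)) ⁻¹' {w | c < f w})) ⁻¹' Set.Ioi 0 := by
      ext y
      simp only [Set.mem_preimage, Set.mem_Ioi, eLpNorm_exponent_top, eLpNormEssSup, enorm_eq_self,
        Set.preimage_ofPred_eq, pos_iff_ne_zero]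
      rw [← not_iff_not, not_lt, not_not]
      constructor
      · intro h
        have h2 : ∀ᵐ x ∂μ, f (x, y) ≤ c := (ENNReal.ae_le_essSup _).mono fun x hx => hx.trans h
        simpa [ae_iff] using h2
      · intro h
        refine essSup_le_of_ae_le c ?_
        rw [Filter.EventuallyLE, ae_iff]
        simpa using h
    rw [this]
    exact measurable_measure_prodMk_right (measurableSet_lt measurable_const hf) measurableSet_Ioi
  · simp_rw [eLpNorm_eq_lintegral_ennreal hp hp']
    exact ((hf.pow_const _).lintegral_prod_left').pow_const _

/-- Minkowski's integral inequality. -/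
theorem eLpNorm_lintegral_le {μ : Measure α} {ν : Measure β} [SigmaFinite μ] [SFinite ν]
    {p : ℝ≥0∞} (hp : 1 ≤ p) {f : α × β → ℝ≥0∞} (hf : Measurable f) :
    eLpNorm (fun x => ∫⁻ y, f (x, y) ∂ν) p μ ≤ ∫⁻ y, eLpNorm (fun x => f (x, y)) p μ ∂ν := by
  have hp0 : p ≠ 0 := (zero_lt_one.trans_le hp).ne'
  have hN := measurable_eLpNorm_ennreal (μ := μ) p hf
  by_cases hp' : p = ∞
  · subst hp'
    rw [eLpNorm_exponent_top, eLpNormEssSup]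
    refine essSup_le_of_ae_le _ ?_
    have h1 : ∀ᵐ w ∂(μ.prod ν), f w ≤ eLpNorm (fun x => f (x, w.2)) ∞ μ := by
      have hs : MeasurableSet {w : α × β | f w ≤ eLpNorm (fun x => f (x, w.2)) ∞ μ} :=
        measurableSet_le hf (hN.comp measurable_snd)
      rw [Measure.ae_prod_iff_ae_ae hs, Measure.ae_ae_comm
        (p := fun x y => f (x, y) ≤ eLpNorm (fun x => f (x, y)) ∞ μ) hs]
      exact Filter.Eventually.of_forall fun y => ENNReal.ae_le_essSup fun x => f (x, y)
    filter_upwards [Measure.ae_ae_of_ae_prod h1] with x hx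
    exact lintegral_mono_ae hx
  rw [eLpNorm_eq_lintegral_ennreal hp0 hp']
  set t := p.toReal
  have ht : 1 ≤ t := by simpa [t] using ENNReal.toReal_mono hp' hp
  have ht0 : 0 < t := by linarith
  set R := ∫⁻ y, eLpNorm (fun x => f (x, y)) p μ ∂ν
  have hΦ : Measurable fun x => ∫⁻ y, f (x, y) ∂ν := hf.lintegral_prod_right'
  rw [one_div, ENNReal.rpow_inv_le_iff ht0]
  by_contra! hlt
  -- A minorant of finite integral `a` replaces duality: with `g = g ^ (1 - t⁻¹) * g ^ t⁻¹`, Tonelli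
  -- and Hölder give `a ≤ a ^ (1 - t⁻¹) * R`, and finiteness of `a` permits cancellation.
  have hex : ∃ g : SimpleFunc α ℝ≥0, (∀ x, (g x : ℝ≥0∞) ≤ (∫⁻ y, f (x, y) ∂ν) ^ t) ∧
      ∫⁻ x, g x ∂μ < ∞ ∧ R ^ t < ∫⁻ x, g x ∂μ := by
    rw [lintegral_eq_nnreal] at hlt
    simp only [lt_iSup_iff] at hlt
    obtain ⟨g₀, hg₀, h₀⟩ := hlt
    rw [← SimpleFunc.lintegral_eq_lintegral] at h₀
    obtain ⟨g, hg, h1, h2⟩ :=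
      SimpleFunc.exists_lt_lintegral_simpleFunc_of_lt_lintegral (f := g₀) h₀
    exact ⟨g, fun x => (ENNReal.coe_le_coe.2 (hg x)).trans (hg₀ x), h1, h2⟩
  obtain ⟨g, hg, hgfin, hglt⟩ := hex
  have hgm : Measurable fun x => (g x : ℝ≥0∞) := g.measurable.coe_nnreal_ennreal
  set a := ∫⁻ x, (g x : ℝ≥0∞) ∂μ with ha
  have hinv : 0 ≤ 1 - t⁻¹ := sub_nonneg.2 (inv_le_one_of_one_le₀ ht)
  have hinv' : 0 ≤ t⁻¹ := by positivity
  have h1 : a ≤ a ^ (1 - t⁻¹) * R := by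
    calc a ≤ ∫⁻ x, (g x : ℝ≥0∞) ^ (1 - t⁻¹) * ∫⁻ y, f (x, y) ∂ν ∂μ := by
          refine lintegral_mono fun x => ?_
          calc (g x : ℝ≥0∞) = (g x : ℝ≥0∞) ^ (1 - t⁻¹ + t⁻¹) := by simp
            _ = (g x : ℝ≥0∞) ^ (1 - t⁻¹) * (g x : ℝ≥0∞) ^ t⁻¹ :=
                ENNReal.rpow_add_of_nonneg _ _ hinv hinv'
            _ ≤ _ := by
                gcongr
                exact (ENNReal.rpow_inv_le_iff ht0).2 (hg x)
      _ = ∫⁻ x, ∫⁻ y, (g x : ℝ≥0∞) ^ (1 - t⁻¹) * f (x, y) ∂ν ∂μ := by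
          refine lintegral_congr fun x => ?_
          rw [lintegral_const_mul' _ _ (ENNReal.rpow_ne_top_of_nonneg hinv ENNReal.coe_ne_top)]
      _ = ∫⁻ y, ∫⁻ x, (g x : ℝ≥0∞) ^ (1 - t⁻¹) * f (x, y) ∂μ ∂ν :=
          lintegral_lintegral_swap
            (((hgm.comp measurable_fst).pow_const _).mul hf).aemeasurable
      _ ≤ ∫⁻ y, a ^ (1 - t⁻¹) * eLpNorm (fun x => f (x, y)) p μ ∂ν := by
          refine lintegral_mono fun y => ?_
          have hfy : Measurable fun x => f (x, y) := hf.comp measurable_prodMk_right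
          have := ENNReal.lintegral_mul_norm_pow_le (μ := μ) hgm.aemeasurable
            (hfy.pow_const t).aemeasurable hinv hinv' (by ring)
          rw [eLpNorm_eq_lintegral_ennreal hp0 hp', one_div]
          refine le_trans (le_of_eq ?_) this
          refine lintegral_congr fun x => ?_
          rw [← ENNReal.rpow_mul, mul_inv_cancel₀ ht0.ne', ENNReal.rpow_one]
      _ = a ^ (1 - t⁻¹) * R := by
          rw [lintegral_const_mul' _ _ (ENNReal.rpow_ne_top_of_nonneg hinv hgfin.ne)]
  have ha0 : a ≠ 0 := (zero_le.trans_lt hglt).ne'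
  have h2 : a ^ (1 - t⁻¹) ≠ 0 := by simp [ha0, hgfin.ne]
  have h3 : a ^ (1 - t⁻¹) ≠ ∞ := ENNReal.rpow_ne_top_of_nonneg hinv hgfin.ne
  have h4 : a ^ t⁻¹ ≤ R := by
    rw [← ENNReal.mul_le_mul_iff_right h2 h3, ← ENNReal.rpow_add_of_nonneg _ _ hinv hinv']
    simpa using h1
  rw [ENNReal.rpow_inv_le_iff ht0] at h4
  exact absurd hglt (not_lt.2 h4)

/-- Schur's test. -/
theorem eLpNorm_lintegral_kernel_le {μ : Measure α} {ν : Measure β} [SFinite μ] [SFinite ν]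
    {p : ℝ≥0∞} (hp : 1 ≤ p) {k : α × β → ℝ≥0∞} (hk : Measurable k) {h : β → ℝ≥0∞}
    (hh : Measurable h) {C : ℝ≥0} (h₁ : ∀ x, ∫⁻ y, k (x, y) ∂ν ≤ C)
    (h₂ : ∀ y, ∫⁻ x, k (x, y) ∂μ ≤ C) :
    eLpNorm (fun x => ∫⁻ y, k (x, y) * h y ∂ν) p μ ≤ C * eLpNorm h p ν := by
  have hp0 : p ≠ 0 := (zero_lt_one.trans_le hp).ne'
  have hkx : ∀ x, Measurable fun y => k (x, y) := fun x => hk.comp measurable_prodMk_left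
  have hky : ∀ y, Measurable fun x => k (x, y) := fun y => hk.comp measurable_prodMk_right
  by_cases hp' : p = ∞
  · subst hp'
    rw [eLpNorm_exponent_top, eLpNormEssSup, eLpNorm_exponent_top, eLpNormEssSup]
    refine essSup_le_of_ae_le _ (Filter.Eventually.of_forall fun x => ?_)
    simp only [enorm_eq_self]
    calc ∫⁻ y, k (x, y) * h y ∂ν ≤ ∫⁻ y, k (x, y) * essSup h ν ∂ν := by
          refine lintegral_mono_ae ((ENNReal.ae_le_essSup h).mono fun y hy => ?_)
          gcongr
      _ = (∫⁻ y, k (x, y) ∂ν) * essSup h ν := lintegral_mul_const _ (hkx x)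
      _ ≤ _ := by gcongr; exact h₁ x
  rw [eLpNorm_eq_lintegral_ennreal hp0 hp', eLpNorm_eq_lintegral_ennreal hp0 hp']
  set t := p.toReal
  have ht : 1 ≤ t := by simpa [t] using ENNReal.toReal_mono hp' hp
  have ht0 : 0 < t := by linarith
  have hinv : 0 ≤ 1 - t⁻¹ := sub_nonneg.2 (inv_le_one_of_one_le₀ ht)
  have hinv' : 0 ≤ t⁻¹ := by positivity
  have h1 : ∀ x, (∫⁻ y, k (x, y) * h y ∂ν) ^ t
      ≤ (C : ℝ≥0∞) ^ (t - 1) * ∫⁻ y, k (x, y) * h y ^ t ∂ν := by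
    intro x
    have := ENNReal.lintegral_mul_norm_pow_le (μ := ν) (hkx x).aemeasurable
      ((hkx x).mul (hh.pow_const t)).aemeasurable hinv hinv' (by ring)
    -- Splitting `k * h` as `k ^ (1 - t⁻¹) * (k * h ^ t) ^ t⁻¹` prepares Hölder's inequality.
    have e1 : ∫⁻ y, k (x, y) * h y ∂ν
        = ∫⁻ y, k (x, y) ^ (1 - t⁻¹) * (k (x, y) * h y ^ t) ^ t⁻¹ ∂ν := by
      refine lintegral_congr fun y => ?_
      rw [ENNReal.mul_rpow_of_nonneg _ _ hinv', ← ENNReal.rpow_mul, mul_inv_cancel₀ ht0.ne',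
        ENNReal.rpow_one, ← mul_assoc, ← ENNReal.rpow_add_of_nonneg _ _ hinv hinv']
      simp
    calc (∫⁻ y, k (x, y) * h y ∂ν) ^ t
        ≤ ((∫⁻ y, k (x, y) ∂ν) ^ (1 - t⁻¹) * (∫⁻ y, k (x, y) * h y ^ t ∂ν) ^ t⁻¹) ^ t := by
          rw [e1]
          exact ENNReal.rpow_le_rpow this ht0.le
      _ ≤ ((C : ℝ≥0∞) ^ (1 - t⁻¹) * (∫⁻ y, k (x, y) * h y ^ t ∂ν) ^ t⁻¹) ^ t := by
          gcongr
          exact h₁ x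
      _ = _ := by
          rw [ENNReal.mul_rpow_of_nonneg _ _ ht0.le, ← ENNReal.rpow_mul, ← ENNReal.rpow_mul,
            inv_mul_cancel₀ ht0.ne', ENNReal.rpow_one, sub_mul, inv_mul_cancel₀ ht0.ne', one_mul]
  have hCt : (C : ℝ≥0∞) ^ (t - 1) ≠ ∞ :=
    ENNReal.rpow_ne_top_of_nonneg (by linarith) ENNReal.coe_ne_top
  have h2 : ∫⁻ x, (∫⁻ y, k (x, y) * h y ∂ν) ^ t ∂μ ≤ (C : ℝ≥0∞) ^ t * ∫⁻ y, h y ^ t ∂ν := by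
    calc ∫⁻ x, (∫⁻ y, k (x, y) * h y ∂ν) ^ t ∂μ
        ≤ ∫⁻ x, (C : ℝ≥0∞) ^ (t - 1) * ∫⁻ y, k (x, y) * h y ^ t ∂ν ∂μ := lintegral_mono h1
      _ = (C : ℝ≥0∞) ^ (t - 1) * ∫⁻ y, ∫⁻ x, k (x, y) * h y ^ t ∂μ ∂ν := by
          rw [lintegral_const_mul' _ _ hCt, lintegral_lintegral_swap
            (hk.mul ((hh.pow_const t).comp measurable_snd)).aemeasurable]
      _ ≤ (C : ℝ≥0∞) ^ (t - 1) * ∫⁻ y, C * h y ^ t ∂ν := by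
          gcongr with y
          rw [lintegral_mul_const _ (hky y)]
          gcongr
          exact h₂ y
      _ = _ := by
          rw [lintegral_const_mul' _ _ ENNReal.coe_ne_top, ← mul_assoc]
          congr 1
          nth_rewrite 2 [← ENNReal.rpow_one (C : ℝ≥0∞)]
          rw [← ENNReal.rpow_add_of_nonneg _ _ (by linarith) zero_le_one, sub_add_cancel]
  calc _ ≤ ((C : ℝ≥0∞) ^ t * ∫⁻ y, h y ^ t ∂ν) ^ (1 / t) := by gcongr
    _ = _ := by
        rw [one_div, ENNReal.mul_rpow_of_nonneg _ _ hinv', ← ENNReal.rpow_mul,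
          mul_inv_cancel₀ ht0.ne', ENNReal.rpow_one]

end Mixed

end

/-! ### Homogeneity and monotonicity of `eLpNorm` for `ℝ≥0∞`-valued functions -/

noncomputable section

theorem eLpNorm_mul_const_ennreal {α : Type*} [MeasurableSpace α] {μ : Measure α} {p : ℝ≥0∞}
    (g : α → ℝ≥0∞) {c : ℝ≥0∞} (hc : c ≠ ∞) :
    eLpNorm (fun x => g x * c) p μ = eLpNorm g p μ * c := by
  by_cases hp : p = 0
  · simp [hp]
  by_cases hp' : p = ∞
  · subst hp'
    simp only [eLpNorm_exponent_top, eLpNormEssSup, enorm_eq_self, mul_comm _ c]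
    exact ENNReal.essSup_const_mul
  have ht : 0 < p.toReal := ENNReal.toReal_pos hp hp'
  rw [eLpNorm_eq_lintegral_ennreal hp hp', eLpNorm_eq_lintegral_ennreal hp hp']
  simp_rw [ENNReal.mul_rpow_of_nonneg _ _ ht.le]
  rw [lintegral_mul_const' _ _ (ENNReal.rpow_ne_top_of_nonneg ht.le hc),
    ENNReal.mul_rpow_of_nonneg _ _ (by positivity), ← ENNReal.rpow_mul, mul_one_div_cancel ht.ne',
    ENNReal.rpow_one]

theorem eLpNorm_ennreal_mono {α : Type*} [MeasurableSpace α] {μ : Measure α} {p : ℝ≥0∞}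
    {g h : α → ℝ≥0∞} (hgh : ∀ x, g x ≤ h x) : eLpNorm g p μ ≤ eLpNorm h p μ :=
  eLpNorm_mono_enorm fun x => by simpa using hgh x

namespace ModulationSpaces

open FourierTransform SchwartzMap

variable {n : ℕ}

local notation "𝔼" => EuclideanSpace ℝ (Fin n)

/-! ### Regularized weights -/

theorem exists_abs_eval_le (v : MvPolynomial (Fin n) ℝ) :
    ∃ (A : ℕ) (C : ℝ), 0 ≤ C ∧ ∀ x : 𝔼,
      |MvPolynomial.eval (fun i => x i) v| ≤ C * (1 + ‖x‖) ^ A := by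
  have h1 : ∀ x : 𝔼, 1 ≤ 1 + ‖x‖ := fun x => by linarith [norm_nonneg x]
  induction v using MvPolynomial.induction_on with
  | C a => exact ⟨0, |a|, abs_nonneg _, fun x => by simp⟩
  | add u v hu hv =>
    obtain ⟨A, C, hC, h⟩ := hu
    obtain ⟨A', C', hC', h'⟩ := hv
    refine ⟨max A A', C + C', by positivity, fun x => ?_⟩
    rw [map_add]
    calc _ ≤ C * (1 + ‖x‖) ^ A + C' * (1 + ‖x‖) ^ A' :=
          (abs_add_le _ _).trans (add_le_add (h x) (h' x))
      _ ≤ C * (1 + ‖x‖) ^ max A A' + C' * (1 + ‖x‖) ^ max A A' := by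
          gcongr
          · exact h1 x
          · exact le_max_left _ _
          · exact h1 x
          · exact le_max_right _ _
      _ = _ := by ring
  | mul_X u i hu =>
    obtain ⟨A, C, hC, h⟩ := hu
    refine ⟨A + 1, C, hC, fun x => ?_⟩
    rw [map_mul, MvPolynomial.eval_X, abs_mul, pow_succ, ← mul_assoc]
    have h2 : |x i| ≤ 1 + ‖x‖ := by
      have := PiLp.norm_apply_le x i
      rw [Real.norm_eq_abs] at this
      linarith
    exact mul_le_mul (h x) h2 (abs_nonneg _) (by positivity)

theorem one_add_enorm_eq (x : 𝔼) : 1 + ‖x‖ₑ = ENNReal.ofReal (1 + ‖x‖) := by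
  rw [ENNReal.ofReal_add zero_le_one (norm_nonneg _), ENNReal.ofReal_one, ofReal_norm]

theorem one_add_enorm_pow_ne_zero (x : 𝔼) (N : ℕ) : (1 + ‖x‖ₑ) ^ N ≠ 0 := by simp

theorem one_add_enorm_pow_ne_top (x : 𝔼) (N : ℕ) : (1 + ‖x‖ₑ) ^ N ≠ ∞ := by simp

theorem isSubmultiplicative_one_add_enorm :
    IsSubmultiplicative fun x : 𝔼 => 1 + ‖x‖ₑ where
  zero := by simp
  one_le x := le_self_add
  ne_top x := by simp
  neg x := by simp
  add_le x y := by
    calc 1 + ‖x + y‖ₑ ≤ 1 + (‖x‖ₑ + ‖y‖ₑ) := by gcongr; exact enorm_add_le x y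
      _ ≤ 1 + (‖x‖ₑ + ‖y‖ₑ) + ‖x‖ₑ * ‖y‖ₑ := le_self_add
      _ = _ := by ring

theorem isSubmultiplicative_one_add_enorm_prod :
    IsSubmultiplicative fun z : 𝔼 × 𝔼 => (1 + ‖z.1‖ₑ) * (1 + ‖z.2‖ₑ) where
  zero := by simp
  one_le z := one_le_mul le_self_add le_self_add
  ne_top z := ENNReal.mul_ne_top (by simp) (by simp)
  neg z := by simp
  add_le z w := by
    calc _ ≤ ((1 + ‖z.1‖ₑ) * (1 + ‖w.1‖ₑ)) * ((1 + ‖z.2‖ₑ) * (1 + ‖w.2‖ₑ)) := by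
          gcongr
          · exact isSubmultiplicative_one_add_enorm.add_le z.1 w.1
          · exact isSubmultiplicative_one_add_enorm.add_le z.2 w.2
      _ = _ := by ring

/-- Measurable `ℝ≥0∞`-valued weights with finite values and polynomial growth. -/
structure IsRegularWeight (W : 𝔼 → ℝ≥0∞) : Prop where
  measurable : Measurable W
  ne_top : ∀ x, W x ≠ ∞
  moderate : ∃ A : ℕ, ∀ x y, W (x + y) ≤ (1 + ‖x‖ₑ) ^ A * W y

/-- The supremum of `w y * (1 + ‖x - y‖) ^ (-A)` over `y` is at least `w x` (take `y = x`) and, by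
moderateness, at most a multiple of it. As a supremum of continuous functions it is Borel, and it is
moderate with constant `1`. The comparison holds at every point, which matters on the lattice, a
Lebesgue null set when `n > 0`. -/
theorem IsPolyModerate.exists_regularWeight {w : 𝔼 → ℝ} (hw : IsPolyModerate w) :
    ∃ W : 𝔼 → ℝ≥0∞, IsRegularWeight W ∧
      ∃ c : ℝ≥0, ∀ x, ENNReal.ofReal (w x) ≤ W x ∧ W x ≤ c * ENNReal.ofReal (w x) := by
  obtain ⟨v, C₀, hv⟩ := hw.moderate
  obtain ⟨A, C, hC, hA⟩ := exists_abs_eval_le v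
  have hmod : ∀ x y : 𝔼, ENNReal.ofReal (w y)
      ≤ (|C₀| * C).toNNReal * (1 + ‖x - y‖ₑ) ^ A * ENNReal.ofReal (w x) := by
    intro x y
    have h1 : w y ≤ |C₀| * C * (1 + ‖x - y‖) ^ A * w x := by
      calc w y = w ((y - x) + x) := by simp
        _ ≤ C₀ * MvPolynomial.eval (fun i => (y - x) i) v * w x := hv _ _
        _ ≤ |C₀| * (C * (1 + ‖x - y‖) ^ A) * w x := by
            have h2 := hA (y - x)
            rw [norm_sub_rev] at h2
            refine mul_le_mul_of_nonneg_right ?_ (hw.nonneg x)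
            refine (le_abs_self _).trans ?_
            rw [abs_mul]
            gcongr
        _ = _ := by ring
    rw [one_add_enorm_eq, ← ENNReal.ofReal_pow (by positivity),
      show ((|C₀| * C).toNNReal : ℝ≥0∞) = ENNReal.ofReal (|C₀| * C) from rfl,
      ← ENNReal.ofReal_mul (by positivity), ← ENNReal.ofReal_mul (by positivity)]
    exact ENNReal.ofReal_le_ofReal h1
  set W : 𝔼 → ℝ≥0∞ := fun x => ⨆ y, ENNReal.ofReal (w y) * ((1 + ‖x - y‖ₑ) ^ A)⁻¹
  have hle : ∀ x, W x ≤ (|C₀| * C).toNNReal * ENNReal.ofReal (w x) := by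
    refine fun x => iSup_le fun y => ?_
    rw [← div_eq_mul_inv]
    refine ENNReal.div_le_of_le_mul ((hmod x y).trans (le_of_eq ?_))
    ring
  refine ⟨W, ⟨?_, fun x => ?_, A, fun u x => iSup_le fun y => ?_⟩,
    (|C₀| * C).toNNReal, fun x => ⟨?_, hle x⟩⟩
  · refine LowerSemicontinuous.measurable (lowerSemicontinuous_iSup fun y => ?_)
    refine Continuous.lowerSemicontinuous ?_
    refine (ENNReal.continuous_const_mul ENNReal.ofReal_ne_top).comp ?_
    exact continuous_inv.comp ((ENNReal.continuous_pow A).comp (by fun_prop))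
  · exact ne_top_of_le_ne_top (ENNReal.mul_ne_top ENNReal.coe_ne_top ENNReal.ofReal_ne_top) (hle x)
  · have h1 : ((1 + ‖u + x - y‖ₑ) ^ A)⁻¹ ≤ (1 + ‖u‖ₑ) ^ A * ((1 + ‖x - y‖ₑ) ^ A)⁻¹ := by
      rw [← div_eq_mul_inv, ENNReal.le_div_iff_mul_le (Or.inl (one_add_enorm_pow_ne_zero _ _))
        (Or.inl (one_add_enorm_pow_ne_top _ _)), mul_comm, ← div_eq_mul_inv]
      refine ENNReal.div_le_of_le_mul ?_
      rw [← mul_pow]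
      gcongr
      have := isSubmultiplicative_one_add_enorm.add_le (-u) (u + x - y)
      simpa [add_sub_assoc] using this
    calc _ ≤ ENNReal.ofReal (w y) * ((1 + ‖u‖ₑ) ^ A * ((1 + ‖x - y‖ₑ) ^ A)⁻¹) := by gcongr
      _ = (1 + ‖u‖ₑ) ^ A * (ENNReal.ofReal (w y) * ((1 + ‖x - y‖ₑ) ^ A)⁻¹) := by ring
      _ ≤ _ := by
          gcongr
          exact le_iSup (fun y => ENNReal.ofReal (w y) * ((1 + ‖x - y‖ₑ) ^ A)⁻¹) y
  · refine le_trans ?_ (le_iSup _ x)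
    simp

theorem IsRegularWeight.le_mul {W : 𝔼 → ℝ≥0∞} {A : ℕ}
    (hA : ∀ x y, W (x + y) ≤ (1 + ‖x‖ₑ) ^ A * W y) (x y : 𝔼) :
    W x ≤ (1 + ‖x - y‖ₑ) ^ A * W y := by
  simpa using hA (x - y) y

/-! ### Mixed norms -/

/-- The mixed norm of a function on phase space, with respect to the weight `Ω` in time and the
weight `M` and the measure `ν` in frequency. -/
def mixedNorm (p q : ℝ≥0∞) (Ω M : 𝔼 → ℝ≥0∞) (ν : Measure 𝔼) (F : 𝔼 × 𝔼 → ℝ≥0∞) : ℝ≥0∞ :=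
  eLpNorm (fun ξ => eLpNorm (fun x => F (x, ξ) * Ω x) p volume * M ξ) q ν

/-- Passing to `r`-th powers replaces `p, q` by `p / r, q / r`, which makes Minkowski and Schur
available for exponents below `1`. -/
theorem mixedNorm_rpow {p q : ℝ≥0∞} {Ω M : 𝔼 → ℝ≥0∞} (hM : ∀ ξ, M ξ ≠ ∞) (ν : Measure 𝔼)
    (F : 𝔼 × 𝔼 → ℝ≥0∞) {r : ℝ} (hr : 0 < r) :
    mixedNorm p q Ω M ν F ^ r
      = eLpNorm (fun ξ => eLpNorm (fun x => (F (x, ξ) * Ω x * M ξ) ^ r)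
        (p / ENNReal.ofReal r) volume) (q / ENNReal.ofReal r) ν := by
  have h0 : ENNReal.ofReal r ≠ 0 := by simpa using hr
  have h1 : ∀ s : ℝ≥0∞, s / ENNReal.ofReal r * ENNReal.ofReal r = s := fun s =>
    ENNReal.div_mul_cancel h0 ENNReal.ofReal_ne_top
  have h2 : ∀ ξ, eLpNorm (fun x => (F (x, ξ) * Ω x * M ξ) ^ r) (p / ENNReal.ofReal r) volume
      = (eLpNorm (fun x => F (x, ξ) * Ω x) p volume * M ξ) ^ r := by
    intro ξ
    have := eLpNorm_enorm_rpow (p := p / ENNReal.ofReal r) (μ := (volume : Measure 𝔼))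
      (fun x => F (x, ξ) * Ω x * M ξ) hr
    simp only [enorm_eq_self, h1] at this
    rw [← eLpNorm_mul_const_ennreal _ (hM ξ)]
    exact this
  simp_rw [h2]
  have := eLpNorm_enorm_rpow (p := q / ENNReal.ofReal r) (μ := ν)
      (fun ξ => eLpNorm (fun x => F (x, ξ) * Ω x) p volume * M ξ) hr
  simp only [enorm_eq_self, h1] at this
  rw [mixedNorm, ← this]

theorem UniformlyFinite.exists_forall {ν : Measure 𝔼} (hν : UniformlyFinite ν) :
    ∃ (N₀ : ℕ) (C : ℝ≥0), ∀ N ≥ N₀, ∀ ξ : 𝔼, ∫⁻ η, ((1 + ‖ξ - η‖ₑ) ^ N)⁻¹ ∂ν ≤ C := by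
  obtain ⟨N₀, C, h⟩ := hν
  refine ⟨N₀, C, fun N hN ξ => (lintegral_mono fun η => ?_).trans (h ξ)⟩
  gcongr
  exact le_self_add

theorem measurable_inv_one_add_enorm_pow (N : ℕ) :
    Measurable fun x : 𝔼 => ((1 + ‖x‖ₑ) ^ N)⁻¹ := by fun_prop

theorem lintegral_prod_sub_left_eq {ν : Measure 𝔼} [SFinite ν] {k k' : 𝔼 → ℝ≥0∞}
    (hk : Measurable k) (hk' : Measurable k') {H : 𝔼 × 𝔼 → ℝ≥0∞} (hH : Measurable H) (x : 𝔼) :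
    ∫⁻ w, k (x - w.1) * k' w.2 * H w ∂((volume : Measure 𝔼).prod ν)
      = ∫⁻ w, k w.1 * k' w.2 * H (x - w.1, w.2) ∂((volume : Measure 𝔼).prod ν) := by
  have hsub : Measurable fun w : 𝔼 × 𝔼 => x - w.1 := measurable_const.sub measurable_fst
  have h1 : Measurable fun w : 𝔼 × 𝔼 => k (x - w.1) * k' w.2 * H w :=
    ((hk.comp hsub).mul (hk'.comp measurable_snd)).mul hH
  have h2 : Measurable fun w : 𝔼 × 𝔼 => k w.1 * k' w.2 * H (x - w.1, w.2) :=
    ((hk.comp measurable_fst).mul (hk'.comp measurable_snd)).mul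
      (hH.comp (hsub.prodMk measurable_snd))
  rw [lintegral_prod_symm' _ h1, lintegral_prod_symm' _ h2]
  refine lintegral_congr fun η => ?_
  rw [← lintegral_sub_left_eq_self _ x]
  simp only [sub_sub_cancel]

theorem eLpNorm_sub_right_mul_const {s : ℝ≥0∞} {h : 𝔼 → ℝ≥0∞} (hh : Measurable h) (y : 𝔼)
    {c : ℝ≥0∞} (hc : c ≠ ∞) :
    eLpNorm (fun x => c * h (x - y)) s volume = c * eLpNorm h s volume := by
  simp_rw [mul_comm c]
  rw [eLpNorm_mul_const_ennreal (fun x => h (x - y)) hc]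
  exact congrArg (· * c) (eLpNorm_comp_measurePreserving (g := h) (f := fun x => x - y)
    hh.aestronglyMeasurable (measurePreserving_sub_right volume y))

/-- A change of variables moves the translation onto `H`; then Minkowski and translation invariance
of the norm apply. -/
theorem eLpNorm_lintegral_conv_le {ν : Measure 𝔼} [SFinite ν] {s : ℝ≥0∞} (hs : 1 ≤ s)
    {k k' : 𝔼 → ℝ≥0∞} (hk : Measurable k) (hk' : Measurable k') (hkt : ∀ x, k x ≠ ∞)
    (hkt' : ∀ x, k' x ≠ ∞) {H : 𝔼 × 𝔼 → ℝ≥0∞} (hH : Measurable H) :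
    eLpNorm (fun x => ∫⁻ w, k (x - w.1) * k' w.2 * H w ∂((volume : Measure 𝔼).prod ν)) s volume
      ≤ (∫⁻ x, k x) * ∫⁻ η, k' η * eLpNorm (fun x => H (x, η)) s volume ∂ν := by
  have hN : Measurable fun η => eLpNorm (fun x => H (x, η)) s volume :=
    measurable_eLpNorm_ennreal s hH
  have hm : Measurable fun w : 𝔼 × (𝔼 × 𝔼) => k w.2.1 * k' w.2.2 * H (w.1 - w.2.1, w.2.2) :=
    ((hk.comp (measurable_fst.comp measurable_snd)).mul
      (hk'.comp (measurable_snd.comp measurable_snd))).mul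
      (hH.comp ((measurable_fst.sub (measurable_fst.comp measurable_snd)).prodMk
        (measurable_snd.comp measurable_snd)))
  simp_rw [lintegral_prod_sub_left_eq hk hk' hH]
  refine (eLpNorm_lintegral_le hs hm).trans (le_of_eq ?_)
  refine Eq.trans ?_ (lintegral_prod_mul hk.aemeasurable (hk'.mul hN).aemeasurable)
  refine lintegral_congr fun w => ?_
  exact (eLpNorm_sub_right_mul_const (h := fun x => H (x, w.2)) (hH.comp measurable_prodMk_right)
    w.1 (ENNReal.mul_ne_top (hkt w.1) (hkt' w.2))).trans (mul_assoc _ _ _)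

/-- The time variable is a convolution on Lebesgue measure. The frequency variable passes between
two different measures, so there Schur's test takes the place of Young's inequality. -/
theorem eLpNorm_eLpNorm_le_of_le_lintegral {ν₁ ν₂ : Measure 𝔼} [SFinite ν₁] [SFinite ν₂]
    {s t : ℝ≥0∞} (hs : 1 ≤ s) (ht : 1 ≤ t) {k : 𝔼 → ℝ≥0∞} (hk : Measurable k)
    (hkt : ∀ x, k x ≠ ∞) (hkneg : ∀ x y, k (x - y) = k (y - x)) {C₀ C L : ℝ≥0}
    (h₀ : ∫⁻ x, k x ≤ C₀) (h₁ : ∀ ξ, ∫⁻ η, k (ξ - η) ∂ν₁ ≤ C)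
    (h₂ : ∀ ξ, ∫⁻ η, k (ξ - η) ∂ν₂ ≤ C) {H Φ : 𝔼 × 𝔼 → ℝ≥0∞} (hH : Measurable H)
    (hΦ : ∀ x ξ, Φ (x, ξ) ≤ L * ∫⁻ w, k (x - w.1) * k (ξ - w.2) * H w
      ∂((volume : Measure 𝔼).prod ν₂)) :
    eLpNorm (fun ξ => eLpNorm (fun x => Φ (x, ξ)) s volume) t ν₁
      ≤ (L * C₀ * C : ℝ≥0) * eLpNorm (fun η => eLpNorm (fun x => H (x, η)) s volume) t ν₂ := by
  have hN : Measurable fun η => eLpNorm (fun x => H (x, η)) s volume :=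
    measurable_eLpNorm_ennreal s hH
  have hstep : ∀ ξ, eLpNorm (fun x => Φ (x, ξ)) s volume
      ≤ (∫⁻ η, k (ξ - η) * eLpNorm (fun x => H (x, η)) s volume ∂ν₂) * (C₀ * L) := by
    intro ξ
    have hk' : Measurable fun η => k (ξ - η) := hk.comp (measurable_const.sub measurable_id)
    have h3 := eLpNorm_lintegral_conv_le (ν := ν₂) hs hk hk' hkt (fun η => hkt _) hH
    have h4 : eLpNorm (fun x => Φ (x, ξ)) s volume ≤ eLpNorm (fun x =>
        (∫⁻ w, k (x - w.1) * k (ξ - w.2) * H w ∂((volume : Measure 𝔼).prod ν₂)) * L) s volume :=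
      eLpNorm_ennreal_mono fun x => (hΦ x ξ).trans_eq (mul_comm _ _)
    rw [eLpNorm_mul_const_ennreal _ ENNReal.coe_ne_top] at h4
    refine h4.trans ((mul_le_mul_left h3 _).trans ?_)
    rw [mul_comm (∫⁻ x, k x), mul_assoc]
    exact mul_le_mul_right (mul_le_mul_left h₀ _) _
  have hsch := eLpNorm_lintegral_kernel_le (μ := ν₁) (ν := ν₂) ht
    (k := fun w : 𝔼 × 𝔼 => k (w.1 - w.2)) (hk.comp (measurable_fst.sub measurable_snd)) hN h₂
    fun η => by simpa only [hkneg _ η] using h₁ η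
  refine (eLpNorm_ennreal_mono hstep).trans ?_
  rw [eLpNorm_mul_const_ennreal _ (ENNReal.mul_ne_top ENNReal.coe_ne_top ENNReal.coe_ne_top)]
  refine (mul_le_mul_left hsch _).trans (le_of_eq ?_)
  push_cast
  ring

/-- A short-time Fourier transform is controlled in mixed norms by the short-time Fourier transform
with respect to a reproducing window. -/
theorem IsReproducing.exists_mixedNorm_stft_le {p q : ℝ≥0∞} (hp : p ≠ 0) (hq : q ≠ 0)
    {Ω M : 𝔼 → ℝ≥0∞} (hΩ : IsRegularWeight Ω) (hM : IsRegularWeight M)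
    {ν₁ ν₂ : Measure 𝔼} [SFinite ν₁] [SFinite ν₂]
    (hν₁ : UniformlyFinite ν₁) (hν₂ : UniformlyFinite ν₂) {a b : 𝓢(𝔼, ℂ)}
    (hab : IsReproducing ν₂ a b) (γ : 𝓢(𝔼, ℂ)) :
    ∃ C : ℝ≥0, ∀ f : 𝓢'(𝔼, ℂ), mixedNorm p q Ω M ν₁ (fun z => ‖stft γ f z.1 z.2‖ₑ)
      ≤ C * mixedNorm p q Ω M ν₂ (fun z => ‖stft b f z.1 z.2‖ₑ) := by
  obtain ⟨A₁, hA₁⟩ := hΩ.moderate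
  obtain ⟨A₂, hA₂⟩ := hM.moderate
  obtain ⟨n₁, C₁, hC₁⟩ := hν₁.exists_forall
  obtain ⟨n₂, C₂, hC₂⟩ := hν₂.exists_forall
  obtain ⟨n₀, C₀, hC₀⟩ := (uniformlyFinite_volume (n := n)).exists_forall
  -- The cap at `1` keeps `r` finite when `p = q = ∞` and meets the requirement `r ≤ 1` of the
  -- self-improving inequality.
  set m := min 1 (min p q) with hm
  have hm0 : m ≠ 0 := by simp [hm, hp, hq]
  have hm1 : m ≤ 1 := min_le_left _ _
  have hmt : m ≠ ∞ := ne_top_of_le_ne_top ENNReal.one_ne_top hm1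
  set r := m.toReal with hrdef
  have hr0 : 0 < r := ENNReal.toReal_pos hm0 hmt
  have hr1 : r ≤ 1 := by simpa using ENNReal.toReal_mono ENNReal.one_ne_top hm1
  have hrm : ENNReal.ofReal r = m := ENNReal.ofReal_toReal hmt
  have hsp : 1 ≤ p / ENNReal.ofReal r := by
    rw [hrm, ENNReal.le_div_iff_mul_le (Or.inl hm0) (Or.inl hmt), one_mul]
    exact (min_le_right _ _).trans (min_le_left _ _)
  have hsq : 1 ≤ q / ENNReal.ofReal r := by
    rw [hrm, ENNReal.le_div_iff_mul_le (Or.inl hm0) (Or.inl hmt), one_mul]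
    exact (min_le_right _ _).trans (min_le_right _ _)
  -- `N₁` orders of decay suffice for all three measures. The factor `⌈r⁻¹⌉₊` in `N₂` makes them
  -- survive the `r`-th power, and the extra `A` in `N` pays for moving both weights under the
  -- integral.
  set N₁ := max n₀ (max n₁ n₂) with hN₁
  set N₂ := N₁ * ⌈r⁻¹⌉₊ with hN₂
  set A := max A₁ A₂ with hA
  set N := N₂ + A with hN
  -- Domination of `V_b f` by its own averages feeds the self-improvement; `L` is the constant of
  -- the change of window to `γ`.
  choose K hK using fun N => hab.exists_enorm_stft_le hν₂ b N
  obtain ⟨L, hL⟩ := hab.exists_enorm_stft_le hν₂ γ N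
  set κ : 𝔼 × 𝔼 → ℝ≥0∞ := fun z => (1 + ‖z.1‖ₑ) * (1 + ‖z.2‖ₑ) with hκdef
  have hκ : IsSubmultiplicative κ := isSubmultiplicative_one_add_enorm_prod
  set c : ℝ≥0 := L ^ r * K N ^ (1 - r) with hc
  set D : ℝ≥0 := c * C₀ * max C₁ C₂ with hD
  refine ⟨D ^ r⁻¹, fun f => ?_⟩
  set F : 𝔼 × 𝔼 → ℝ≥0∞ := fun z => ‖stft b f z.1 z.2‖ₑ with hF
  set G : 𝔼 × 𝔼 → ℝ≥0∞ := fun z => ‖stft γ f z.1 z.2‖ₑ with hG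
  have hgrowth : ∃ (A : ℝ≥0) (N : ℕ), ∀ z, F z ≤ A * κ z ^ N := by
    obtain ⟨B, C, hC, h⟩ := exists_norm_stft_le b f
    refine ⟨C.toNNReal, B, fun z => ?_⟩
    simp only [hF, hκdef]
    rw [← ofReal_norm, one_add_enorm_eq, one_add_enorm_eq,
      show (C.toNNReal : ℝ≥0∞) = ENNReal.ofReal C from rfl, ← ENNReal.ofReal_mul (by positivity),
      ← ENNReal.ofReal_pow (by positivity), ← ENNReal.ofReal_mul hC]
    exact ENNReal.ofReal_le_ofReal (h z.1 z.2)
  have hmain := rpow_le_lintegral_rpow hκ hr1 hr0 (F := F) (G := G) (K := K)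
    (fun N z => hK N f z) hgrowth (N := N) (L := L) (fun z => hL f z)
  have hcc : (L : ℝ≥0∞) ^ r * (K N : ℝ≥0∞) ^ (1 - r) = c := by
    rw [hc, ENNReal.coe_mul, ENNReal.coe_rpow_of_nonneg _ hr0.le,
      ENNReal.coe_rpow_of_nonneg _ (by linarith)]
  have hkey : ∀ u : 𝔼 × 𝔼, ((κ u ^ N)⁻¹ * κ u ^ A) ^ r ≤ (κ u ^ N₁)⁻¹ := by
    intro u
    have h0 : κ u ^ A ≠ 0 := pow_ne_zero _ (zero_lt_one.trans_le (hκ.one_le u)).ne'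
    have h1 : κ u ^ A ≠ ∞ := ENNReal.pow_ne_top (hκ.ne_top u)
    rw [hN, pow_add, ENNReal.mul_inv (Or.inr h1) (Or.inr h0), mul_assoc,
      ENNReal.inv_mul_cancel h0 h1, mul_one, ENNReal.inv_rpow, ENNReal.inv_le_inv,
      ← ENNReal.rpow_natCast, ← ENNReal.rpow_natCast, ← ENNReal.rpow_mul]
    refine ENNReal.rpow_le_rpow_of_exponent_le (hκ.one_le u) ?_
    have h2 : r⁻¹ ≤ ⌈r⁻¹⌉₊ := Nat.le_ceil _
    have h3 : 1 ≤ (⌈r⁻¹⌉₊ : ℝ) * r := by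
      calc (1 : ℝ) = r⁻¹ * r := (inv_mul_cancel₀ hr0.ne').symm
        _ ≤ _ := by gcongr
    rw [hN₂]
    push_cast
    rw [mul_assoc]
    exact le_mul_of_one_le_right (by positivity) h3
  have hH : Measurable fun w : 𝔼 × 𝔼 => (F w * Ω w.1 * M w.2) ^ r := by
    have h1 : Measurable F := (continuous_stft b f).measurable.enorm
    exact ((h1.mul (hΩ.measurable.comp measurable_fst)).mul
      (hM.measurable.comp measurable_snd)).pow_const r
  have hΦ : ∀ x ξ, (G (x, ξ) * Ω x * M ξ) ^ r ≤ c * ∫⁻ w, ((1 + ‖x - w.1‖ₑ) ^ N₁)⁻¹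
      * ((1 + ‖ξ - w.2‖ₑ) ^ N₁)⁻¹ * (F w * Ω w.1 * M w.2) ^ r
        ∂((volume : Measure 𝔼).prod ν₂) := by
    intro x ξ
    have hfin : (Ω x * M ξ) ^ r ≠ ∞ := ENNReal.rpow_ne_top_of_nonneg hr0.le
      (ENNReal.mul_ne_top (hΩ.ne_top x) (hM.ne_top ξ))
    rw [mul_assoc, ENNReal.mul_rpow_of_nonneg _ _ hr0.le]
    calc G (x, ξ) ^ r * (Ω x * M ξ) ^ r
        ≤ (c * ∫⁻ w, (F w * (κ ((x, ξ) - w) ^ N)⁻¹) ^ r ∂((volume : Measure 𝔼).prod ν₂))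
            * (Ω x * M ξ) ^ r := by
          gcongr
          rw [← hcc]
          exact hmain (x, ξ)
      _ = c * ∫⁻ w, (F w * (κ ((x, ξ) - w) ^ N)⁻¹) ^ r * (Ω x * M ξ) ^ r
            ∂((volume : Measure 𝔼).prod ν₂) := by
          rw [mul_assoc, lintegral_mul_const' _ _ hfin]
      _ ≤ _ := by
          refine mul_le_mul_right (lintegral_mono fun w => ?_) _
          have hw : Ω x * M ξ ≤ κ ((x, ξ) - w) ^ A * (Ω w.1 * M w.2) := by
            have e1 : Ω x ≤ (1 + ‖x - w.1‖ₑ) ^ A * Ω w.1 := by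
              refine (IsRegularWeight.le_mul hA₁ x w.1).trans ?_
              gcongr
              · exact le_self_add
              · exact le_max_left _ _
            have e2 : M ξ ≤ (1 + ‖ξ - w.2‖ₑ) ^ A * M w.2 := by
              refine (IsRegularWeight.le_mul hA₂ ξ w.2).trans ?_
              gcongr
              · exact le_self_add
              · exact le_max_right _ _
            calc Ω x * M ξ ≤ _ := mul_le_mul' e1 e2
              _ = _ := by
                simp only [hκdef, Prod.fst_sub, Prod.snd_sub, mul_pow]
                ring
          have hkap : (κ ((x, ξ) - w) ^ N₁)⁻¹
              = ((1 + ‖x - w.1‖ₑ) ^ N₁)⁻¹ * ((1 + ‖ξ - w.2‖ₑ) ^ N₁)⁻¹ := by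
            simp only [hκdef, Prod.fst_sub, Prod.snd_sub, mul_pow]
            exact ENNReal.mul_inv (by simp) (by simp)
          calc (F w * (κ ((x, ξ) - w) ^ N)⁻¹) ^ r * (Ω x * M ξ) ^ r
              ≤ (F w * (κ ((x, ξ) - w) ^ N)⁻¹) ^ r
                * (κ ((x, ξ) - w) ^ A * (Ω w.1 * M w.2)) ^ r := by gcongr
            _ = ((κ ((x, ξ) - w) ^ N)⁻¹ * κ ((x, ξ) - w) ^ A) ^ r
                * (F w * Ω w.1 * M w.2) ^ r := by
              rw [← ENNReal.mul_rpow_of_nonneg _ _ hr0.le, ← ENNReal.mul_rpow_of_nonneg _ _ hr0.le]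
              congr 1
              ring
            _ ≤ _ := by
              rw [← hkap]
              gcongr
              exact hkey _
  have hfinal := eLpNorm_eLpNorm_le_of_le_lintegral hsp hsq
    (k := fun x => ((1 + ‖x‖ₑ) ^ N₁)⁻¹) (measurable_inv_one_add_enorm_pow N₁)
    (fun x => ENNReal.inv_ne_top.2 (one_add_enorm_pow_ne_zero x N₁))
    (fun x y => by rw [← enorm_neg, neg_sub]) (C₀ := C₀)
    (C := max C₁ C₂) (by simpa using hC₀ N₁ (le_max_left _ _) 0)
    (fun ξ => (hC₁ N₁ ((le_max_left _ _).trans (le_max_right _ _)) ξ).trans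
      (by exact_mod_cast le_max_left _ _))
    (fun ξ => (hC₂ N₁ ((le_max_right _ _).trans (le_max_right _ _)) ξ).trans
      (by exact_mod_cast le_max_right _ _)) hH
      (Φ := fun z => (G z * Ω z.1 * M z.2) ^ r) hΦ
  rw [← mixedNorm_rpow hM.ne_top ν₁ G hr0, ← mixedNorm_rpow hM.ne_top ν₂ F hr0] at hfinal
  have h5 := ENNReal.rpow_le_rpow hfinal (inv_nonneg.2 hr0.le)
  rwa [ENNReal.mul_rpow_of_nonneg _ _ (inv_nonneg.2 hr0.le), ← ENNReal.rpow_mul,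
    ← ENNReal.rpow_mul, mul_inv_cancel₀ hr0.ne', ENNReal.rpow_one, ENNReal.rpow_one,
    ← ENNReal.coe_rpow_of_nonneg _ (inv_nonneg.2 hr0.le)] at h5

end ModulationSpaces

end

noncomputable section

namespace ModulationSpaces

open FourierTransform SchwartzMap

variable {n : ℕ}

local notation "𝔼" => EuclideanSpace ℝ (Fin n)

/-! ### The counting measure on the integer lattice -/

@[simp]
theorem latticePoint_apply (k : Fin n → ℤ) (i : Fin n) : latticePoint k i = k i := rfl

/-- The counting measure on the integer lattice. -/
def latticeMeasure (n : ℕ) : Measure (EuclideanSpace ℝ (Fin n)) :=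
  Measure.sum fun k : Fin n → ℤ => Measure.dirac (latticePoint k)

instance : SFinite (latticeMeasure n) := by
  unfold latticeMeasure
  infer_instance

theorem lintegral_latticeMeasure (F : 𝔼 → ℝ≥0∞) :
    ∫⁻ η, F η ∂latticeMeasure n = ∑' k : Fin n → ℤ, F (latticePoint k) := by
  simp [latticeMeasure, lintegral_sum_measure]

theorem ae_latticeMeasure_iff {P : 𝔼 → Prop} :
    (∀ᵐ η ∂latticeMeasure n, P η) ↔ ∀ k : Fin n → ℤ, P (latticePoint k) := by
  simp [latticeMeasure, ae_dirac_eq]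

theorem essSup_latticeMeasure (F : 𝔼 → ℝ≥0∞) :
    essSup F (latticeMeasure n) = ⨆ k : Fin n → ℤ, F (latticePoint k) := by
  refine le_antisymm (essSup_le_of_ae_le _ ?_) (iSup_le ?_)
  · exact ae_latticeMeasure_iff.2 fun k => le_iSup (fun k => F (latticePoint k)) k
  · exact ae_latticeMeasure_iff.1 (ENNReal.ae_le_essSup F)

theorem eLpNorm_latticeMeasure {q : ℝ≥0∞} (hq : q ≠ 0) (F : 𝔼 → ℝ≥0∞) :
    eLpNorm F q (latticeMeasure n) = if q = ∞ then ⨆ k : Fin n → ℤ, F (latticePoint k)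
      else (∑' k : Fin n → ℤ, F (latticePoint k) ^ q.toReal) ^ (1 / q.toReal) := by
  split_ifs with h
  · subst h
    simp only [eLpNorm_exponent_top, eLpNormEssSup, enorm_eq_self]
    exact essSup_latticeMeasure F
  · rw [eLpNorm_eq_lintegral_ennreal hq h, lintegral_latticeMeasure]

theorem one_le_dist_latticePoint {k l : Fin n → ℤ} (h : k ≠ l) :
    1 ≤ dist (latticePoint k) (latticePoint l) := by
  obtain ⟨i, hi⟩ := Function.ne_iff.1 h
  rw [dist_eq_norm]
  refine le_trans ?_ (PiLp.norm_apply_le (latticePoint k - latticePoint l) i)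
  rw [PiLp.sub_apply, latticePoint_apply, latticePoint_apply, Real.norm_eq_abs]
  exact_mod_cast Int.one_le_abs (sub_ne_zero.2 hi)

/-- The balls of radius `1 / 2` about lattice points are disjoint, and on each `1 + ‖ξ - η‖` is at
most twice its analogue at the centre. The lattice sum is thus bounded by the Lebesgue integral. -/
theorem uniformlyFinite_latticeMeasure : UniformlyFinite (latticeMeasure n) := by
  obtain ⟨N, C, h⟩ := uniformlyFinite_volume (n := n)
  set B : Set 𝔼 := Metric.ball 0 (1 / 2) with hB
  have hB0 : volume B ≠ 0 := (Metric.measure_ball_pos _ _ (by norm_num)).ne'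
  have hBt : volume B ≠ ∞ := measure_ball_lt_top.ne
  have hball : ∀ k : Fin n → ℤ, volume (Metric.ball (latticePoint k) (1 / 2)) = volume B :=
    fun k => Measure.addHaar_ball_center volume _ _
  have hk : ∀ (ξ : 𝔼) (k : Fin n → ℤ), ((1 + ‖ξ - latticePoint k‖ₑ) ^ N)⁻¹ * volume B
      ≤ 2 ^ N * ∫⁻ η in Metric.ball (latticePoint k) (1 / 2), ((1 + ‖ξ - η‖ₑ) ^ N)⁻¹ := by
    intro ξ k
    rw [← hball k, ← setLIntegral_const, ← lintegral_const_mul' _ _ (by simp)]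
    refine setLIntegral_mono' measurableSet_ball fun η hη => ?_
    have h1 : 1 + ‖ξ - η‖ₑ ≤ 2 * (1 + ‖ξ - latticePoint k‖ₑ) := by
      have h2 := isSubmultiplicative_one_add_enorm.add_le (latticePoint k - η)
        (ξ - latticePoint k)
      rw [sub_add_sub_cancel'] at h2
      refine h2.trans ?_
      gcongr
      have h3 : ‖latticePoint k - η‖ₑ ≤ 1 := by
        rw [← edist_eq_enorm_sub, edist_comm, edist_dist]
        refine ENNReal.ofReal_le_one.2 ?_
        have := Metric.mem_ball.1 hη
        linarith
      exact (add_le_add_right h3 1).trans_eq one_add_one_eq_two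
    rw [← div_eq_mul_inv, ENNReal.le_div_iff_mul_le (Or.inl (one_add_enorm_pow_ne_zero _ _))
      (Or.inl (one_add_enorm_pow_ne_top _ _)), mul_comm, ← div_eq_mul_inv]
    refine ENNReal.div_le_of_le_mul ?_
    rw [← mul_pow]
    gcongr
  have hdisj : Pairwise (Function.onFun Disjoint
      fun k : Fin n → ℤ => Metric.ball (latticePoint k) (1 / 2)) := fun k l hkl =>
    Metric.ball_disjoint_ball (by linarith [one_le_dist_latticePoint hkl])
  refine ⟨N, (2 ^ N * C / volume B).toNNReal, fun ξ => ?_⟩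
  rw [ENNReal.coe_toNNReal (ENNReal.div_ne_top (ENNReal.mul_ne_top (by simp) ENNReal.coe_ne_top)
    hB0), ENNReal.le_div_iff_mul_le (Or.inl hB0) (Or.inl hBt), lintegral_latticeMeasure,
    ← ENNReal.tsum_mul_right]
  refine (ENNReal.tsum_le_tsum (hk ξ)).trans ?_
  rw [ENNReal.tsum_mul_left, ← lintegral_iUnion (fun k => measurableSet_ball) hdisj]
  gcongr
  exact (setLIntegral_le_lintegral _ _).trans (h ξ)

/-! ### Windows for the frequency-uniform decomposition -/

theorem finite_support_sub_latticePoint {ρ : 𝔼 → ℝ} (hρ : IsCubeBump ρ) (ξ : 𝔼) :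
    (Function.support fun l : Fin n → ℤ => ρ (ξ - latticePoint l)).Finite := by
  refine Set.Finite.subset (Set.Finite.pi' fun i : Fin n => Set.finite_Icc (⌊ξ i⌋ - 1) (⌊ξ i⌋ + 2))
    fun l hl i => ?_
  have hlt : |ξ i - l i| < 1 := by
    by_contra! h
    exact hl (hρ.eq_zero _ ⟨i, by simpa using h⟩)
  rw [abs_lt] at hlt
  have h2 := Int.floor_le (ξ i)
  have h3 := Int.lt_floor_add_one (ξ i)
  constructor
  · have h4 : ((⌊ξ i⌋ - 1 : ℤ) : ℝ) < (l i : ℝ) := by push_cast; linarith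
    exact le_of_lt (by exact_mod_cast h4)
  · have h4 : (l i : ℝ) < ((⌊ξ i⌋ + 2 : ℤ) : ℝ) := by push_cast; linarith
    exact le_of_lt (by exact_mod_cast h4)

theorem tsum_sub_latticePoint_pos {ρ : 𝔼 → ℝ} (hρ : IsCubeBump ρ) (ξ : 𝔼) :
    0 < ∑' l : Fin n → ℤ, ρ (ξ - latticePoint l) := by
  refine (summable_of_hasFiniteSupport (finite_support_sub_latticePoint hρ ξ)).tsum_pos
    (fun l => (hρ.mem_Icc _).1) (fun i => round (ξ i)) ?_
  rw [hρ.eq_one _ fun i => by simpa using abs_sub_round (ξ i)]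
  exact one_pos

theorem hasSum_freqCutoff {ρ : 𝔼 → ℝ} (hρ : IsCubeBump ρ) (ξ : 𝔼) :
    HasSum (fun k : Fin n → ℤ => freqCutoff ρ k ξ) 1 := by
  have hs : Summable fun l : Fin n → ℤ => ρ (ξ - latticePoint l) :=
    summable_of_hasFiniteSupport (finite_support_sub_latticePoint hρ ξ)
  have h := hs.hasSum.div_const (∑' l : Fin n → ℤ, ρ (ξ - latticePoint l))
  rwa [div_self (tsum_sub_latticePoint_pos hρ ξ).ne'] at h

theorem latticePoint_add (k l : Fin n → ℤ) :
    latticePoint (k + l) = latticePoint k + latticePoint l := by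
  ext i
  simp

theorem freqCutoff_eq_zero_sub (ρ : 𝔼 → ℝ) (k : Fin n → ℤ) (ξ : 𝔼) :
    freqCutoff ρ k ξ = freqCutoff ρ 0 (ξ - latticePoint k) := by
  have h0 : (latticePoint 0 : 𝔼) = 0 := by ext i; simp
  rw [freqCutoff, freqCutoff, h0, sub_zero, ← (Equiv.addLeft k).tsum_eq]
  simp [latticePoint_add, sub_sub]

theorem hasCompactSupport_of_eq_zero {E : Type*} [Zero E] {g : 𝔼 → E} {R : ℝ}
    (h : ∀ ξ : 𝔼, (∃ i, R ≤ |ξ i|) → g ξ = 0) : HasCompactSupport g := by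
  refine HasCompactSupport.intro (isCompact_closedBall (0 : 𝔼) (Real.sqrt (∑ _i : Fin n, R ^ 2)))
    fun ξ hξ => h ξ ?_
  by_contra! hlt
  apply hξ
  rw [Metric.mem_closedBall, dist_zero_right, EuclideanSpace.norm_eq]
  refine Real.sqrt_le_sqrt (Finset.sum_le_sum fun i _ => ?_)
  exact pow_le_pow_left₀ (norm_nonneg _) (hlt i).le 2

/-- The Schwartz function `σ₀`. -/
def cutoffSchwartz {ρ : 𝔼 → ℝ} (hρ : IsCubeBump ρ) : 𝓢(𝔼, ℂ) :=
  HasCompactSupport.toSchwartzMap (f := fun ξ => (freqCutoff ρ 0 ξ : ℂ))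
    (hasCompactSupport_of_eq_zero (R := 1) fun ξ hξ => by
      have h0 : (latticePoint 0 : 𝔼) = 0 := by ext i; simp
      simp [freqCutoff, h0, hρ.eq_zero ξ hξ])
    (hasTemperateGrowth_freqCutoff hρ 0).1

theorem cutoffSchwartz_apply {ρ : 𝔼 → ℝ} (hρ : IsCubeBump ρ) (ξ : 𝔼) :
    cutoffSchwartz hρ ξ = freqCutoff ρ 0 ξ := rfl

/-- The dilate `ρ (ξ / 2)` equals `1` on the cube `|ξ|_∞ ≤ 1`, off which `σ₀` vanishes. -/
theorem exists_schwartz_mul_cutoffSchwartz {ρ : 𝔼 → ℝ} (hρ : IsCubeBump ρ) :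
    ∃ u : 𝓢(𝔼, ℂ), ∀ ξ, (starRingEnd ℂ) (u ξ) * cutoffSchwartz hρ ξ = cutoffSchwartz hρ ξ := by
  refine ⟨HasCompactSupport.toSchwartzMap (f := fun ξ => (ρ ((2⁻¹ : ℝ) • ξ) : ℂ))
    (hasCompactSupport_of_eq_zero (R := 2) fun ξ ⟨i, hi⟩ => ?_) ?_, fun ξ => ?_⟩
  · rw [hρ.eq_zero _ ⟨i, ?_⟩, Complex.ofReal_zero]
    rw [PiLp.smul_apply, smul_eq_mul, abs_mul, abs_of_pos (by norm_num)]
    linarith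
  · exact Complex.ofRealCLM.contDiff.comp (hρ.contDiff.comp (contDiff_const_smul _))
  · change (starRingEnd ℂ) (ρ ((2⁻¹ : ℝ) • ξ) : ℂ) * _ = _
    by_cases h : ∃ i, 1 ≤ |ξ i|
    · have h0 : (latticePoint 0 : 𝔼) = 0 := by ext i; simp
      simp [cutoffSchwartz_apply, freqCutoff, h0, hρ.eq_zero ξ h]
    · push Not at h
      rw [hρ.eq_one _ fun i => ?_]
      · simp
      · rw [PiLp.smul_apply, smul_eq_mul, abs_mul, abs_of_pos (by norm_num)]
        linarith [h i]

/-- The window `𝓕⁻¹ σ₀`. -/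
def boxWindow {ρ : 𝔼 → ℝ} (hρ : IsCubeBump ρ) : 𝓢(𝔼, ℂ) := 𝓕⁻ (cutoffSchwartz hρ)

theorem fourier_boxWindow {ρ : 𝔼 → ℝ} (hρ : IsCubeBump ρ) :
    𝓕 (boxWindow hρ) = cutoffSchwartz hρ :=
  fourier_fourierInv_eq _

/-- With `𝓕 a = 1` wherever `σ₀` is nonzero, the reproducing condition is the partition of unity `∑
σ_k = 1`. -/
theorem exists_isReproducing_latticeMeasure {ρ : 𝔼 → ℝ} (hρ : IsCubeBump ρ) :
    ∃ a, IsReproducing (latticeMeasure n) a (boxWindow hρ) := by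
  obtain ⟨u, hu⟩ := exists_schwartz_mul_cutoffSchwartz hρ
  refine ⟨𝓕⁻ u, fun ξ => ?_⟩
  simp_rw [fourier_boxWindow, fourier_fourierInv_eq, hu]
  have hs := hasSum_freqCutoff hρ ξ
  have hk : ∀ k : Fin n → ℤ, cutoffSchwartz hρ (ξ - latticePoint k) = freqCutoff ρ k ξ := fun k => by
    rw [cutoffSchwartz_apply, ← freqCutoff_eq_zero_sub]
  have hi : Integrable (fun η => cutoffSchwartz hρ (ξ - η)) (latticeMeasure n) := by
    refine integrable_sum_measure (fun k => integrable_dirac (by simp)) ?_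
    simp_rw [integral_dirac, hk, Complex.norm_real]
    exact hs.summable.norm
  refine (hasSum_integral_measure hi).unique ?_
  simp_rw [integral_dirac, hk]
  simpa using (Complex.hasSum_ofReal (f := fun k => freqCutoff ρ k ξ)).2 hs

/-- By translation invariance the integral does not depend on `ξ`, so `φ` divided by the squared
`L₂` norm of `𝓕 φ` serves as `a`. -/
theorem exists_isReproducing_volume {φ : 𝓢(𝔼, ℂ)} (hφ : φ ≠ 0) :
    ∃ a, IsReproducing volume a φ := by
  set I : ℝ := ∫ ξ, ‖𝓕 φ ξ‖ ^ 2 with hI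
  have hI0 : I ≠ 0 := by
    intro h0
    apply hφ
    have hint : Integrable fun ξ => ‖𝓕 φ ξ‖ ^ 2 := ((𝓕 φ).memLp 2 volume).integrable_norm_pow
      (by norm_num)
    rw [hI, integral_eq_zero_iff_of_nonneg (fun ξ => by positivity) hint] at h0
    have hz : (fun ξ => ‖𝓕 φ ξ‖ ^ 2) = fun _ => (0 : ℝ) :=
      (Continuous.ae_eq_iff_eq volume ((𝓕 φ).continuous.norm.pow 2) continuous_const).1 h0
    have h1 : 𝓕 φ = 0 := by
      ext ξ
      simpa using congrFun hz ξ
    rw [← fourierInv_fourier_eq (E := 𝓢(𝔼, ℂ)) (F := 𝓢(𝔼, ℂ)) φ, h1]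
    exact map_zero (fourierInvCLM ℂ 𝓢(𝔼, ℂ))
  refine ⟨((I⁻¹ : ℝ) : ℂ) • φ, fun ξ => ?_⟩
  have h1 : 𝓕 (((I⁻¹ : ℝ) : ℂ) • φ) = ((I⁻¹ : ℝ) : ℂ) • 𝓕 φ :=
    map_smul (fourierCLM ℂ 𝓢(𝔼, ℂ)) _ φ
  rw [integral_sub_left_eq_self (fun η => (starRingEnd ℂ) (𝓕 (((I⁻¹ : ℝ) : ℂ) • φ) η) * 𝓕 φ η)]
  have h2 : ∀ η, (starRingEnd ℂ) (𝓕 (((I⁻¹ : ℝ) : ℂ) • φ) η) * 𝓕 φ η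
      = ((I⁻¹ * ‖𝓕 φ η‖ ^ 2 : ℝ) : ℂ) := by
    intro η
    rw [h1, smul_apply, smul_eq_mul, map_mul, Complex.conj_ofReal, mul_assoc, Complex.conj_mul']
    push_cast
    rfl
  simp_rw [h2]
  rw [integral_complex_ofReal, integral_const_mul, ← hI, inv_mul_cancel₀ hI0, Complex.ofReal_one]

end ModulationSpaces

end

noncomputable section

namespace ModulationSpaces

open FourierTransform SchwartzMap

variable {n : ℕ}

local notation "𝔼" => EuclideanSpace ℝ (Fin n)

/-! ### Functions representing tempered distributions -/

theorem IsRepresentedBy.locallyIntegrable {T : 𝓢'(𝔼, ℂ)} {g : 𝔼 → ℂ} (h : IsRepresentedBy T g) :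
    LocallyIntegrable g volume := by
  intro x
  -- Testing against a bump equal to `1` on the unit ball about `x` gives integrability of `g`
  -- there.
  set B : ContDiffBump x := ⟨1, 2, one_pos, one_lt_two⟩ with hB
  refine ⟨Metric.closedBall x 1, Metric.closedBall_mem_nhds x one_pos, ?_⟩
  have hc : HasCompactSupport fun y => (B y : ℂ) :=
    B.hasCompactSupport.comp_left (g := Complex.ofReal) Complex.ofReal_zero
  have hs : ContDiff ℝ ((⊤ : ℕ∞) : WithTop ℕ∞) fun y => (B y : ℂ) :=
    Complex.ofRealCLM.contDiff.comp B.contDiff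
  refine (h (hc.toSchwartzMap hs)).1.integrableOn.congr_fun (fun y hy => ?_)
    measurableSet_closedBall
  change (B y : ℂ) * g y = g y
  rw [B.one_of_mem_closedBall hy, Complex.ofReal_one, one_mul]

theorem IsRepresentedBy.ae_eq {T : 𝓢'(𝔼, ℂ)} {g g' : 𝔼 → ℂ} (h : IsRepresentedBy T g)
    (h' : IsRepresentedBy T g') : g =ᵐ[volume] g' := by
  refine ae_eq_of_integral_contDiff_smul_eq h.locallyIntegrable h'.locallyIntegrable
    fun u hu hc => ?_
  have hc' : HasCompactSupport fun y => (u y : ℂ) :=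
    hc.comp_left (g := Complex.ofReal) Complex.ofReal_zero
  have hu' : ContDiff ℝ ((⊤ : ℕ∞) : WithTop ℕ∞) fun y => (u y : ℂ) :=
    Complex.ofRealCLM.contDiff.comp hu
  simp only [Complex.real_smul]
  exact (h (hc'.toSchwartzMap hu')).2.symm.trans (h' (hc'.toSchwartzMap hu')).2

theorem IsRepresentedBy.distLpNorm_eq {T : 𝓢'(𝔼, ℂ)} {g : 𝔼 → ℂ} (h : IsRepresentedBy T g)
    (p : ℝ≥0∞) (w : 𝔼 → ℝ) : distLpNorm p w T = weightedLpNorm p w g := by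
  refine le_antisymm (iInf₂_le g h) (le_iInf₂ fun g' h' => le_of_eq ?_)
  refine eLpNorm_congr_ae ?_
  filter_upwards [h.ae_eq h'] with x hx
  rw [hx]

/-! ### The frequency-uniform decomposition and the short-time Fourier transform -/

theorem conj_timeFreqShift_boxWindow {ρ : 𝔼 → ℝ} (hρ : IsCubeBump ρ) (k : Fin n → ℤ) (x t : 𝔼) :
    character (latticePoint k) x
        * (starRingEnd ℂ) (timeFreqShift x (latticePoint k) (boxWindow hρ) t)
      = (starRingEnd ℂ) (𝓕 (timeFreqShift (latticePoint k) t (cutoffSchwartz hρ)) x) := by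
  have h1 : 𝓕 (cutoffSchwartz hρ) (x - t) = boxWindow hρ (t - x) := by
    rw [boxWindow, fourierInv_eq_integral, fourier_eq_integral, neg_sub]
  rw [fourier_timeFreqShift_apply, h1, timeFreqShift_apply, map_mul, map_mul, conj_character,
    conj_character, ← mul_assoc, neg_neg, character_comm (x - t), sub_eq_add_neg x t,
    character_add_right, character_neg_right]

/-- The left side is the transpose of `□_k` on a test function. Plancherel turns it into a
superposition of conjugated time-frequency shifts of `𝓕⁻ σ₀`, all at frequency `k`. -/
theorem fourier_freqCutoff_smul_eq_integral {ρ : 𝔼 → ℝ} (hρ : IsCubeBump ρ) (k : Fin n → ℤ)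
    (ψ : 𝓢(𝔼, ℂ)) (t : 𝔼) :
    𝓕 (smulLeftCLM ℂ (fun ξ => (freqCutoff ρ k ξ : ℂ)) (𝓕⁻ ψ)) t
      = ∫ x, (ψ x * character (latticePoint k) x)
        * (starRingEnd ℂ) (timeFreqShift x (latticePoint k) (boxWindow hρ) t) := by
  simp_rw [mul_assoc, conj_timeFreqShift_boxWindow hρ]
  have h1 := schwartzInner_fourier (𝓕⁻ ψ) (timeFreqShift (latticePoint k) t (cutoffSchwartz hρ))
  rw [fourier_fourierInv_eq, schwartzInner, schwartzInner] at h1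
  simp_rw [mul_comm (ψ _)]
  rw [h1, fourier_eq_integral]
  refine integral_congr_ae (Filter.Eventually.of_forall fun u => ?_)
  simp only [timeFreqShift_apply, map_mul, conj_character, cutoffSchwartz_apply,
    Complex.conj_ofReal, ← freqCutoff_eq_zero_sub,
    smulLeftCLM_apply_apply (hasTemperateGrowth_freqCutoff hρ k), smul_eq_mul, mul_assoc]

theorem continuous_conjSchwartz_timeFreqShift_left (b : 𝓢(𝔼, ℂ)) (ξ : 𝔼) :
    Continuous fun x => conjSchwartz (timeFreqShift x ξ b) := by
  have h := (continuous_conjSchwartz_timeFreqShift b).comp (Continuous.prodMk_left ξ)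
  exact h

theorem integrable_seminorm_smul_timeFreqShift (b ψ : 𝓢(𝔼, ℂ)) {χ : 𝔼 → ℂ}
    (hχ1 : ∀ x, ‖χ x‖ = 1) (ξ : 𝔼) (r l : ℕ) :
    Integrable (fun x => SchwartzMap.seminorm ℝ r l
      ((ψ x * χ x) • conjSchwartz (timeFreqShift x ξ b))) volume := by
  have hq : Continuous (SchwartzMap.seminorm ℝ r l : Seminorm ℝ 𝓢(𝔼, ℂ)) :=
    (schwartz_withSeminorms ℝ 𝔼 ℂ).continuous_seminorm (r, l)
  obtain ⟨A, C, hC, hA⟩ := exists_seminorm_conjSchwartz_timeFreqShift_le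
    (SchwartzMap.seminorm ℝ r l) hq b
  have hcs := continuous_conjSchwartz_timeFreqShift_left b ξ
  have hcont : Continuous fun x => SchwartzMap.seminorm ℝ r l
      (conjSchwartz (timeFreqShift x ξ b)) := hq.comp hcs
  simp_rw [seminorm_complex_smul, norm_mul, hχ1, mul_one]
  have hm : Continuous fun x => ‖ψ x‖ * SchwartzMap.seminorm ℝ r l
      (conjSchwartz (timeFreqShift x ξ b)) := ψ.continuous.norm.mul hcont
  refine ((integrable_one_add_pow_mul_norm ψ A).const_mul (C * (1 + ‖ξ‖) ^ A)).mono'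
    hm.aestronglyMeasurable (Filter.Eventually.of_forall fun x => ?_)
  rw [Real.norm_of_nonneg (mul_nonneg (norm_nonneg _) (apply_nonneg _ _))]
  calc _ ≤ ‖ψ x‖ * (C * ((1 + ‖x‖) * (1 + ‖ξ‖)) ^ A) := by
        gcongr
        exact hA x _
    _ = _ := by rw [mul_pow]; ring

/-- A superposition of time-frequency shifts is mapped to a superposition of values of the
short-time Fourier transform. -/
theorem integral_mul_stft (b ψ : 𝓢(𝔼, ℂ)) {χ : 𝔼 → ℂ} (hχ : Continuous χ)
    (hχ1 : ∀ x, ‖χ x‖ = 1) (ξ : 𝔼) {s : 𝓢(𝔼, ℂ)}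
    (hs : ∀ t, s t = ∫ x, (ψ x * χ x) * (starRingEnd ℂ) (timeFreqShift x ξ b t)) (f : 𝓢'(𝔼, ℂ)) :
    Integrable (fun x => ψ x * (χ x * stft b f x ξ)) volume ∧
      f s = ∫ x, ψ x * (χ x * stft b f x ξ) := by
  have hcs := continuous_conjSchwartz_timeFreqShift_left b ξ
  have hc : Continuous fun x => (ψ x * χ x) • conjSchwartz (timeFreqShift x ξ b) :=
    Continuous.smul (f := fun x => ψ x * χ x) (ψ.continuous.mul hχ) hcs
  have hs' : ∀ t, s t = ∫ x, ((ψ x * χ x) • conjSchwartz (timeFreqShift x ξ b)) t := fun t => by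
    simp only [hs, smul_apply, smul_eq_mul, conjSchwartz_apply]
  have h1 := map_eq_integral hc (integrable_seminorm_smul_timeFreqShift b ψ hχ1 ξ) hs'
    (realLinear f)
  have h2 : ∀ x, realLinear f ((ψ x * χ x) • conjSchwartz (timeFreqShift x ξ b))
      = ψ x * (χ x * stft b f x ξ) := fun x => by
    rw [← mul_assoc]
    exact map_smul f _ _
  simp_rw [h2] at h1
  exact h1

theorem isRepresentedBy_boxOp {ρ : 𝔼 → ℝ} (hρ : IsCubeBump ρ) (k : Fin n → ℤ) (f : 𝓢'(𝔼, ℂ)) :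
    IsRepresentedBy (boxOp ρ k f) fun x =>
      character (latticePoint k) x * stft (boxWindow hρ) f x (latticePoint k) := fun ψ =>
  integral_mul_stft (boxWindow hρ) ψ
    (continuous_character_comp continuous_const continuous_id) (norm_character _) (latticePoint k)
    (fourier_freqCutoff_smul_eq_integral hρ k ψ) f

/-! ### Comparison with mixed norms -/

/-- The `L_q(ν)` norm in `ξ`, with weight `m`, of the `L_p` norm in `x`, with weight `ω`, of the
short-time Fourier transform. -/
def stftNorm (p q : ℝ≥0∞) (m ω : 𝔼 → ℝ) (ν : Measure 𝔼) (γ : 𝓢(𝔼, ℂ)) (f : 𝓢'(𝔼, ℂ)) : ℝ≥0∞ :=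
  eLpNorm (fun ξ => weightedLpNorm p ω (fun x => stft γ f x ξ) * ENNReal.ofReal (m ξ)) q ν

theorem modulationNorm_eq_stftNorm (p q : ℝ≥0∞) (m ω : 𝔼 → ℝ) (φ : 𝓢(𝔼, ℂ)) (f : 𝓢'(𝔼, ℂ)) :
    modulationNorm p q m ω φ f = stftNorm p q m ω volume φ f := rfl

/-- The representing function of `□_k f` is essentially unique, its character factor has modulus
`1`, and `L_q` of the lattice measure is `ℓ_q`. -/
theorem discreteModulationNorm_eq_stftNorm {p q : ℝ≥0∞} (hq : q ≠ 0) (m ω : 𝔼 → ℝ) {ρ : 𝔼 → ℝ}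
    (hρ : IsCubeBump ρ) (f : 𝓢'(𝔼, ℂ)) :
    discreteModulationNorm p q m ω ρ f
      = stftNorm p q m ω (latticeMeasure n) (boxWindow hρ) f := by
  have h1 : ∀ k : Fin n → ℤ, distLpNorm p ω (boxOp ρ k f)
      = weightedLpNorm p ω fun x => stft (boxWindow hρ) f x (latticePoint k) := fun k => by
    rw [(isRepresentedBy_boxOp hρ k f).distLpNorm_eq]
    exact eLpNorm_congr_norm_ae (Filter.Eventually.of_forall fun x => by simp)
  rw [stftNorm, eLpNorm_latticeMeasure hq, discreteModulationNorm]
  simp_rw [h1]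

theorem weightedLpNorm_eq {p : ℝ≥0∞} {w : 𝔼 → ℝ} (hw : ∀ x, 0 ≤ w x) (g : 𝔼 → ℂ) :
    weightedLpNorm p w g = eLpNorm (fun x => ‖g x‖ₑ * ENNReal.ofReal (w x)) p volume := by
  refine eLpNorm_congr_enorm_ae (Filter.Eventually.of_forall fun x => ?_)
  rw [enorm_mul, enorm_eq_self, ← ofReal_norm (w x : ℂ), Complex.norm_real,
    Real.norm_of_nonneg (hw x)]

theorem mixedNorm_mono_weight {p q : ℝ≥0∞} {Ω M Ω' M' : 𝔼 → ℝ≥0∞} {c d : ℝ≥0}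
    (hΩ : ∀ x, Ω x ≤ c * Ω' x) (hM : ∀ ξ, M ξ ≤ d * M' ξ) (ν : Measure 𝔼) (F : 𝔼 × 𝔼 → ℝ≥0∞) :
    mixedNorm p q Ω M ν F ≤ (c * d : ℝ≥0) * mixedNorm p q Ω' M' ν F := by
  rw [mixedNorm, mixedNorm, mul_comm, ← eLpNorm_mul_const_ennreal _ ENNReal.coe_ne_top]
  refine eLpNorm_ennreal_mono fun ξ => ?_
  have h1 : eLpNorm (fun x => F (x, ξ) * Ω x) p volume
      ≤ eLpNorm (fun x => F (x, ξ) * Ω' x) p volume * c := by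
    rw [← eLpNorm_mul_const_ennreal _ ENNReal.coe_ne_top]
    refine eLpNorm_ennreal_mono fun x => ?_
    rw [mul_assoc, mul_comm _ (c : ℝ≥0∞)]
    gcongr
    exact hΩ x
  refine (mul_le_mul' h1 (hM ξ)).trans (le_of_eq ?_)
  push_cast
  ring

theorem stftNorm_eq_mixedNorm {p q : ℝ≥0∞} {m ω : 𝔼 → ℝ} (hω : ∀ x, 0 ≤ ω x) (ν : Measure 𝔼)
    (γ : 𝓢(𝔼, ℂ)) (f : 𝓢'(𝔼, ℂ)) :
    stftNorm p q m ω ν γ f = mixedNorm p q (fun x => ENNReal.ofReal (ω x))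
      (fun ξ => ENNReal.ofReal (m ξ)) ν fun z => ‖stft γ f z.1 z.2‖ₑ := by
  simp_rw [stftNorm, weightedLpNorm_eq hω]
  rfl

/-- The norm with rough weights is equivalent to one with regular weights. -/
theorem exists_regularWeight_stftNorm (p q : ℝ≥0∞) {m ω : 𝔼 → ℝ} (hm : IsPolyModerate m)
    (hω : IsPolyModerate ω) :
    ∃ Ω M : 𝔼 → ℝ≥0∞, IsRegularWeight Ω ∧ IsRegularWeight M ∧
      (∀ x, ENNReal.ofReal (ω x) ≤ Ω x) ∧ (∀ ξ, ENNReal.ofReal (m ξ) ≤ M ξ) ∧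
      ∃ c : ℝ≥0, ∀ (ν : Measure 𝔼) (γ : 𝓢(𝔼, ℂ)) (f : 𝓢'(𝔼, ℂ)),
        stftNorm p q m ω ν γ f ≤ mixedNorm p q Ω M ν (fun z => ‖stft γ f z.1 z.2‖ₑ) ∧
        mixedNorm p q Ω M ν (fun z => ‖stft γ f z.1 z.2‖ₑ) ≤ c * stftNorm p q m ω ν γ f := by
  obtain ⟨Ω, hΩ, c, hc⟩ := hω.exists_regularWeight
  obtain ⟨M, hM, d, hd⟩ := hm.exists_regularWeight
  refine ⟨Ω, M, hΩ, hM, fun x => (hc x).1, fun x => (hd x).1, c * d, fun ν γ f => ?_⟩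
  rw [stftNorm_eq_mixedNorm hω.nonneg]
  refine ⟨?_, mixedNorm_mono_weight (fun x => (hc x).2) (fun x => (hd x).2) ν _⟩
  simpa using mixedNorm_mono_weight (p := p) (q := q) (c := 1) (d := 1)
    (fun x => by simpa using (hc x).1) (fun x => by simpa using (hd x).1) ν _

theorem IsReproducing.exists_stftNorm_le {p q : ℝ≥0∞} (hp : p ≠ 0) (hq : q ≠ 0)
    {m ω : 𝔼 → ℝ} (hm : IsPolyModerate m) (hω : IsPolyModerate ω)
    {ν₁ ν₂ : Measure 𝔼} [SFinite ν₁] [SFinite ν₂]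
    (hν₁ : UniformlyFinite ν₁) (hν₂ : UniformlyFinite ν₂) {a b : 𝓢(𝔼, ℂ)}
    (hab : IsReproducing ν₂ a b) (γ : 𝓢(𝔼, ℂ)) :
    ∃ C : ℝ≥0, ∀ f, stftNorm p q m ω ν₁ γ f ≤ C * stftNorm p q m ω ν₂ b f := by
  obtain ⟨Ω, M, hΩ, hM, -, -, c, hc⟩ := exists_regularWeight_stftNorm p q hm hω
  obtain ⟨C, hC⟩ := hab.exists_mixedNorm_stft_le hp hq hΩ hM hν₁ hν₂ γ
  refine ⟨C * c, fun f => ((hc ν₁ γ f).1.trans (hC f)).trans ?_⟩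
  rw [ENNReal.coe_mul, mul_assoc]
  gcongr
  exact (hc ν₂ b f).2

/-! ### Quasi-norm properties -/

theorem exists_mixedNorm_add_le (p q : ℝ≥0∞) : ∃ K : ℝ≥0, ∀ {Ω M : 𝔼 → ℝ≥0∞},
    Measurable Ω → Measurable M → ∀ (ν : Measure 𝔼) [SFinite ν] {F G : 𝔼 × 𝔼 → ℝ≥0∞},
    Measurable F → Measurable G →
    mixedNorm p q Ω M ν (F + G) ≤ K * (mixedNorm p q Ω M ν F + mixedNorm p q Ω M ν G) := by
  refine ⟨(ENNReal.LpAddConst p).toNNReal * (ENNReal.LpAddConst q).toNNReal, ?_⟩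
  intro Ω M hΩ hM ν _ F G hF hG
  have hp := ENNReal.coe_toNNReal (ENNReal.LpAddConst_lt_top p).ne
  have hq := ENNReal.coe_toNNReal (ENNReal.LpAddConst_lt_top q).ne
  have hFm : Measurable fun ξ => eLpNorm (fun x => F (x, ξ) * Ω x) p volume * M ξ :=
    (measurable_eLpNorm_ennreal p (hF.mul (hΩ.comp measurable_fst))).mul hM
  have hGm : Measurable fun ξ => eLpNorm (fun x => G (x, ξ) * Ω x) p volume * M ξ :=
    (measurable_eLpNorm_ennreal p (hG.mul (hΩ.comp measurable_fst))).mul hM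
  have h1 : ∀ ξ, eLpNorm (fun x => (F + G) (x, ξ) * Ω x) p volume * M ξ
      ≤ (eLpNorm (fun x => F (x, ξ) * Ω x) p volume * M ξ
        + eLpNorm (fun x => G (x, ξ) * Ω x) p volume * M ξ) * (ENNReal.LpAddConst p).toNNReal := by
    intro ξ
    have h2 := eLpNorm_add_le' (μ := (volume : Measure 𝔼)) (f := fun x => F (x, ξ) * Ω x)
      (g := fun x => G (x, ξ) * Ω x)
      ((hF.comp measurable_prodMk_right).mul hΩ).aestronglyMeasurable
      ((hG.comp measurable_prodMk_right).mul hΩ).aestronglyMeasurable p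
    have h3 : (fun x => (F + G) (x, ξ) * Ω x)
        = (fun x => F (x, ξ) * Ω x) + fun x => G (x, ξ) * Ω x := by
      ext1 x
      simp [add_mul]
    rw [h3, hp, ← add_mul, mul_right_comm, mul_comm _ (ENNReal.LpAddConst p)]
    gcongr
  refine (eLpNorm_ennreal_mono h1).trans ?_
  rw [eLpNorm_mul_const_ennreal _ ENNReal.coe_ne_top, ENNReal.coe_mul, mul_comm, mul_assoc, hq]
  gcongr
  exact eLpNorm_add_le' hFm.aestronglyMeasurable hGm.aestronglyMeasurable q

theorem stft_smul (γ : 𝓢(𝔼, ℂ)) (c : ℂ) (f : 𝓢'(𝔼, ℂ)) (x ξ : 𝔼) :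
    stft γ (c • f) x ξ = c * stft γ f x ξ := rfl

theorem exists_stftNorm_add_le (p q : ℝ≥0∞) {m ω : 𝔼 → ℝ} (hm : IsPolyModerate m)
    (hω : IsPolyModerate ω) (ν : Measure 𝔼) [SFinite ν] (γ : 𝓢(𝔼, ℂ)) :
    ∃ K : ℝ≥0, ∀ f g, stftNorm p q m ω ν γ (f + g)
      ≤ K * (stftNorm p q m ω ν γ f + stftNorm p q m ω ν γ g) := by
  obtain ⟨Ω, M, hΩ, hM, -, -, c, hc⟩ := exists_regularWeight_stftNorm p q hm hω
  obtain ⟨K, hK⟩ := exists_mixedNorm_add_le (n := n) p q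
  refine ⟨K * c, fun f g => (hc ν γ (f + g)).1.trans ?_⟩
  have hmeas : ∀ f : 𝓢'(𝔼, ℂ), Measurable fun z : 𝔼 × 𝔼 => ‖stft γ f z.1 z.2‖ₑ :=
    fun f => (continuous_stft γ f).measurable.enorm
  have h1 : mixedNorm p q Ω M ν (fun z => ‖stft γ (f + g) z.1 z.2‖ₑ)
      ≤ mixedNorm p q Ω M ν ((fun z => ‖stft γ f z.1 z.2‖ₑ) + fun z => ‖stft γ g z.1 z.2‖ₑ) := by
    refine eLpNorm_ennreal_mono fun ξ => mul_le_mul_left (eLpNorm_ennreal_mono fun x => ?_) _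
    gcongr
    exact enorm_add_le _ _
  refine h1.trans ((hK hΩ.measurable hM.measurable ν (hmeas f) (hmeas g)).trans ?_)
  rw [ENNReal.coe_mul, mul_assoc, mul_add (c : ℝ≥0∞)]
  gcongr
  · exact (hc ν γ f).2
  · exact (hc ν γ g).2

theorem stftNorm_smul (p q : ℝ≥0∞) (m ω : 𝔼 → ℝ) (ν : Measure 𝔼) (γ : 𝓢(𝔼, ℂ)) (c : ℂ)
    (f : 𝓢'(𝔼, ℂ)) : stftNorm p q m ω ν γ (c • f) = ‖c‖ₑ * stftNorm p q m ω ν γ f := by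
  have h1 : ∀ ξ, weightedLpNorm p ω (fun x => stft γ (c • f) x ξ)
      = ‖c‖ₑ * weightedLpNorm p ω (fun x => stft γ f x ξ) := fun ξ => by
    rw [weightedLpNorm, weightedLpNorm, ← eLpNorm_const_smul]
    congr 1
    ext1 x
    simp [stft_smul, mul_assoc]
  rw [stftNorm, stftNorm, mul_comm, ← eLpNorm_mul_const_ennreal _ enorm_ne_top]
  simp_rw [h1]
  congr 1
  ext1 ξ
  ring

/-- Moderateness bounds every value by a multiple of the value at `x`, so a single zero forces `w =
0`. -/
theorem IsPolyModerate.pos {w : 𝔼 → ℝ} (hw : IsPolyModerate w) (h0 : w ≠ 0) (x : 𝔼) : 0 < w x := by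
  obtain ⟨y, hy⟩ := Function.ne_iff.1 h0
  obtain ⟨v, C, h⟩ := hw.moderate
  refine (hw.nonneg x).lt_of_ne fun hx => hy (le_antisymm ?_ (hw.nonneg y))
  simpa [← hx] using h (y - x) x

/-- Positive weights can be cancelled, and continuity of the transform upgrades almost every `x` to
every `x`. -/
theorem stft_eq_zero_of_stftNorm_eq_zero {p q : ℝ≥0∞} (hp : p ≠ 0) (hq : q ≠ 0) {m ω : 𝔼 → ℝ}
    (hm : IsPolyModerate m) (hω : IsPolyModerate ω) (hm0 : m ≠ 0) (hω0 : ω ≠ 0) {ν : Measure 𝔼}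
    {γ : 𝓢(𝔼, ℂ)} {f : 𝓢'(𝔼, ℂ)} (h : stftNorm p q m ω ν γ f = 0) :
    ∀ᵐ ξ ∂ν, ∀ x, stft γ f x ξ = 0 := by
  obtain ⟨Ω, M, hΩ, hM, hωΩ, hmM, c, hc⟩ := exists_regularWeight_stftNorm p q hm hω
  have h0 : mixedNorm p q Ω M ν (fun z => ‖stft γ f z.1 z.2‖ₑ) = 0 := by
    simpa [h] using (hc ν γ f).2
  have hmeas : Measurable fun z : 𝔼 × 𝔼 => ‖stft γ f z.1 z.2‖ₑ :=
    (continuous_stft γ f).measurable.enorm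
  have hout : Measurable fun ξ => eLpNorm (fun x => ‖stft γ f x ξ‖ₑ * Ω x) p volume * M ξ :=
    (measurable_eLpNorm_ennreal p (hmeas.mul (hΩ.measurable.comp measurable_fst))).mul
      hM.measurable
  rw [mixedNorm, eLpNorm_eq_zero_iff hout.aestronglyMeasurable hq] at h0
  filter_upwards [h0] with ξ hξ
  have hMξ : M ξ ≠ 0 := fun h => (ENNReal.ofReal_pos.2 (hm.pos hm0 ξ)).not_ge (h ▸ hmM ξ)
  have h1 := (mul_eq_zero.1 hξ).resolve_right hMξ
  have hin : Measurable fun x => ‖stft γ f x ξ‖ₑ * Ω x :=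
    (hmeas.comp measurable_prodMk_right).mul hΩ.measurable
  rw [eLpNorm_eq_zero_iff hin.aestronglyMeasurable hp] at h1
  have h2 : (fun x => stft γ f x ξ) =ᵐ[volume] fun _ => 0 := by
    filter_upwards [h1] with x hx
    have hΩx : Ω x ≠ 0 := fun h => (ENNReal.ofReal_pos.2 (hω.pos hω0 x)).not_ge (h ▸ hωΩ x)
    simpa using (mul_eq_zero.1 hx).resolve_right hΩx
  have h3 := (continuous_stft γ f).comp (Continuous.prodMk_left ξ)
  exact congrFun ((Continuous.ae_eq_iff_eq volume h3 continuous_const).1 h2)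

theorem IsReproducing.eq_zero_of_stftNorm_eq_zero {p q : ℝ≥0∞} (hp : p ≠ 0) (hq : q ≠ 0)
    {m ω : 𝔼 → ℝ} (hm : IsPolyModerate m) (hω : IsPolyModerate ω) (hm0 : m ≠ 0) (hω0 : ω ≠ 0)
    {ν : Measure 𝔼} [SFinite ν] (hν : UniformlyFinite ν) {a b : 𝓢(𝔼, ℂ)}
    (hab : IsReproducing ν a b) {f : 𝓢'(𝔼, ℂ)} (h : stftNorm p q m ω ν b f = 0) : f = 0 := by
  have h1 := stft_eq_zero_of_stftNorm_eq_zero hp hq hm hω hm0 hω0 h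
  have h2 : ∀ᵐ w ∂((volume : Measure 𝔼).prod ν), stft b f w.1 w.2 = 0 := by
    filter_upwards [Measure.quasiMeasurePreserving_snd.ae h1] with w hw
    exact hw w.1
  refine DFunLike.ext _ _ fun ψ => ?_
  -- Every value of `f` is a short-time Fourier transform at the origin, for a suitable window, so
  -- the reproducing formula computes it from `V_b f`.
  have h3 : f ψ = stft (conjSchwartz ψ) f 0 0 := by
    rw [stft, timeFreqShift_zero_zero]
    congr 1
    ext t
    simp [conjSchwartz_apply]
  rw [h3, hab.stft_eq_integral hν, integral_eq_zero_of_ae]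
  · rfl
  · filter_upwards [h2] with w hw
    simp [hw]

/-- The two inequalities are one comparison theorem, with the roles of `(φ, volume)` and `(𝓕⁻ σ₀,
lattice)` exchanged. -/
theorem areEquivalent_discreteModulationNorm {p q : ℝ≥0∞} (hp : p ≠ 0) (hq : q ≠ 0)
    {m ω : 𝔼 → ℝ} (hm : IsPolyModerate m) (hω : IsPolyModerate ω) {φ : 𝓢(𝔼, ℂ)} (hφ : φ ≠ 0)
    {ρ : 𝔼 → ℝ} (hρ : IsCubeBump ρ) :
    AreEquivalent (discreteModulationNorm p q m ω ρ) (modulationNorm p q m ω φ) := by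
  obtain ⟨a, ha⟩ := exists_isReproducing_latticeMeasure hρ
  obtain ⟨a', ha'⟩ := exists_isReproducing_volume hφ
  obtain ⟨C, hC⟩ := ha.exists_stftNorm_le hp hq hm hω uniformlyFinite_volume
    uniformlyFinite_latticeMeasure φ
  obtain ⟨C', hC'⟩ := ha'.exists_stftNorm_le hp hq hm hω uniformlyFinite_latticeMeasure
    uniformlyFinite_volume (boxWindow hρ)
  refine ⟨max C C', fun f => ?_⟩
  rw [discreteModulationNorm_eq_stftNorm hq m ω hρ, modulationNorm_eq_stftNorm]
  refine ⟨(hC' f).trans ?_, (hC f).trans ?_⟩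
  · gcongr
    exact le_max_right _ _
  · gcongr
    exact le_max_left _ _

theorem isQuasiNormOn_discreteModulationNorm {p q : ℝ≥0∞} (hp : p ≠ 0) (hq : q ≠ 0)
    {m ω : 𝔼 → ℝ} (hm : IsPolyModerate m) (hω : IsPolyModerate ω) (hm0 : m ≠ 0) (hω0 : ω ≠ 0)
    {φ : 𝓢(𝔼, ℂ)} (hφ : φ ≠ 0) {ρ : 𝔼 → ℝ} (hρ : IsCubeBump ρ) :
    IsQuasiNormOn (modulationSpace p q m ω φ) (discreteModulationNorm p q m ω ρ) := by
  have hsmul : ∀ (c : ℂ) (f : 𝓢'(𝔼, ℂ)), modulationNorm p q m ω φ (c • f)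
      = ‖c‖ₑ * modulationNorm p q m ω φ f := stftNorm_smul p q m ω volume φ
  have hsmul' : ∀ (c : ℂ) (f : 𝓢'(𝔼, ℂ)), discreteModulationNorm p q m ω ρ (c • f)
      = ‖c‖ₑ * discreteModulationNorm p q m ω ρ f := by
    simp_rw [discreteModulationNorm_eq_stftNorm hq m ω hρ]
    exact stftNorm_smul p q m ω _ _
  refine ⟨?_, fun f hf g hg => ?_, fun c f hf => ?_, fun f hf => ?_, fun f _ => ⟨fun h => ?_, ?_⟩,
    fun c f _ => hsmul' c f, ?_⟩
  · change modulationNorm p q m ω φ 0 < ∞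
    rw [← zero_smul ℂ (0 : 𝓢'(𝔼, ℂ)), hsmul, enorm_zero, zero_mul]
    exact ENNReal.zero_lt_top
  · obtain ⟨K, hK⟩ := exists_stftNorm_add_le p q hm hω volume φ
    exact (hK f g).trans_lt (ENNReal.mul_lt_top ENNReal.coe_lt_top (ENNReal.add_lt_top.2 ⟨hf, hg⟩))
  · exact (hsmul c f).trans_lt (ENNReal.mul_lt_top enorm_lt_top hf)
  · obtain ⟨C, hC⟩ := areEquivalent_discreteModulationNorm hp hq hm hω hφ hρ
    exact (hC f).1.trans_lt (ENNReal.mul_lt_top ENNReal.coe_lt_top hf)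
  · obtain ⟨a, ha⟩ := exists_isReproducing_latticeMeasure hρ
    rw [discreteModulationNorm_eq_stftNorm hq m ω hρ] at h
    exact ha.eq_zero_of_stftNorm_eq_zero hp hq hm hω hm0 hω0 uniformlyFinite_latticeMeasure h
  · rintro rfl
    rw [← zero_smul ℂ (0 : 𝓢'(𝔼, ℂ)), hsmul', enorm_zero, zero_mul]
  · obtain ⟨K, hK⟩ := exists_stftNorm_add_le p q hm hω (latticeMeasure n) (boxWindow hρ)
    refine ⟨K, fun f _ g _ => ?_⟩
    simp_rw [discreteModulationNorm_eq_stftNorm hq m ω hρ]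
    exact hK f g

end ModulationSpaces

end

theorem proposition2p1 (n : ℕ) (p q : ℝ≥0∞) (hp : p ≠ 0) (hq : q ≠ 0)
    (m ω : EuclideanSpace ℝ (Fin n) → ℝ)
    (hm : ModulationSpaces.IsPolyModerate m) (hω : ModulationSpaces.IsPolyModerate ω)
    (φ : 𝓢(EuclideanSpace ℝ (Fin n), ℂ)) (hφ : φ ≠ 0)
    (ρ : EuclideanSpace ℝ (Fin n) → ℝ) (hρ : ModulationSpaces.IsCubeBump ρ) :
    ModulationSpaces.AreEquivalent
        (ModulationSpaces.discreteModulationNorm p q m ω ρ)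
        (ModulationSpaces.modulationNorm p q m ω φ) ∧
      (m ≠ 0 → ω ≠ 0 →
        ModulationSpaces.IsQuasiNormOn (ModulationSpaces.modulationSpace p q m ω φ)
          (ModulationSpaces.discreteModulationNorm p q m ω ρ)) := by
  exact ⟨ModulationSpaces.areEquivalent_discreteModulationNorm hp hq hm hω hφ hρ, fun hm0 hω0 =>
    ModulationSpaces.isQuasiNormOn_discreteModulationNorm hp hq hm hω hm0 hω0 hφ hρ⟩
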